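/- Let $n\ge 1$, $K\ge 2$ be integers, $c\in\mathbb R$, $f\in C^K(\mathbb R^n;\mathbb R^n)$, and let $\bar u:\mathbb R\to\mathbb R^n$ be a non-constant $1$-periodic solution of $\bar u''+c\bar u'+f(\bar u)=0$, i.e. a standing wave of $u_t-cu_x=u_{xx}+f(u)$. For real $\xi$ let $$L_\xi=(\partial_x+i\xi)^2+c(\partial_x+i\xi)+df(\bar u)$$ be the Bloch operators on $L^2_{\rm per}([0,1];\mathbb C^n)$ with domain $H^2_{\rm per}$. Assume (D1) $0$ is an (algebraically) simple eigenvalue of $L_0$; (D2) there is $\theta>0$ with $\Re\,\sigma(L_\xi)\le-\theta|\xi|^2$ for all $\xi\in[-\pi,\pi]$. A *critical branch* on $|\xi|<\delta$ ($\delta>0$) is a family $(\mu(\xi),q(\cdot,\xi),\tilde q(\cdot,\xi))$, real-analytic in $\xi\in(-\delta,\delta)$ (with $q,\tilde q$ valued in continuous $1$-periodic functions), where $\mu(\xi)\in\mathbb C$ is an eigenvalue of $L_\xi$ with right eigenfunction $q(\cdot,\xi)$ (column vector) and left eigenfunction $\tilde q(\cdot,\xi)$ (row vector: $\int_0^1\tilde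 q\,L_\xi w\,dx=\mu(\xi)\int_0^1\tilde q\,w\,dx$ for all $w\in H^2_{\rm per}$), with $\mu(0)=0$, $q(\cdot,0)=\bar u'$ and $\int_0^1\tilde q(x,\xi)q(x,\xi)\,dx=1$. Then a critical branch exists for some $\delta>0$. Moreover, for every critical branch on $|\xi|<\delta$ there is $\varepsilon_0\in(0,\delta/2)$ such that the following holds for every $\varepsilon\in(0,\varepsilon_0]$ and every smooth $\phi:\mathbb R\to\mathbb R$ with $\phi=1$ for $|\xi|\le\varepsilon$ and $\phi=0$ for $|\xi|\ge2\varepsilon$. Let $P(\xi)$ be the eigenprojection of $L_\xi$ at $\mu(\xi)$, let $\hat g(\eta)=\int_{\mathbb R} e^{-i\eta x}g(x)\,dx$ and $\hat g(\xi,x)=\sum_{j\in\mathbb Z}e^{2\pi ijx}\hat g(\xi+2\pi j)$ for Schwartz $g:\mathbb R\to\mathbb C^n$, and $$S^I(t)g(x)=\frac1{2\pi}\int_{-\pi}^{\pi}e^{i\xi x}\phi(\xi)P(\xi)e^{L_\xi t}\hat g(\xi,x)\,d\xi,\qquad \tilde e(x,t;y)=\frac1{2\pi}\int_{\mathbb R}e^{i\xi(x-y)}\phi(\xi)e^{\mu(\xi)t}\tilde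 q(y,\xi)\,d\xi .$$ For $t>0$ the operator $S^I(t)$ has an integral kernel $G^I(x,t;y)=S^I(t)\delta_y(x)$, continuous in $(x,y)$, and it decomposes as $$G^I(x,t;y)=\bar u'(x)\,\tilde e(x,t;y)+\widetilde G^I(x,t;y),$$ where, with a constant $C$ independent of $t$ and $p$, for all $t>0$ and $2\le p\le\infty$, $$\sup_y\|\widetilde G^I(\cdot,t;y)\|_{L^p(\mathbb R)}\le C(1+t)^{-\frac12(1-1/p)-\frac12}.$$ Moreover $\partial_t^k\tilde e$ exists and is of class $C^{K+1}$ in $(x,t,y)\in\mathbb R^3$ for every integer $k\ge0$, and for all integers $j,k,r\ge0$ with $j+r\le K+1$ there is a constant $C$ such that for all $t>0$ and $2\le p\le\infty$, $$\sup_y\|\partial_x^j\partial_t^k\partial_y^r\tilde e(\cdot,t;y)\|_{L^p(\mathbb R)}\le C(1+t)^{-\frac12(1-1/p)-\frac{j+k}2}.$$ -/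

import Mathlib

open MeasureTheory Filter Set
open scoped Topology ENNReal ContDiff SchwartzMap

namespace BlochRD

noncomputable section

/-! ## Unbounded operators: spectrum, algebraic simplicity, eigenprojections, semigroups -/

section Abstract

variable {H : Type*} [NormedAddCommGroup H] [NormedSpace ℂ H]

/-- `R` is the bounded two-sided inverse `(lam - A)⁻¹` of `lam - A : D(A) → H`. -/
def IsResolventAt (A : H →ₗ.[ℂ] H) (lam : ℂ) (R : H →L[ℂ] H) : Prop :=
  (∀ h : H, ∃ hd : R h ∈ A.domain, lam • R h - A ⟨R h, hd⟩ = h) ∧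
  ∀ w : A.domain, R (lam • (w : H) - A w) = w

/-- The spectrum of an unbounded operator. -/
def opSpectrum (A : H →ₗ.[ℂ] H) : Set ℂ :=
  {lam | ¬ ∃ R : H →L[ℂ] H, IsResolventAt A lam R}

/-- The kernel of `(A - lam)^m` (with its natural domain). -/
def genKernel (A : H →ₗ.[ℂ] H) (lam : ℂ) : ℕ → Set H
  | 0 => {0}
  | m + 1 => {h | ∃ hd : h ∈ A.domain, A ⟨h, hd⟩ - lam • h ∈ genKernel A lam m}

/-- The generalized eigenspace (root space) of `A` at `lam`. -/
def genEigenspace (A : H →ₗ.[ℂ] H) (lam : ℂ) : Set H :=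
  {h | ∃ m : ℕ, h ∈ genKernel A lam m}

/-- `lam` is an (algebraically) simple eigenvalue of `A`: the generalized eigenspace is
one-dimensional. -/
def IsSimpleEigenvalue (A : H →ₗ.[ℂ] H) (lam : ℂ) : Prop :=
  ∃ v : H, v ≠ 0 ∧ ∀ h : H, h ∈ genEigenspace A lam ↔ ∃ a : ℂ, h = a • v

/-- `P` is the (total) eigenprojection of `A` at the isolated eigenvalue `lam`: a bounded
projection that commutes with `A`, whose range is the generalized eigenspace, and such that
`lam - A` is invertible on the complementary invariant subspace `ker P`. -/
structure IsEigenprojection (A : H →ₗ.[ℂ] H) (lam : ℂ) (P : H →L[ℂ] H) : Prop where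
  idem : ∀ h : H, P (P h) = P h
  comm : ∀ w : A.domain, ∃ hd : P w ∈ A.domain, A ⟨P w, hd⟩ = P (A w)
  range : ∀ h : H, P h = h ↔ h ∈ genEigenspace A lam
  compl : ∀ h : H, P h = 0 → ∃! w : A.domain, P w = 0 ∧ lam • (w : H) - A w = h

open Classical in
/-- The eigenprojection of `A` at `lam` (zero if there is none). -/
def eigenprojection (A : H →ₗ.[ℂ] H) (lam : ℂ) : H →L[ℂ] H :=
  if h : ∃ P : H →L[ℂ] H, IsEigenprojection A lam P then h.choose else 0

/-- `T` restricted to `t ≥ 0` is the strongly continuous semigroup whose infinitesimal generator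
is exactly `A` (same domain). -/
structure IsSemigroupOf (A : H →ₗ.[ℂ] H) (T : ℝ → H →L[ℂ] H) : Prop where
  zero : T 0 = ContinuousLinearMap.id ℂ H
  add : ∀ s t : ℝ, 0 ≤ s → 0 ≤ t → T (s + t) = (T s).comp (T t)
  cont : ∀ h : H, Tendsto (fun t => T t h) (𝓝[>] 0) (𝓝 h)
  gen : ∀ h z : H,
    Tendsto (fun t : ℝ => ((t : ℂ)⁻¹) • (T t h - h)) (𝓝[>] 0) (𝓝 z) ↔ (h, z) ∈ A.graph

open Classical in
/-- The semigroup `e^{A t}` generated by `A` (zero if `A` is not a generator). Only the values at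
`t ≥ 0` are meaningful; they are determined by `A`. -/
def expSemigroup (A : H →ₗ.[ℂ] H) : ℝ → H →L[ℂ] H :=
  if h : ∃ T : ℝ → H →L[ℂ] H, IsSemigroupOf A T then h.choose else 0

end Abstract

/-! ## Periodic `L²` and the Bloch operators -/

/-- `ℂⁿ`. -/
abbrev Cn (n : ℕ) : Type := EuclideanSpace ℂ (Fin n)

/-- `L²_per([0,1]; ℂⁿ)`. -/
abbrev L2per (n : ℕ) : Type :=
  Lp (Cn n) 2 (AddCircle.haarAddCircle : Measure UnitAddCircle)

/-- Inclusion `ℝⁿ → ℂⁿ`. -/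
def toCn {n : ℕ} (v : EuclideanSpace ℝ (Fin n)) : Cn n :=
  WithLp.toLp 2 fun i => ((v i : ℝ) : ℂ)

/-- The Jacobian `df(u)` acting on `ℂⁿ`. -/
def jac {n : ℕ} (f : EuclideanSpace ℝ (Fin n) → EuclideanSpace ℝ (Fin n))
    (v : EuclideanSpace ℝ (Fin n)) : Cn n →L[ℂ] Cn n :=
  Matrix.toEuclideanCLM (𝕜 := ℂ) (Matrix.of fun i j =>
    (((fderiv ℝ f v (EuclideanSpace.single j (1 : ℝ))) i : ℝ) : ℂ))

/-- The coefficient `x ↦ df(u(x))` as a function on the circle (`u` is meant to be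
`1`-periodic). -/
def coeffA {n : ℕ} (f : EuclideanSpace ℝ (Fin n) → EuclideanSpace ℝ (Fin n))
    (u : ℝ → EuclideanSpace ℝ (Fin n)) : UnitAddCircle → (Cn n →L[ℂ] Cn n) :=
  AddCircle.liftIco 1 0 fun x => jac f (u x)

/-- `v` is the weak derivative of `w` in `L²_per`, tested against the periodic exponentials
`e^{-2πijx}`, `j ∈ ℤ`. -/
def IsPerDeriv {n : ℕ} (w v : L2per n) : Prop :=
  ∀ j : ℤ, fourierCoeff (v : UnitAddCircle → Cn n) j =
    (2 * Real.pi * Complex.I * j : ℂ) • fourierCoeff (w : UnitAddCircle → Cn n) j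

section Helpers

variable {n : ℕ}

lemma integrable_L2per (w : L2per n) :
    Integrable (w : UnitAddCircle → Cn n) AddCircle.haarAddCircle :=
  (Lp.memLp w).integrable (by norm_num)

lemma fourierCoeff_L2per_add (w v : L2per n) (j : ℤ) :
    fourierCoeff ((w + v : L2per n) : UnitAddCircle → Cn n) j =
      fourierCoeff (w : UnitAddCircle → Cn n) j + fourierCoeff (v : UnitAddCircle → Cn n) j := by
  rw [fourierCoeff_congr_ae (Lp.coeFn_add w v),
    fourierCoeff.add (integrable_L2per w) (integrable_L2per v), Pi.add_apply]

lemma fourierCoeff_L2per_smul (a : ℂ) (w : L2per n) (j : ℤ) :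
    fourierCoeff ((a • w : L2per n) : UnitAddCircle → Cn n) j =
      a • fourierCoeff (w : UnitAddCircle → Cn n) j := by
  rw [fourierCoeff_congr_ae (Lp.coeFn_smul a w), fourierCoeff.const_smul]

lemma fourierCoeff_L2per_zero (j : ℤ) :
    fourierCoeff ((0 : L2per n) : UnitAddCircle → Cn n) j = 0 := by
  have := fourierCoeff_L2per_smul (n := n) 0 0 j
  simpa using this

lemma L2per_eq_zero {w : L2per n}
    (h : ∀ j : ℤ, fourierCoeff (w : UnitAddCircle → Cn n) j = 0) : w = 0 := by
  have key : ∀ i : Fin n, ∀ᵐ x ∂(AddCircle.haarAddCircle : Measure UnitAddCircle),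
      (w : UnitAddCircle → Cn n) x i = 0 := by
    intro i
    have hm : MemLp (fun x => (w : UnitAddCircle → Cn n) x i) 2
        (AddCircle.haarAddCircle : Measure UnitAddCircle) :=
      (PiLp.proj (𝕜 := ℂ) 2 (fun _ : Fin n => ℂ) i).comp_memLp' (Lp.memLp w)
    have hz : hm.toLp _ = 0 := by
      apply (fourierBasis (T := (1 : ℝ))).repr.injective
      ext j
      rw [map_zero, fourierBasis_repr, fourierCoeff_congr_ae hm.coeFn_toLp]
      have h1 := congrArg (PiLp.proj (𝕜 := ℂ) 2 (fun _ : Fin n => ℂ) i) (h j)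
      rw [fourierCoeff, ← ContinuousLinearMap.integral_comp_comm _
        ((integrable_L2per w).fourier_smul (-j)), map_zero] at h1
      simpa [fourierCoeff] using h1
    have h2 := hm.coeFn_toLp
    rw [hz] at h2
    filter_upwards [h2, Lp.coeFn_zero ℂ 2 (AddCircle.haarAddCircle : Measure UnitAddCircle)]
      with x hx hx0
    rw [← hx, hx0]; rfl
  apply Lp.ext
  filter_upwards [ae_all_iff.2 key, Lp.coeFn_zero (Cn n) 2
    (AddCircle.haarAddCircle : Measure UnitAddCircle)] with x hx hx0
  rw [hx0]
  ext i
  simpa using hx i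

lemma IsPerDeriv.eq_zero {v : L2per n} (h : IsPerDeriv 0 v) : v = 0 :=
  L2per_eq_zero fun j => by rw [h j, fourierCoeff_L2per_zero, smul_zero]

end Helpers

/-- The graph of the Bloch operator
`L_ξ = e^{-iξx} (∂_x² + c ∂_x + A(x)) e^{iξx} = (∂_x + iξ)² + c (∂_x + iξ) + A(x)`
on `L²_per`, with domain `H²_per` (`v₁ = w'`, `v₂ = w''`). -/
def blochGraph {n : ℕ} (c : ℝ) (A : UnitAddCircle → (Cn n →L[ℂ] Cn n)) (ξ : ℝ) :
    Submodule ℂ (L2per n × L2per n) where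
  carrier := {wz | ∃ v₁ v₂ : L2per n, IsPerDeriv wz.1 v₁ ∧ IsPerDeriv v₁ v₂ ∧
    ∀ᵐ x ∂(AddCircle.haarAddCircle : Measure UnitAddCircle),
      wz.2 x = (v₂ x + (2 * Complex.I * ξ) • v₁ x + ((Complex.I * ξ) ^ 2) • wz.1 x)
        + (c : ℂ) • (v₁ x + (Complex.I * ξ) • wz.1 x) + A x (wz.1 x)}
  add_mem' := by
    rintro ⟨w, z⟩ ⟨w', z'⟩ ⟨v₁, v₂, h₁, h₂, h⟩ ⟨v₁', v₂', h₁', h₂', h'⟩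
    refine ⟨v₁ + v₁', v₂ + v₂', ?_, ?_, ?_⟩
    · intro j
      simp only [Prod.mk_add_mk, fourierCoeff_L2per_add, h₁ j, h₁' j, smul_add]
    · intro j
      simp only [fourierCoeff_L2per_add, h₂ j, h₂' j, smul_add]
    · filter_upwards [h, h', Lp.coeFn_add z z', Lp.coeFn_add w w', Lp.coeFn_add v₁ v₁',
        Lp.coeFn_add v₂ v₂'] with x a a' b₁ b₂ b₃ b₄
      simp only [Prod.mk_add_mk, b₁, b₂, b₃, b₄, Pi.add_apply, map_add, smul_add] at a a' ⊢
      rw [a, a']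
      abel
  zero_mem' := by
    refine ⟨0, 0, ?_, ?_, ?_⟩
    · intro j
      rw [Prod.fst_zero, fourierCoeff_L2per_zero, smul_zero]
    · intro j
      rw [fourierCoeff_L2per_zero, smul_zero]
    · filter_upwards [Lp.coeFn_zero (Cn n) 2
        (AddCircle.haarAddCircle : Measure UnitAddCircle)] with x hx
      rw [Prod.fst_zero, Prod.snd_zero, hx]
      simp
  smul_mem' := by
    rintro a ⟨w, z⟩ ⟨v₁, v₂, h₁, h₂, h⟩
    refine ⟨a • v₁, a • v₂, ?_, ?_, ?_⟩
    · intro j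
      simp only [Prod.smul_mk, fourierCoeff_L2per_smul, h₁ j]
      rw [smul_comm]
    · intro j
      simp only [fourierCoeff_L2per_smul, h₂ j]
      rw [smul_comm]
    · filter_upwards [h, Lp.coeFn_smul a z, Lp.coeFn_smul a w, Lp.coeFn_smul a v₁,
        Lp.coeFn_smul a v₂] with x b b₁ b₂ b₃ b₄
      simp only [Prod.smul_mk, b₁, b₂, b₃, b₄, Pi.smul_apply, map_smul] at b ⊢
      rw [b]
      module

/-- The Bloch operator `L_ξ` as an unbounded operator on `L²_per`. -/
def blochOp {n : ℕ} (c : ℝ) (A : UnitAddCircle → (Cn n →L[ℂ] Cn n)) (ξ : ℝ) :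
    L2per n →ₗ.[ℂ] L2per n :=
  (blochGraph c A ξ).toLinearPMap

lemma blochOp_graph {n : ℕ} (c : ℝ) (A : UnitAddCircle → (Cn n →L[ℂ] Cn n)) (ξ : ℝ) :
    (blochOp c A ξ).graph = blochGraph c A ξ := by
  apply Submodule.toLinearPMap_graph_eq
  rintro ⟨w, z⟩ ⟨v₁, v₂, h₁, h₂, h⟩ hw
  simp only at hw h h₁
  subst hw
  have e₁ := h₁.eq_zero
  subst e₁
  have e₂ := h₂.eq_zero
  subst e₂
  apply Lp.ext
  filter_upwards [h, Lp.coeFn_zero (Cn n) 2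
    (AddCircle.haarAddCircle : Measure UnitAddCircle)] with x hx hx0
  simpa [hx0] using hx

/-- The Bloch operator of the linearization `L = ∂_x² + c ∂_x + df(u)` about the profile `u`. -/
def linBloch {n : ℕ} (c : ℝ) (f : EuclideanSpace ℝ (Fin n) → EuclideanSpace ℝ (Fin n))
    (u : ℝ → EuclideanSpace ℝ (Fin n)) (ξ : ℝ) : L2per n →ₗ.[ℂ] L2per n :=
  blochOp c (coeffA f u) ξ

/-! ## The profile and the spectral hypotheses -/

/-- `u` is a non-constant `1`-periodic standing wave of `u_t - c u_x = u_xx + f(u)`. -/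
structure IsPeriodicProfile {n : ℕ} (c : ℝ)
    (f : EuclideanSpace ℝ (Fin n) → EuclideanSpace ℝ (Fin n))
    (u : ℝ → EuclideanSpace ℝ (Fin n)) : Prop where
  smooth : ContDiff ℝ 2 u
  periodic : Function.Periodic u 1
  eqn : ∀ x : ℝ, deriv (deriv u) x + c • deriv u x + f (u x) = 0
  nonconst : ∃ x y : ℝ, u x ≠ u y

/-- Simplicity: `0` is a simple eigenvalue of `L_0`. -/
def CondD1 {n : ℕ} (c : ℝ) (f : EuclideanSpace ℝ (Fin n) → EuclideanSpace ℝ (Fin n))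
    (u : ℝ → EuclideanSpace ℝ (Fin n)) : Prop :=
  IsSimpleEigenvalue (linBloch c f u 0) 0

/-- Diffusive spectral stability: `Re σ(L_ξ) ≤ -θ |ξ|²` for `ξ ∈ [-π, π]`, some `θ > 0`. -/
def CondD2 {n : ℕ} (c : ℝ) (f : EuclideanSpace ℝ (Fin n) → EuclideanSpace ℝ (Fin n))
    (u : ℝ → EuclideanSpace ℝ (Fin n)) : Prop :=
  ∃ θ : ℝ, 0 < θ ∧ ∀ ξ ∈ Icc (-Real.pi) Real.pi, ∀ lam ∈ opSpectrum (linBloch c f u ξ),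
    lam.re ≤ -θ * |ξ| ^ 2

/-! ## The critical eigenvalue branch -/

/-- The class in `L²_per` of a continuous periodic function. -/
def toL2per {n : ℕ} (w : C(UnitAddCircle, Cn n)) : L2per n :=
  ContinuousMap.toLp 2 (AddCircle.haarAddCircle : Measure UnitAddCircle) ℂ w

/-- `(mu, q, qt)` is an analytic family, on `|ξ| < δ`, of eigenvalues `mu ξ` of `L_ξ` bifurcating
from `mu 0 = 0`, with right eigenfunctions `q(·,ξ)` bifurcating from `q(·,0) = u'` and left
eigenfunctions `qt(·,ξ)` (row vectors), normalized by `∫₀¹ qt(x,ξ) q(x,ξ) dx = 1`. -/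
structure IsCriticalBranch {n : ℕ} (c : ℝ)
    (f : EuclideanSpace ℝ (Fin n) → EuclideanSpace ℝ (Fin n))
    (u : ℝ → EuclideanSpace ℝ (Fin n)) (δ : ℝ) (mu : ℝ → ℂ)
    (q : ℝ → C(UnitAddCircle, Cn n)) (qt : ℝ → C(UnitAddCircle, Cn n →L[ℂ] ℂ)) : Prop where
  pos : 0 < δ
  analytic_mu : AnalyticOnNhd ℝ mu (Ioo (-δ) δ)
  analytic_q : AnalyticOnNhd ℝ q (Ioo (-δ) δ)
  analytic_qt : AnalyticOnNhd ℝ qt (Ioo (-δ) δ)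
  mu_zero : mu 0 = 0
  q_zero : ∀ x : ℝ, q 0 (x : UnitAddCircle) = toCn (deriv u x)
  right_eigen : ∀ ξ ∈ Ioo (-δ) δ,
    (toL2per (q ξ), mu ξ • toL2per (q ξ)) ∈ (linBloch c f u ξ).graph
  left_eigen : ∀ ξ ∈ Ioo (-δ) δ, ∀ w : (linBloch c f u ξ).domain,
    ∫ x, qt ξ x ((linBloch c f u ξ w) x) ∂AddCircle.haarAddCircle =
      mu ξ * ∫ x, qt ξ x ((w : L2per n) x) ∂AddCircle.haarAddCircle
  normalized : ∀ ξ ∈ Ioo (-δ) δ, ∫ x, qt ξ x (q ξ x) ∂AddCircle.haarAddCircle = 1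

/-- `φ` is a smooth cut-off with `φ = 1` on `|ξ| ≤ ε` and `φ = 0` on `|ξ| ≥ 2ε`. -/
structure IsCutoff (ε : ℝ) (φ : ℝ → ℝ) : Prop where
  smooth : ContDiff ℝ ∞ φ
  one : ∀ ξ : ℝ, |ξ| ≤ ε → φ ξ = 1
  zero : ∀ ξ : ℝ, 2 * ε ≤ |ξ| → φ ξ = 0

/-! ## The low-frequency solution operator and its kernel -/

/-- The Fourier transform `∫ e^{-iηx} g(x) dx`. -/
def fourierT {n : ℕ} (g : ℝ → Cn n) (η : ℝ) : Cn n :=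
  ∫ x : ℝ, Complex.exp (-(Complex.I * η * x)) • g x

/-- The Bloch transform `ĝ(ξ,x) = ∑_j e^{2πijx} ĝ(ξ + 2πj)`. -/
def blochFun {n : ℕ} (g : ℝ → Cn n) (ξ : ℝ) (x : UnitAddCircle) : Cn n :=
  ∑' j : ℤ, fourier j x • fourierT g (ξ + 2 * Real.pi * j)

open Classical in
/-- The Bloch transform `ĝ(ξ,·)` as an element of `L²_per`. -/
def blochTransform {n : ℕ} (g : ℝ → Cn n) (ξ : ℝ) : L2per n :=
  if h : MemLp (blochFun g ξ) 2 (AddCircle.haarAddCircle : Measure UnitAddCircle)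
  then h.toLp _ else 0

open Classical in
/-- The continuous representative of an element of `L²_per` (zero if there is none). -/
def contRep {n : ℕ} (w : L2per n) : UnitAddCircle → Cn n :=
  if h : ∃ v : C(UnitAddCircle, Cn n), toL2per v = w then h.choose else 0

/-- The low-frequency solution operator
`S^I(t) g(x) = (1/2π) ∫_{-π}^{π} e^{iξx} φ(ξ) P(ξ) e^{L_ξ t} ĝ(ξ,x) dξ`,
with `P(ξ)` the eigenprojection of `L_ξ` at `mu ξ`. -/
def lowFreqOp {n : ℕ} (c : ℝ) (f : EuclideanSpace ℝ (Fin n) → EuclideanSpace ℝ (Fin n))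
    (u : ℝ → EuclideanSpace ℝ (Fin n)) (mu : ℝ → ℂ) (φ : ℝ → ℝ) (t : ℝ)
    (g : ℝ → Cn n) (x : ℝ) : Cn n :=
  (1 / (2 * Real.pi) : ℂ) • ∫ ξ in (-Real.pi)..Real.pi,
    (Complex.exp (Complex.I * ξ * x) * (φ ξ : ℂ)) •
      contRep (eigenprojection (linBloch c f u ξ) (mu ξ)
        (expSemigroup (linBloch c f u ξ) t (blochTransform g ξ))) (x : UnitAddCircle)

/-- `G` is the Green kernel `G^I(x,t;y) = S^I(t) δ_y (x)`, i.e. the (unique) continuous integral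
kernel of `S^I(t)` for each `t > 0`. -/
def IsLowFreqGreenKernel {n : ℕ} (c : ℝ)
    (f : EuclideanSpace ℝ (Fin n) → EuclideanSpace ℝ (Fin n))
    (u : ℝ → EuclideanSpace ℝ (Fin n)) (mu : ℝ → ℂ) (φ : ℝ → ℝ)
    (G : ℝ → ℝ → ℝ → (Cn n →L[ℂ] Cn n)) : Prop :=
  ∀ t : ℝ, 0 < t → Continuous (fun z : ℝ × ℝ => G z.1 t z.2) ∧
    ∀ (g : 𝓢(ℝ, Cn n)) (x : ℝ), Integrable (fun y => G x t y (g y)) ∧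
      lowFreqOp c f u mu φ t g x = ∫ y : ℝ, G x t y (g y)

/-- `ẽ(x,t;y) = (1/2π) ∫ e^{iξ(x-y)} φ(ξ) e^{mu(ξ)t} qt(y,ξ) dξ`, a row vector. -/
def eTilde {n : ℕ} (mu : ℝ → ℂ) (φ : ℝ → ℝ) (qt : ℝ → C(UnitAddCircle, Cn n →L[ℂ] ℂ))
    (x t y : ℝ) : Cn n →L[ℂ] ℂ :=
  (1 / (2 * Real.pi) : ℂ) • ∫ ξ : ℝ,
    (Complex.exp (Complex.I * ξ * (x - y)) * (φ ξ : ℂ) * Complex.exp (mu ξ * t)) •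
      qt ξ (y : UnitAddCircle)

/-- The mixed partial derivative `∂_x^j ∂_t^k ∂_y^r e(x,t;y)`. -/
def mixedDeriv {F : Type*} [NormedAddCommGroup F] [NormedSpace ℝ F] (j k r : ℕ)
    (e : ℝ → ℝ → ℝ → F) (x t y : ℝ) : F :=
  iteratedDeriv j (fun x' => iteratedDeriv k (fun t' => iteratedDeriv r (fun y' => e x' t' y') y)
    t) x

end

end BlochRD

/-! Near zero frequency the critical part of the Bloch semigroup has rank one: the eigenprojection
is `P(ξ)w = (∫ q̃ w) q`, and `q̃` turns `e^{L_ξ t}` into the scalar `e^{μ(ξ)t}`. Unfolding the Bloch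
transform then gives the kernel `(1/2π) ∫ e^{iξ(x-y)} φ(ξ) e^{μ(ξ)t} q(x,ξ) q̃(y,ξ) dξ`. Replacing
`q(x,ξ)` by `q(x,0) = u'(x)` produces `u' ẽ`. The remainder carries the factor `q(x,ξ) - q(x,0) =
O(ξ)`, and each factor `ξ` is worth `t^{-1/2}` against `|e^{μ(ξ)t}| ≤ e^{-θξ²t}`. In the same way
`∂_x` and `∂_t` insert `iξ` and `μ(ξ) = O(ξ)`, whereas `∂_y` only uses the regularity of `q̃` and
gains no decay.

Spectral part. Writing `w = (1-∂²)⁻¹h` replaces `L_ξ - μ` by a bounded operator `pencil`, polynomial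
in `ξ` and `μ` and equal to `-1` plus a compact operator (`mem_blochGraph_iff`). Simplicity of `0`
makes a rank-one bordering of this operator invertible at the origin (`isUnit_bordered_of_simple`).
The implicit function theorem applied to the resulting scalar equation produces `μ`, and the
bordered inverse produces both eigenfunctions (`exists_analytic_branch`). Because invertibility of
the bordered operator is an open condition, it also identifies the eigenprojection along any given
branch, without comparing that branch with the constructed one
(`IsCriticalBranch.eventually_eigenprojection`).

Semigroup part. `L_ξ` is a diagonal Fourier multiplier plus a bounded multiplication operator, so it
generates a semigroup by Duhamel's formula (`exists_isSemigroupOf_blochOp`). Left eigenfunctionals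
of the generator are left eigenfunctionals of the semigroup (`IsSemigroupOf.left_eigenfunctional`).

Decay part. The sup bound is a Gaussian integral. For `L²` the line is folded onto one period: at
fixed `x` the values at `x + k` are Fourier coefficients of one function on the band, because the
amplitude is periodic in `x`, and Parseval applies. Interpolation gives every `p ≥ 2`
(`exists_eLpNorm_oscIntegral_le`). Regularity in `y` comes from the adjoint differential equation,
solved for functions of `y` with values in `C([-d,d])` (`IsCriticalBranch.exists_regular_left`). -/

namespace BlochRD

noncomputable section

/-! ### Fourier basis of periodic `L²` and Fourier multipliers -/

section FourierBasis

/-- The exponential `x ↦ e^{2πijx} v` as a continuous function on the circle. -/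
def expFun (E : Type*) [NormedAddCommGroup E] [NormedSpace ℂ E] (j : ℤ) :
    E →L[ℂ] C(UnitAddCircle, E) :=
  LinearMap.mkContinuous
    { toFun := fun v => ⟨fun x => fourier j x • v, by fun_prop⟩
      map_add' := fun v w => by ext x; simp
      map_smul' := fun a v => by ext x; exact smul_comm _ _ _ } 1
    (fun v => by
      rw [one_mul, ContinuousMap.norm_le _ (norm_nonneg v)]
      intro x
      change ‖fourier j x • v‖ ≤ ‖v‖
      rw [norm_smul, fourier_apply, Circle.norm_coe, one_mul])

lemma norm_expFun_le (E : Type*) [NormedAddCommGroup E] [NormedSpace ℂ E] (j : ℤ) :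
    ‖expFun E j‖ ≤ 1 := LinearMap.mkContinuous_norm_le _ zero_le_one _

variable {n : ℕ}

/-- `toL2per` as a continuous linear map. -/
def toL2perCLM (n : ℕ) : C(UnitAddCircle, Cn n) →L[ℂ] L2per n :=
  ContinuousMap.toLp 2 (AddCircle.haarAddCircle : Measure UnitAddCircle) ℂ

lemma toL2perCLM_apply (w : C(UnitAddCircle, Cn n)) : toL2perCLM n w = toL2per w := rfl

lemma coeFn_toL2per (w : C(UnitAddCircle, Cn n)) :
    (toL2per w : UnitAddCircle → Cn n) =ᵐ[AddCircle.haarAddCircle] w :=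
  ContinuousMap.coeFn_toLp _ w

lemma toL2per_injective : Function.Injective (toL2per (n := n)) :=
  ContinuousMap.toLp_injective _

lemma contRep_toL2per (w : C(UnitAddCircle, Cn n)) : contRep (toL2per w) = w := by
  have h : ∃ v : C(UnitAddCircle, Cn n), toL2per v = toL2per w := ⟨w, rfl⟩
  rw [contRep, dif_pos h, toL2per_injective h.choose_spec]

/-- The vector `e^{2πij·} v` in `L²_per`. -/
def expVec (n : ℕ) (j : ℤ) : Cn n →L[ℂ] L2per n := (toL2perCLM n).comp (expFun (Cn n) j)

lemma coeFn_expVec (j : ℤ) (v : Cn n) :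
    (expVec n j v : UnitAddCircle → Cn n) =ᵐ[AddCircle.haarAddCircle] fun x => fourier j x • v :=
  coeFn_toL2per _

lemma fourierCoeff_fourier_smul {E : Type*} [NormedAddCommGroup E] [NormedSpace ℂ E]
    [CompleteSpace E] (j k : ℤ) (v : E) :
    fourierCoeff (fun x : UnitAddCircle => fourier j x • v) k = if k = j then v else 0 := by
  have h1 : fourierCoeff (fun x : UnitAddCircle => fourier j x • v) k =
      fourierCoeff (fun x : UnitAddCircle => (fourier j x : ℂ)) k • v := by
    simp only [fourierCoeff, ← smul_assoc]
    rw [integral_smul_const]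
  have h2 := fourierCoeff_fourier (T := 1) j
  have h3 : fourierCoeff (fun x : UnitAddCircle => (fourier j x : ℂ)) k = (Pi.single j 1 : ℤ → ℂ) k :=
    congrFun h2 k
  rw [h1, h3, Pi.single_apply]
  split_ifs <;> simp

lemma fourierCoeff_expVec (j k : ℤ) (v : Cn n) :
    fourierCoeff (expVec n j v : UnitAddCircle → Cn n) k = if k = j then v else 0 := by
  rw [fourierCoeff_congr_ae (coeFn_expVec j v), fourierCoeff_fourier_smul]

/-- Taking the `j`-th coefficient is the adjoint of `expVec n j`; orthonormality, completeness and
the norm bound on coefficients are all read off from this. -/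
lemma inner_expVec (j : ℤ) (v : Cn n) (w : L2per n) :
    inner ℂ (expVec n j v) w = inner ℂ v (fourierCoeff (w : UnitAddCircle → Cn n) j) := by
  rw [L2.inner_def, fourierCoeff, ← integral_inner ((integrable_L2per w).fourier_smul (-j))]
  apply integral_congr_ae
  filter_upwards [coeFn_expVec j v] with x hx
  rw [hx, inner_smul_left, inner_smul_right, fourier_neg]

lemma orthonormal_expVec : Orthonormal ℂ
    (fun p : ℤ × Fin n => expVec n p.1 (EuclideanSpace.single p.2 (1 : ℂ))) := by
  rw [orthonormal_iff_ite]
  rintro ⟨j, i⟩ ⟨k, l⟩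
  rw [inner_expVec, fourierCoeff_expVec]
  by_cases h : j = k
  · subst h
    simp [EuclideanSpace.inner_single_left]
  · simp [h]

/-- The exponentials form a Hilbert basis of `L²_per`. -/
def expBasis (n : ℕ) : HilbertBasis (ℤ × Fin n) ℂ (L2per n) :=
  HilbertBasis.mkOfOrthogonalEqBot orthonormal_expVec (by
    rw [Submodule.eq_bot_iff]
    intro w hw
    apply L2per_eq_zero
    intro j
    ext i
    rw [Submodule.mem_orthogonal] at hw
    have := hw _ (Submodule.subset_span ⟨(j, i), rfl⟩)
    rw [inner_expVec, EuclideanSpace.inner_single_left] at this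
    simpa using this)

lemma expBasis_apply (p : ℤ × Fin n) :
    expBasis n p = expVec n p.1 (EuclideanSpace.single p.2 (1 : ℂ)) := by
  simp [expBasis]

lemma expBasis_repr (w : L2per n) (p : ℤ × Fin n) :
    (expBasis n).repr w p = fourierCoeff (w : UnitAddCircle → Cn n) p.1 p.2 := by
  rw [HilbertBasis.repr_apply_apply, expBasis_apply, inner_expVec,
    EuclideanSpace.inner_single_left]
  simp

lemma L2per_ext {w z : L2per n} (h : ∀ j : ℤ, fourierCoeff (w : UnitAddCircle → Cn n) j =
    fourierCoeff (z : UnitAddCircle → Cn n) j) : w = z := by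
  apply (expBasis n).repr.injective
  ext p
  rw [expBasis_repr, expBasis_repr, h]

/-- The `j`-th Fourier coefficient as a continuous linear map. -/
def coeffCLM (n : ℕ) (j : ℤ) : L2per n →L[ℂ] Cn n :=
  LinearMap.mkContinuous
    { toFun := fun w => fourierCoeff (w : UnitAddCircle → Cn n) j
      map_add' := fun w v => fourierCoeff_L2per_add w v j
      map_smul' := fun a w => fourierCoeff_L2per_smul a w j } 1
    (fun w => by
      set v := fourierCoeff (w : UnitAddCircle → Cn n) j with hv
      change ‖v‖ ≤ 1 * ‖w‖
      rw [one_mul]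
      have h1 : ‖inner ℂ (expVec n j v) w‖ ≤ ‖expVec n j v‖ * ‖w‖ := norm_inner_le_norm _ _
      have h2 : ‖expVec n j v‖ ^ 2 = ‖v‖ ^ 2 := by
        have := inner_expVec j v (expVec n j v)
        rw [fourierCoeff_expVec, if_pos rfl, inner_self_eq_norm_sq_to_K,
          inner_self_eq_norm_sq_to_K] at this
        exact_mod_cast this
      have h3 : ‖expVec n j v‖ = ‖v‖ := by
        rwa [sq_eq_sq₀ (norm_nonneg _) (norm_nonneg _)] at h2
      rw [inner_expVec, ← hv, h3, inner_self_eq_norm_sq_to_K] at h1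
      simp only [norm_pow, RCLike.norm_ofReal, abs_norm] at h1
      rcases (norm_nonneg v).eq_or_lt with h | h
      · rw [← h]; exact norm_nonneg _
      · nlinarith)

lemma coeffCLM_apply (j : ℤ) (w : L2per n) :
    coeffCLM n j w = fourierCoeff (w : UnitAddCircle → Cn n) j := rfl

lemma norm_coeffCLM_le (j : ℤ) : ‖coeffCLM n j‖ ≤ 1 :=
  LinearMap.mkContinuous_norm_le _ zero_le_one _

lemma coeffCLM_expVec (j k : ℤ) (v : Cn n) :
    coeffCLM n k (expVec n j v) = if k = j then v else 0 := fourierCoeff_expVec j k v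

lemma L2per_ext' {w z : L2per n} (h : ∀ j : ℤ, coeffCLM n j w = coeffCLM n j z) : w = z :=
  L2per_ext h

/-- The span of the exponentials is dense. -/
lemma dense_span_expVec :
    Dense (Submodule.span ℂ {w : L2per n | ∃ j v, w = expVec n j v} : Set (L2per n)) := by
  have h := (expBasis n).dense_span
  rw [← Submodule.dense_iff_topologicalClosure_eq_top] at h
  refine h.mono (Submodule.span_mono ?_)
  rintro _ ⟨p, rfl⟩
  exact ⟨p.1, _, expBasis_apply p⟩

/-- Density of trigonometric polynomials reduces the operator identities below to computations with
symbols. -/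
lemma clm_ext_expVec {X : Type*} [NormedAddCommGroup X] [NormedSpace ℂ X] {S T : L2per n →L[ℂ] X}
    (h : ∀ j v, S (expVec n j v) = T (expVec n j v)) : S = T := by
  apply ContinuousLinearMap.ext_on dense_span_expVec
  rintro _ ⟨j, v, rfl⟩
  exact h j v

/-- The Fourier multiplier with a bounded symbol (zero if the symbol is unbounded). -/
def multiplier (n : ℕ) (m : ℤ → ℂ) : L2per n →L[ℂ] L2per n :=
  open Classical in
  if h : ∃ C : ℝ, 0 ≤ C ∧ ∀ j, ‖m j‖ ≤ C then
    ((expBasis n).repr.symm.toContinuousLinearEquiv : _ →L[ℂ] L2per n).comp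
      ((lp.mapCLM 2 (fun p : ℤ × Fin n => m p.1 • ContinuousLinearMap.id ℂ ℂ)
        h.choose_spec.1 (fun p => by
          rw [norm_smul, ContinuousLinearMap.norm_id, mul_one]
          exact h.choose_spec.2 p.1)).comp
        ((expBasis n).repr.toContinuousLinearEquiv : L2per n →L[ℂ] _))
  else 0

lemma coeffCLM_multiplier {m : ℤ → ℂ} {C : ℝ} (hm : ∀ j, ‖m j‖ ≤ C) (w : L2per n) (j : ℤ) :
    coeffCLM n j (multiplier n m w) = m j • coeffCLM n j w := by
  have h : ∃ C : ℝ, 0 ≤ C ∧ ∀ j, ‖m j‖ ≤ C := ⟨C, (norm_nonneg _).trans (hm 0), hm⟩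
  ext i
  rw [coeffCLM_apply, coeffCLM_apply, ← expBasis_repr _ (j, i), multiplier, dif_pos h]
  simp [expBasis_repr]

lemma norm_multiplier_apply_le {m : ℤ → ℂ} {C : ℝ} (hm : ∀ j, ‖m j‖ ≤ C) (w : L2per n) :
    ‖multiplier n m w‖ ≤ C * ‖w‖ := by
  have hC : 0 ≤ C := (norm_nonneg _).trans (hm 0)
  have h1 : (expBasis n).repr (multiplier n m w) =
      lp.mapCLM 2 (fun p : ℤ × Fin n => m p.1 • ContinuousLinearMap.id ℂ ℂ)
        hC (fun p => by
          rw [norm_smul, ContinuousLinearMap.norm_id, mul_one]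
          exact hm p.1) ((expBasis n).repr w) := by
    ext p
    have := congrArg (fun v : Cn n => v p.2) (coeffCLM_multiplier hm w p.1)
    rw [expBasis_repr]
    simpa [expBasis_repr, coeffCLM_apply] using this
  rw [← (expBasis n).repr.norm_map, h1, ← (expBasis n).repr.norm_map w]
  exact ContinuousLinearMap.le_of_opNorm_le _ (lp.norm_mapCLM_le _ _ _ _) _

lemma norm_multiplier_le {m : ℤ → ℂ} {C : ℝ} (hm : ∀ j, ‖m j‖ ≤ C) : ‖multiplier n m‖ ≤ C :=
  ContinuousLinearMap.opNorm_le_bound _ ((norm_nonneg _).trans (hm 0))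
    (norm_multiplier_apply_le hm)

lemma multiplier_expVec {m : ℤ → ℂ} {C : ℝ} (hm : ∀ j, ‖m j‖ ≤ C) (j : ℤ) (v : Cn n) :
    multiplier n m (expVec n j v) = m j • expVec n j v := by
  apply L2per_ext'
  intro k
  rw [coeffCLM_multiplier hm, map_smul, coeffCLM_expVec]
  split_ifs with h
  · rw [h]
  · simp

lemma isCompactOperator_of_finite_symbol {m : ℤ → ℂ} {C : ℝ} (hm : ∀ j, ‖m j‖ ≤ C)
    (s : Finset ℤ) (hs : ∀ j ∉ s, m j = 0) : IsCompactOperator (multiplier n m) := by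
  have h1 : multiplier n m = ∑ j ∈ s, m j • (expVec n j).comp (coeffCLM n j) := by
    ext1 w
    apply L2per_ext'
    intro k
    rw [coeffCLM_multiplier hm]
    simp only [sum_apply, smul_apply,
      ContinuousLinearMap.comp_apply, map_sum, map_smul, coeffCLM_expVec]
    by_cases hk : k ∈ s
    · rw [Finset.sum_eq_single_of_mem k hk]
      · simp
      · intro b _ hb
        rw [if_neg (Ne.symm hb), smul_zero]
    · rw [hs k hk, zero_smul, Finset.sum_eq_zero]
      intro b hb
      rw [if_neg (by rintro rfl; exact hk hb), smul_zero]
  rw [h1]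
  have h2 : ∀ j, IsCompactOperator (m j • (expVec n j).comp (coeffCLM n j)) := by
    intro j
    have : IsCompactOperator (expVec n j : Cn n →L[ℂ] L2per n) := by
      rw [isCompactOperator_iff_exists_mem_nhds_image_subset_compact]
      exact ⟨Metric.closedBall 0 1, Metric.closedBall_mem_nhds _ one_pos, _,
        (isCompact_closedBall 0 1).image (expVec n j).continuous, subset_rfl⟩
    exact (this.comp_clm (coeffCLM n j)).smul (m j)
  rw [FunLike.coe_sum]
  exact Finset.sum_induction _ IsCompactOperator (fun _ _ => IsCompactOperator.add)
    isCompactOperator_zero (fun j _ => h2 j)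

/-- Truncations to finitely many frequencies have finite rank and converge in operator norm, since
the tail of the symbol is uniformly small; norm limits of compact operators are compact. -/
lemma isCompactOperator_multiplier {m : ℤ → ℂ} (h0 : Tendsto m cofinite (𝓝 0)) :
    IsCompactOperator (multiplier n m) := by
  classical
  -- For an unbounded symbol `multiplier` is zero by default, hence compact, so boundedness need not
  -- be extracted from the limit.
  by_cases hb : ∃ C : ℝ, 0 ≤ C ∧ ∀ j, ‖m j‖ ≤ C
  swap
  · rw [multiplier, dif_neg hb]; exact isCompactOperator_zero
  obtain ⟨C, hC, hm⟩ := hb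
  have hm' : ∀ (s : Finset ℤ) j, ‖if j ∈ s then m j else 0‖ ≤ C := fun s j => by
    split_ifs
    · exact hm j
    · simpa using hC
  have key : Tendsto (fun s : Finset ℤ => multiplier n (fun j => if j ∈ s then m j else 0)) atTop
      (𝓝 (multiplier n m)) := by
    rw [Metric.tendsto_atTop]
    intro ε hε
    have h1 : ∀ᶠ j in cofinite, ‖m j‖ < ε / 2 := by
      have := h0.norm
      rw [norm_zero] at this
      exact this.eventually_lt_const (by positivity)
    have hfin : {j | ¬ ‖m j‖ < ε / 2}.Finite := h1
    refine ⟨hfin.toFinset, fun s hs => ?_⟩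
    rw [dist_eq_norm]
    refine lt_of_le_of_lt (ContinuousLinearMap.opNorm_le_bound _ (by positivity : 0 ≤ ε / 2)
      fun w => ?_) (half_lt_self hε)
    have h2 : ∀ j, ‖(if j ∈ s then m j else 0) - m j‖ ≤ ε / 2 := by
      intro j
      split_ifs with hj
      · simp; positivity
      · rw [zero_sub, norm_neg]
        by_contra h
        exact hj (hs (by simpa using fun h' : ‖m j‖ < ε / 2 => h h'.le))
    have h3 : (multiplier n (fun j => if j ∈ s then m j else 0) - multiplier n m) w =
        multiplier n (fun j => (if j ∈ s then m j else 0) - m j) w := by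
      apply L2per_ext'
      intro j
      rw [coeffCLM_multiplier h2, sub_apply, map_sub,
        coeffCLM_multiplier (hm' s), coeffCLM_multiplier hm, sub_smul]
    rw [h3]
    exact norm_multiplier_apply_le h2 w
  exact isCompactOperator_of_tendsto key (Eventually.of_forall fun s =>
    isCompactOperator_of_finite_symbol (hm' s) s fun j hj => if_neg hj)

end FourierBasis

/-! ### The smoothing operator `(1 - ∂²)⁻¹` and the bounded pencil -/

section Smoothing

variable {n : ℕ}

lemma norm_expVec_apply (j : ℤ) (v : Cn n) : ‖expVec n j v‖ = ‖v‖ := by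
  have := inner_expVec j v (expVec n j v)
  rw [fourierCoeff_expVec, if_pos rfl, inner_self_eq_norm_sq_to_K,
    inner_self_eq_norm_sq_to_K] at this
  have h2 : ‖expVec n j v‖ ^ 2 = ‖v‖ ^ 2 := by exact_mod_cast this
  rwa [sq_eq_sq₀ (norm_nonneg _) (norm_nonneg _)] at h2

lemma norm_expVec_le (j : ℤ) : ‖expVec n j‖ ≤ 1 :=
  ContinuousLinearMap.opNorm_le_bound _ zero_le_one fun v => by rw [norm_expVec_apply, one_mul]

/-- The symbol of `(1 - ∂²)⁻¹`. -/
def jSym (j : ℤ) : ℂ := ((1 + (2 * Real.pi * j) ^ 2 : ℝ) : ℂ)⁻¹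

/-- The symbol of `∂ (1 - ∂²)⁻¹`. -/
def djSym (j : ℤ) : ℂ := (2 * Real.pi * Complex.I * j) * jSym j

lemma jSym_ne_zero (j : ℤ) : jSym j ≠ 0 := by
  rw [jSym]
  apply inv_ne_zero
  rw [Complex.ofReal_ne_zero]
  positivity

lemma norm_jSym (j : ℤ) : ‖jSym j‖ = (1 + (2 * Real.pi * j) ^ 2)⁻¹ := by
  rw [jSym, norm_inv, Complex.norm_real, Real.norm_of_nonneg (by positivity)]

lemma norm_jSym_le (j : ℤ) : ‖jSym j‖ ≤ 1 := by
  rw [norm_jSym]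
  apply inv_le_one_of_one_le₀
  nlinarith [sq_nonneg (2 * Real.pi * j)]

lemma norm_djSym (j : ℤ) : ‖djSym j‖ = |2 * Real.pi * j| * (1 + (2 * Real.pi * j) ^ 2)⁻¹ := by
  rw [djSym, norm_mul, norm_jSym]
  congr 1
  have : (2 * Real.pi * Complex.I * j : ℂ) = ((2 * Real.pi * j : ℝ) : ℂ) * Complex.I := by
    push_cast; ring
  rw [this, norm_mul, Complex.norm_I, mul_one, Complex.norm_real, Real.norm_eq_abs]

/-- With `s = (2πj)²` this is `s/(1+s)² ≤ 1/(1+s)`. It transfers boundedness and vanishing at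
infinity from `jSym` to `djSym`. -/
lemma norm_djSym_sq_le (j : ℤ) : ‖djSym j‖ ^ 2 ≤ ‖jSym j‖ := by
  rw [norm_djSym, norm_jSym, mul_pow, sq_abs]
  set s := (2 * Real.pi * j) ^ 2
  have hs : 0 ≤ s := sq_nonneg _
  rw [inv_pow, ← div_eq_mul_inv, ← one_div, div_le_div_iff₀ (by positivity) (by positivity)]
  nlinarith

lemma norm_djSym_le (j : ℤ) : ‖djSym j‖ ≤ 1 := by
  have h1 := norm_djSym_sq_le j
  have h2 := norm_jSym_le j
  nlinarith [norm_nonneg (djSym j)]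

/-- Comparison with `1/j²`. This summability is what makes the Fourier series of `(1 - ∂²)⁻¹h`
converge uniformly, so that smoothing lands in continuous functions. -/
lemma summable_norm_jSym : Summable fun j : ℤ => ‖jSym j‖ := by
  have h := (Real.summable_one_div_int_pow (p := 2)).2 one_lt_two
  refine Summable.of_norm_bounded_eventually h ?_
  filter_upwards [(Set.finite_singleton (0 : ℤ)).compl_mem_cofinite] with j hj
  rw [norm_norm, norm_jSym, one_div]
  have hj' : (0 : ℝ) < (j : ℝ) ^ 2 := by
    have : (j : ℝ) ≠ 0 := by exact_mod_cast hj
    positivity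
  apply inv_anti₀ hj'
  have : (1 : ℝ) ≤ (2 * Real.pi) ^ 2 := by nlinarith [Real.pi_gt_three]
  nlinarith

lemma tendsto_jSym : Tendsto jSym cofinite (𝓝 0) :=
  tendsto_zero_iff_norm_tendsto_zero.2 summable_norm_jSym.tendsto_cofinite_zero

lemma tendsto_djSym : Tendsto djSym cofinite (𝓝 0) := by
  have h1 : Tendsto (fun j => ‖djSym j‖ ^ 2) cofinite (𝓝 0) :=
    squeeze_zero (fun _ => by positivity) norm_djSym_sq_le
      summable_norm_jSym.tendsto_cofinite_zero
  have h2 := h1.sqrt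
  simp only [Real.sqrt_sq (norm_nonneg _), Real.sqrt_zero] at h2
  exact tendsto_zero_iff_norm_tendsto_zero.2 h2

/-- `(1 - ∂²)⁻¹` on `L²_per`. -/
def opJ (n : ℕ) : L2per n →L[ℂ] L2per n := multiplier n jSym

/-- `∂ (1 - ∂²)⁻¹` on `L²_per`. -/
def opDJ (n : ℕ) : L2per n →L[ℂ] L2per n := multiplier n djSym

lemma coeffCLM_opJ (w : L2per n) (j : ℤ) : coeffCLM n j (opJ n w) = jSym j • coeffCLM n j w :=
  coeffCLM_multiplier norm_jSym_le w j

lemma coeffCLM_opDJ (w : L2per n) (j : ℤ) : coeffCLM n j (opDJ n w) = djSym j • coeffCLM n j w :=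
  coeffCLM_multiplier norm_djSym_le w j

lemma opJ_expVec (j : ℤ) (v : Cn n) : opJ n (expVec n j v) = jSym j • expVec n j v :=
  multiplier_expVec norm_jSym_le j v

lemma opDJ_expVec (j : ℤ) (v : Cn n) : opDJ n (expVec n j v) = djSym j • expVec n j v :=
  multiplier_expVec norm_djSym_le j v

lemma isCompactOperator_opJ : IsCompactOperator (opJ n) := isCompactOperator_multiplier tendsto_jSym

lemma isCompactOperator_opDJ : IsCompactOperator (opDJ n) :=
  isCompactOperator_multiplier tendsto_djSym

lemma opJ_injective : Function.Injective (opJ n) := by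
  intro w z h
  apply L2per_ext'
  intro j
  have := congrArg (coeffCLM n j) h
  rw [coeffCLM_opJ, coeffCLM_opJ] at this
  exact smul_right_injective _ (jSym_ne_zero j) this

lemma opJ_comp_opDJ : (opJ n).comp (opDJ n) = (opDJ n).comp (opJ n) := by
  apply clm_ext_expVec
  intro j v
  simp only [ContinuousLinearMap.comp_apply, opJ_expVec, opDJ_expVec, map_smul]
  rw [smul_comm]

/-- Since `(2πij)² = 1 - (1 + (2πj)²)`, this is `∂²(1-∂²)⁻¹ = (1-∂²)⁻¹ - 1` on the level of symbols;
it removes every second derivative. -/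
lemma sq_symbol_mul_jSym (j : ℤ) :
    (2 * Real.pi * Complex.I * j : ℂ) ^ 2 * jSym j = jSym j - 1 := by
  have h := jSym_ne_zero j
  rw [jSym, Ne, inv_eq_zero] at h
  rw [jSym, mul_inv_eq_iff_eq_mul₀ h, sub_mul, inv_mul_cancel₀ h]
  push_cast
  linear_combination (2 * Real.pi * j : ℂ) ^ 2 * Complex.I_sq

lemma opDJ_comp_opDJ :
    (opDJ n).comp (opDJ n) = (opJ n - ContinuousLinearMap.id ℂ _).comp (opJ n) := by
  apply clm_ext_expVec
  intro j v
  simp only [ContinuousLinearMap.comp_apply, opJ_expVec, opDJ_expVec, map_smul, sub_apply,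
    ContinuousLinearMap.id_apply]
  have e : djSym j * djSym j = jSym j * (jSym j - 1) := by
    rw [← sq_symbol_mul_jSym, djSym]; ring
  rw [smul_smul, e, mul_smul, sub_smul, one_smul]

lemma dense_range_opJ : DenseRange (opJ n) := by
  refine dense_span_expVec.mono ?_
  have : Submodule.span ℂ {w : L2per n | ∃ j v, w = expVec n j v} ≤
      LinearMap.range (opJ n : L2per n →ₗ[ℂ] L2per n) := by
    rw [Submodule.span_le]
    rintro _ ⟨j, v, rfl⟩
    refine ⟨(jSym j)⁻¹ • expVec n j v, ?_⟩
    rw [ContinuousLinearMap.coe_coe, map_smul, opJ_expVec, smul_smul,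
      inv_mul_cancel₀ (jSym_ne_zero j), one_smul]
  exact this

lemma isPerDeriv_opJ (h : L2per n) : IsPerDeriv (opJ n h) (opDJ n h) := by
  intro j
  have h1 := coeffCLM_opJ h j
  have h2 := coeffCLM_opDJ h j
  rw [coeffCLM_apply] at h1 h2
  rw [h1, h2, djSym, mul_smul]

lemma isPerDeriv_opDJ (h : L2per n) : IsPerDeriv (opDJ n h) (opJ n h - h) := by
  intro j
  have h1 := coeffCLM_opDJ h j
  have h2 : coeffCLM n j (opJ n h - h) = _ := map_sub _ _ _
  rw [coeffCLM_opJ] at h2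
  rw [coeffCLM_apply] at h1 h2
  have e : (2 * Real.pi * Complex.I * j : ℂ) * djSym j = jSym j - 1 := by
    rw [← sq_symbol_mul_jSym, djSym]; ring
  rw [h1, h2, smul_smul, e, sub_smul, one_smul]

lemma IsPerDeriv.unique {w v v' : L2per n} (h : IsPerDeriv w v) (h' : IsPerDeriv w v') : v = v' :=
  L2per_ext fun j => by rw [h j, h' j]

/-- Membership in `H²_per`: twice weakly differentiable elements are in the range of
`(1 - ∂²)⁻¹`. -/
lemma IsPerDeriv.eq_opJ {w v₁ v₂ : L2per n} (h₁ : IsPerDeriv w v₁) (h₂ : IsPerDeriv v₁ v₂) :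
    w = opJ n (w - v₂) := by
  apply L2per_ext'
  intro j
  rw [coeffCLM_opJ, map_sub, coeffCLM_apply, coeffCLM_apply, h₂ j, h₁ j, smul_smul, ← one_smul ℂ (fourierCoeff (w : UnitAddCircle → Cn n) j), smul_smul, ← sub_smul, smul_smul]
  congr 1
  linear_combination sq_symbol_mul_jSym j

section FourierSum

variable {X F : Type*} [NormedAddCommGroup X] [NormedSpace ℂ X] [NormedAddCommGroup F]
  [NormedSpace ℂ F]

lemma norm_fourierSumTerm_le {L : ℤ → X →L[ℂ] F} (hL : ∀ j x, ‖L j x‖ ≤ ‖x‖) (x : X) (j : ℤ) :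
    ‖jSym j • expFun F j (L j x)‖ ≤ ‖jSym j‖ * ‖x‖ := by
  rw [norm_smul]
  refine mul_le_mul_of_nonneg_left ?_ (norm_nonneg _)
  refine ((expFun F j).le_of_opNorm_le (norm_expFun_le F j) _).trans ?_
  rw [one_mul]
  exact hL j x

lemma summable_fourierSumTerm [CompleteSpace F] {L : ℤ → X →L[ℂ] F}
    (hL : ∀ j x, ‖L j x‖ ≤ ‖x‖) (x : X) : Summable (fun j : ℤ => jSym j • expFun F j (L j x)) :=
  Summable.of_norm_bounded (summable_norm_jSym.mul_right ‖x‖) (norm_fourierSumTerm_le hL x)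

/-- The Fourier series with coefficients `jSym j • L j x`, as a continuous function. -/
def fourierSumOp [CompleteSpace F] (L : ℤ → X →L[ℂ] F) (hL : ∀ j x, ‖L j x‖ ≤ ‖x‖) :
    X →L[ℂ] C(UnitAddCircle, F) :=
  LinearMap.mkContinuous
    { toFun := fun x => ∑' j : ℤ, jSym j • expFun F j (L j x)
      map_add' := fun x y => by
        rw [← (summable_fourierSumTerm hL x).tsum_add (summable_fourierSumTerm hL y)]
        simp only [map_add, smul_add]
      map_smul' := fun a x => by
        rw [RingHom.id_apply, ← (summable_fourierSumTerm hL x).tsum_const_smul]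
        congr 1
        ext1 j
        rw [map_smul, map_smul, smul_comm] }
    (∑' j : ℤ, ‖jSym j‖) (fun x => by
      rw [← tsum_mul_right]
      exact tsum_of_norm_bounded (summable_norm_jSym.mul_right ‖x‖).hasSum
        (norm_fourierSumTerm_le hL x))

lemma hasSum_fourierSumOp [CompleteSpace F] {L : ℤ → X →L[ℂ] F} (hL : ∀ j x, ‖L j x‖ ≤ ‖x‖)
    (x : X) : HasSum (fun j : ℤ => jSym j • expFun F j (L j x)) (fourierSumOp L hL x) :=
  (summable_fourierSumTerm hL x).hasSum

end FourierSum

/-- `(1 - ∂²)⁻¹` from `L²_per` to continuous functions. -/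
def opJc (n : ℕ) : L2per n →L[ℂ] C(UnitAddCircle, Cn n) :=
  fourierSumOp (coeffCLM n) fun j w => by
    simpa using (coeffCLM n j).le_of_opNorm_le (norm_coeffCLM_le j) w

lemma hasSum_opJc (w : L2per n) :
    HasSum (fun j : ℤ => jSym j • expFun (Cn n) j (coeffCLM n j w)) (opJc n w) :=
  hasSum_fourierSumOp _ w

/-- Links the two versions of the smoothing operator: elements of the domain of `L_ξ` have the
explicit continuous representative `opJc n h`. -/
lemma toL2per_opJc (h : L2per n) : toL2per (opJc n h) = opJ n h := by
  have h1 : (toL2perCLM n).comp (opJc n) = opJ n := by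
    apply clm_ext_expVec
    intro k v
    have h2 := (hasSum_opJc (expVec n k v)).mapL (toL2perCLM n)
    refine h2.unique ?_
    rw [opJ_expVec]
    convert hasSum_ite_eq k (jSym k • expVec n k v) using 2 with j
    simp only [coeffCLM_expVec, map_smul]
    split_ifs with hj
    · subst hj; rfl
    · simp
  exact DFunLike.congr_fun h1 h

/-- The pairing `w ↦ ∫ p(x) w(x) dx` of `L²_per` with a continuous row vector `p`. -/
def rowCLM (n : ℕ) : C(UnitAddCircle, Cn n →L[ℂ] ℂ) →L[ℂ] (L2per n →L[ℂ] ℂ) :=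
  ((ContinuousLinearMap.id ℂ (Cn n →L[ℂ] ℂ)).lpPairing
    (AddCircle.haarAddCircle : Measure UnitAddCircle) 2 2).comp
    (ContinuousMap.toLp 2 (AddCircle.haarAddCircle : Measure UnitAddCircle) ℂ)

lemma rowCLM_apply (p : C(UnitAddCircle, Cn n →L[ℂ] ℂ)) (w : L2per n) :
    rowCLM n p w = ∫ x, p x (w x) ∂AddCircle.haarAddCircle := by
  rw [rowCLM, ContinuousLinearMap.comp_apply, ContinuousLinearMap.lpPairing_eq_integral]
  apply integral_congr_ae
  filter_upwards [ContinuousMap.coeFn_toLp (p := 2) (𝕜 := ℂ)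
    (AddCircle.haarAddCircle : Measure UnitAddCircle) p] with x hx
  rw [hx]; rfl

lemma integrable_of_continuous {E : Type*} [NormedAddCommGroup E] (p : C(UnitAddCircle, E)) :
    Integrable p (AddCircle.haarAddCircle : Measure UnitAddCircle) :=
  p.continuous.integrable_of_hasCompactSupport (HasCompactSupport.of_compactSpace _)

/-- The pairing is bilinear rather than sesquilinear, so frequency `j` sees the coefficient of `p`
at `-j`. -/
lemma rowCLM_expVec (p : C(UnitAddCircle, Cn n →L[ℂ] ℂ)) (j : ℤ) (v : Cn n) :
    rowCLM n p (expVec n j v) = fourierCoeff p (-j) v := by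
  rw [rowCLM_apply, fourierCoeff, ← ContinuousLinearMap.apply_apply (𝕜 := ℂ) v (∫ _, _ ∂_),
    ← ContinuousLinearMap.integral_comp_comm _ ((integrable_of_continuous p).fourier_smul _)]
  apply integral_congr_ae
  filter_upwards [coeFn_expVec j v] with x hx
  rw [hx]
  simp

/-- The transpose of `(1 - ∂²)⁻¹`, with values in continuous row vectors. -/
def opRJ (n : ℕ) : (L2per n →L[ℂ] ℂ) →L[ℂ] C(UnitAddCircle, Cn n →L[ℂ] ℂ) :=
  fourierSumOp (fun j => (ContinuousLinearMap.compL ℂ (Cn n) (L2per n) ℂ).flip (expVec n (-j)))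
    fun j ψ => by
      rw [ContinuousLinearMap.flip_apply, ContinuousLinearMap.compL_apply]
      exact (ContinuousLinearMap.opNorm_comp_le _ _).trans
        (mul_le_of_le_one_right (norm_nonneg _) (norm_expVec_le _))

lemma hasSum_opRJ (ψ : L2per n →L[ℂ] ℂ) :
    HasSum (fun j : ℤ => jSym j • expFun (Cn n →L[ℂ] ℂ) j (ψ.comp (expVec n (-j))))
      (opRJ n ψ) := by
  have h := hasSum_fourierSumOp (L := fun j =>
    (ContinuousLinearMap.compL ℂ (Cn n) (L2per n) ℂ).flip (expVec n (-j)))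
    (fun j ψ => by
      rw [ContinuousLinearMap.flip_apply, ContinuousLinearMap.compL_apply]
      exact (ContinuousLinearMap.opNorm_comp_le _ _).trans
        (mul_le_of_le_one_right (norm_nonneg _) (norm_expVec_le _))) ψ
  simp only [ContinuousLinearMap.flip_apply, ContinuousLinearMap.compL_apply] at h
  exact h

lemma jSym_neg (j : ℤ) : jSym (-j) = jSym j := by
  simp [jSym]

/-- The symbol of `(1-∂²)⁻¹` is even, so the frequency flip of the bilinear pairing does not change
it. Thus any functional composed with the smoothing operator is integration against a continuous row
vector. -/
lemma rowCLM_opRJ (ψ : L2per n →L[ℂ] ℂ) : rowCLM n (opRJ n ψ) = ψ.comp (opJ n) := by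
  apply clm_ext_expVec
  intro k v
  have h2 : HasSum (fun j => rowCLM n (jSym j • expFun (Cn n →L[ℂ] ℂ) j
      (ψ.comp (expVec n (-j)))) (expVec n k v)) (rowCLM n (opRJ n ψ) (expVec n k v)) :=
    ((hasSum_opRJ ψ).mapL (rowCLM n)).mapL (ContinuousLinearMap.apply ℂ _ (expVec n k v))
  refine h2.unique ?_
  rw [ContinuousLinearMap.comp_apply, opJ_expVec, map_smul]
  convert hasSum_ite_eq (-k) (jSym k • ψ (expVec n k v)) using 2 with j
  rw [map_smul, smul_apply, rowCLM_expVec]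
  have h3 : fourierCoeff (expFun (Cn n →L[ℂ] ℂ) j (ψ.comp (expVec n (-j)))) (-k) =
      if -k = j then ψ.comp (expVec n (-j)) else 0 := fourierCoeff_fourier_smul _ _ _
  rw [h3]
  rcases eq_or_ne (-k) j with hj | hj
  · subst hj; simp [jSym_neg]
  · simp [hj, hj.symm]

/-- Multiplication by a continuous matrix function on `L²_per`. -/
def mulOp (A : C(UnitAddCircle, Cn n →L[ℂ] Cn n)) : L2per n →L[ℂ] L2per n :=
  (ContinuousLinearMap.id ℂ (Cn n →L[ℂ] Cn n)).holderL
    (AddCircle.haarAddCircle : Measure UnitAddCircle) ∞ 2 2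
    (ContinuousMap.toLp ∞ (AddCircle.haarAddCircle : Measure UnitAddCircle) ℂ A)

lemma coeFn_mulOp (A : C(UnitAddCircle, Cn n →L[ℂ] Cn n)) (w : L2per n) :
    (mulOp A w : UnitAddCircle → Cn n) =ᵐ[AddCircle.haarAddCircle] fun x => A x (w x) := by
  have h := ContinuousLinearMap.coeFn_holder (r := 2) (ContinuousLinearMap.id ℂ (Cn n →L[ℂ] Cn n))
    (ContinuousMap.toLp ∞ (AddCircle.haarAddCircle : Measure UnitAddCircle) ℂ A) w
  filter_upwards [h, ContinuousMap.coeFn_toLp (p := ∞) (𝕜 := ℂ)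
    (AddCircle.haarAddCircle : Measure UnitAddCircle) A] with x hx hA
  rw [hA] at hx
  exact hx

/-- The operator pencil `(L_ξ - μ)(1 - ∂²)⁻¹` for complex `ξ` and `μ`. -/
def pencil (c : ℝ) (A : C(UnitAddCircle, Cn n →L[ℂ] Cn n)) (ξ μ : ℂ) : L2per n →L[ℂ] L2per n :=
  (opJ n - ContinuousLinearMap.id ℂ _) + (2 * Complex.I * ξ + c) • opDJ n +
    ((Complex.I * ξ) ^ 2 + c * (Complex.I * ξ) - μ) • opJ n + (mulOp A).comp (opJ n)

/-- `H²_per` is the image of `(1-∂²)⁻¹`, by `IsPerDeriv.eq_opJ`. Parametrizing it by all of `L²`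
makes the Bloch operator a bounded operator, depending polynomially on `ξ`, with no domain left to
track. -/
lemma mem_blochGraph_iff (c : ℝ) (A : C(UnitAddCircle, Cn n →L[ℂ] Cn n)) (ξ : ℝ) (w z : L2per n) :
    (w, z) ∈ (blochOp c A ξ).graph ↔ ∃ h, w = opJ n h ∧ z = pencil c A ξ 0 h := by
  have key : ∀ h : L2per n, (pencil c A ξ 0 h : UnitAddCircle → Cn n)
      =ᵐ[AddCircle.haarAddCircle] fun x =>
      ((opJ n h - h : L2per n) x + (2 * Complex.I * ξ) • opDJ n h x
        + ((Complex.I * ξ) ^ 2) • opJ n h x)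
        + (c : ℂ) • (opDJ n h x + (Complex.I * ξ) • opJ n h x) + A x (opJ n h x) := by
    intro h
    have e : pencil c A ξ 0 h = (opJ n h - h) + (2 * Complex.I * ξ + c) • opDJ n h +
      ((Complex.I * ξ) ^ 2 + c * (Complex.I * ξ) - 0) • opJ n h + mulOp A (opJ n h) := rfl
    rw [e]
    filter_upwards [coeFn_mulOp A (opJ n h),
      Lp.coeFn_add ((opJ n h - h) + (2 * Complex.I * ξ + c) • opDJ n h +
        ((Complex.I * ξ) ^ 2 + c * (Complex.I * ξ) - 0) • opJ n h) (mulOp A (opJ n h)),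
      Lp.coeFn_add ((opJ n h - h) + (2 * Complex.I * ξ + c) • opDJ n h)
        (((Complex.I * ξ) ^ 2 + c * (Complex.I * ξ) - 0) • opJ n h),
      Lp.coeFn_add (opJ n h - h) ((2 * Complex.I * ξ + c) • opDJ n h),
      Lp.coeFn_smul (2 * Complex.I * ξ + c : ℂ) (opDJ n h),
      Lp.coeFn_smul ((Complex.I * ξ) ^ 2 + c * (Complex.I * ξ) - 0 : ℂ) (opJ n h)]
      with x h1 h2 h3 h4 h5 h6
    rw [h2, Pi.add_apply, h3, Pi.add_apply, h4, Pi.add_apply, h5, h6, h1]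
    simp only [Pi.smul_apply]
    module
  rw [blochOp_graph]
  constructor
  · rintro ⟨v₁, v₂, h₁, h₂, h⟩
    simp only at h₁ h
    refine ⟨w - v₂, h₁.eq_opJ h₂, ?_⟩
    have hw := h₁.eq_opJ h₂
    have e1 : v₁ = opDJ n (w - v₂) := h₁.unique (by
      conv_lhs => rw [hw]
      exact isPerDeriv_opJ _)
    have e2 : v₂ = opJ n (w - v₂) - (w - v₂) := h₂.unique (by
      conv_lhs => rw [e1]
      exact isPerDeriv_opDJ _)
    apply Lp.ext
    filter_upwards [h, key (w - v₂)] with x hx hk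
    rw [hk, hx, ← e2, ← e1, ← hw]
  · rintro ⟨h, rfl, rfl⟩
    exact ⟨opDJ n h, opJ n h - h, isPerDeriv_opJ h, isPerDeriv_opDJ h, key h⟩

end Smoothing

/-! ### Rank-one bordering and the Fredholm alternative -/

section Bordering

variable {H : Type*} [NormedAddCommGroup H] [NormedSpace ℂ H]

/-- The bordered operator `B + g ⊗ ℓ`. -/
def bordered (B : H →L[ℂ] H) (ℓ : H →L[ℂ] ℂ) (g : H) : H →L[ℂ] H := B + ℓ.smulRight g

lemma bordered_apply (B : H →L[ℂ] H) (ℓ : H →L[ℂ] ℂ) (g h : H) :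
    bordered B ℓ g h = B h + ℓ h • g := rfl

variable {B : H →L[ℂ] H} {ℓ : H →L[ℂ] ℂ} {g : H}

lemma inverse_bordered_apply (hT : IsUnit (bordered B ℓ g)) (h : H) :
    Ring.inverse (bordered B ℓ g) (B h + ℓ h • g) = h := by
  have := DFunLike.congr_fun (Ring.inverse_mul_cancel _ hT) h
  exact this

lemma bordered_inverse_apply (hT : IsUnit (bordered B ℓ g)) (h : H) :
    B (Ring.inverse (bordered B ℓ g) h) + ℓ (Ring.inverse (bordered B ℓ g) h) • g = h := by
  have := DFunLike.congr_fun (Ring.mul_inverse_cancel _ hT) h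
  exact this

/-- On the kernel of `B` the bordered operator is `h ↦ ℓ(h) g`; inverting it shows that the kernel
is at most one-dimensional. -/
lemma eq_of_bordered_kernel (hT : IsUnit (bordered B ℓ g)) {h : H} (hB : B h = 0) :
    h = ℓ h • Ring.inverse (bordered B ℓ g) g := by
  have := inverse_bordered_apply hT h
  rw [hB, zero_add, map_smul] at this
  exact this.symm

/-- With `T` the bordered operator, `B T⁻¹g + ℓ(T⁻¹g) g = g`: the scalar equation `ℓ(T⁻¹g) = 1` is
exactly what makes `T⁻¹g` a kernel vector. The next lemma is the dual statement, with left kernel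
functional `ℓ ∘ T⁻¹`. -/
lemma bordered_kernel_of_normalized (hT : IsUnit (bordered B ℓ g))
    (h1 : ℓ (Ring.inverse (bordered B ℓ g) g) = 1) :
    B (Ring.inverse (bordered B ℓ g) g) = 0 := by
  have := bordered_inverse_apply hT g
  rw [h1, one_smul] at this
  simpa using this

lemma bordered_left_kernel_of_normalized (hT : IsUnit (bordered B ℓ g))
    (h1 : ℓ (Ring.inverse (bordered B ℓ g) g) = 1) (h : H) :
    ℓ (Ring.inverse (bordered B ℓ g) (B h)) = 0 := by
  have := congrArg ℓ (inverse_bordered_apply hT h)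
  rw [map_add, map_smul, map_add, map_smul, h1, smul_eq_mul, mul_one] at this
  simpa using this

lemma eq_of_bordered_left_kernel (hT : IsUnit (bordered B ℓ g)) {ψ : H →L[ℂ] ℂ}
    (hψ : ∀ h, ψ (B h) = 0) (h : H) :
    ψ h = ψ g * ℓ (Ring.inverse (bordered B ℓ g) h) := by
  have := congrArg ψ (bordered_inverse_apply hT h)
  rw [map_add, map_smul, hψ, zero_add, smul_eq_mul, mul_comm] at this
  exact this.symm

/-- The range condition: the bordered solution solves `B x = h` itself as soon as the functional `ℓ
∘ T⁻¹` vanishes on `h`. -/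
lemma bordered_solve (hT : IsUnit (bordered B ℓ g)) {h : H}
    (h0 : ℓ (Ring.inverse (bordered B ℓ g) h) = 0) : B (Ring.inverse (bordered B ℓ g) h) = h := by
  have := bordered_inverse_apply hT h
  rwa [h0, zero_smul, add_zero] at this

/-- Fredholm alternative for the compact operator `T + 1`: either `1` is an eigenvalue, which
injectivity of `T` excludes, or `1 - (T + 1) = -T` is invertible. -/
lemma isUnit_of_compact_of_injective [CompleteSpace H] {T : H →L[ℂ] H}
    (hK : IsCompactOperator ⇑(T + 1 : H →L[ℂ] H)) (hinj : ∀ h, T h = 0 → h = 0) : IsUnit T := by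
  rcases IsCompactOperator.hasEigenvalue_or_mem_resolventSet hK (one_ne_zero (α := ℂ)) with h | h
  · exfalso
    obtain ⟨v, hv⟩ := h.exists_hasEigenvector
    refine hv.2 (hinj v ?_)
    have h1 := hv.apply_eq_smul
    rw [one_smul] at h1
    have h2 : T v + v = v := h1
    simpa using h2
  · rw [spectrum.mem_resolventSet_iff] at h
    have : algebraMap ℂ (H →L[ℂ] H) 1 - (T + 1) = -T := by rw [map_one]; abel
    rw [this] at h
    simpa using h.neg

end Bordering

/-! ### Compactness of the pencil and smoothness of its left kernel -/

section Pencil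

variable {n : ℕ} (c : ℝ) (A : C(UnitAddCircle, Cn n →L[ℂ] Cn n))

lemma pencil_apply (ξ μ : ℂ) (h : L2per n) : pencil c A ξ μ h =
    (opJ n h - h) + (2 * Complex.I * ξ + c) • opDJ n h +
    ((Complex.I * ξ) ^ 2 + c * (Complex.I * ξ) - μ) • opJ n h + mulOp A (opJ n h) := rfl

lemma pencil_eq_sub (ξ μ : ℂ) (h : L2per n) :
    pencil c A ξ μ h = pencil c A ξ 0 h - μ • opJ n h := by
  rw [pencil_apply, pencil_apply]
  module

lemma contDiff_pencil {m : ℕ∞ω} : ContDiff ℂ m (fun p : ℂ × ℂ => pencil c A p.1 p.2) := by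
  unfold pencil
  fun_prop

/-- Every term of the pencil except the summand `-1` contains `opJ` or `opDJ`, both compact. -/
lemma isCompactOperator_pencil_add_one (ξ μ : ℂ) : 
    IsCompactOperator ⇑(pencil c A ξ μ + 1 : L2per n →L[ℂ] L2per n) := by
  have h1 : (⇑(pencil c A ξ μ + 1 : L2per n →L[ℂ] L2per n) : L2per n → L2per n) =
      ⇑(opJ n) + ((2 * Complex.I * ξ + c) • ⇑(opDJ n)) +
      (((Complex.I * ξ) ^ 2 + c * (Complex.I * ξ) - μ) • ⇑(opJ n)) + (mulOp A) ∘ (opJ n) := by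
    ext1 h
    change pencil c A ξ μ h + h = opJ n h + (2 * Complex.I * ξ + c) • opDJ n h +
      ((Complex.I * ξ) ^ 2 + c * (Complex.I * ξ) - μ) • opJ n h + mulOp A (opJ n h)
    rw [pencil_apply]
    abel
  rw [h1]
  exact ((isCompactOperator_opJ.add (isCompactOperator_opDJ.smul _)).add
    (isCompactOperator_opJ.smul _)).add (isCompactOperator_opJ.clm_comp _)

/-- The zeroth-order part of `pencil + 1`. -/
def pencilN (ξ μ : ℂ) : L2per n →L[ℂ] L2per n :=
  (1 + (Complex.I * ξ) ^ 2 + c * (Complex.I * ξ) - μ) • ContinuousLinearMap.id ℂ (L2per n) + mulOp A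

/-- The operator `Z` with `(pencil + 1)² = Z (1 - ∂²)⁻¹`. -/
def pencilZ (ξ μ : ℂ) : L2per n →L[ℂ] L2per n :=
  (2 * Complex.I * ξ + c) ^ 2 • (opJ n - ContinuousLinearMap.id ℂ _) +
    (2 * Complex.I * ξ + c) • (opDJ n).comp (pencilN c A ξ μ) +
    (2 * Complex.I * ξ + c) • (pencilN c A ξ μ).comp (opDJ n) +
    (pencilN c A ξ μ).comp ((opJ n).comp (pencilN c A ξ μ))

lemma contDiff_pencilZ {m : ℕ∞ω} : ContDiff ℂ m (fun p : ℂ × ℂ => pencilZ c A p.1 p.2) := by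
  unfold pencilZ pencilN
  fun_prop

lemma pencil_add_self (ξ μ : ℂ) (h : L2per n) :
    pencil c A ξ μ h + h = (2 * Complex.I * ξ + c) • opDJ n h + pencilN c A ξ μ (opJ n h) := by
  have : pencilN c A ξ μ (opJ n h) =
    (1 + (Complex.I * ξ) ^ 2 + c * (Complex.I * ξ) - μ) • opJ n h + mulOp A (opJ n h) := rfl
  rw [pencil_apply, this]
  module

/-- An annihilator of the range satisfies `ψ = ψ ∘ (pencil + 1)`, and this is used twice. One step
leaves a bare `opDJ`, whose symbol decays only like `1/|j|`; the square has a full factor `opJ` on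
the right, by `opDJ² = (opJ - 1) opJ` and commutation. -/
lemma left_kernel_eq (ξ μ : ℂ) {ψ : L2per n →L[ℂ] ℂ} (hψ : ∀ h, ψ (pencil c A ξ μ h) = 0)
    (h : L2per n) : ψ h = ψ (pencilZ c A ξ μ (opJ n h)) := by
  have h1 : ∀ h, ψ h = ψ ((2 * Complex.I * ξ + c) • opDJ n h + pencilN c A ξ μ (opJ n h)) := by
    intro h
    rw [← pencil_add_self, map_add, hψ, zero_add]
  have e1 : opJ n (opDJ n h) = opDJ n (opJ n h) := DFunLike.congr_fun opJ_comp_opDJ h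
  have e2 : opDJ n (opDJ n h) = opJ n (opJ n h) - opJ n h := DFunLike.congr_fun opDJ_comp_opDJ h
  have e3 : pencilZ c A ξ μ (opJ n h) =
      (2 * Complex.I * ξ + c) ^ 2 • (opJ n (opJ n h) - opJ n h) +
      (2 * Complex.I * ξ + c) • opDJ n (pencilN c A ξ μ (opJ n h)) +
      (2 * Complex.I * ξ + c) • pencilN c A ξ μ (opDJ n (opJ n h)) +
      pencilN c A ξ μ (opJ n (pencilN c A ξ μ (opJ n h))) := rfl
  rw [h1 h, h1 ((2 * Complex.I * ξ + c) • opDJ n h + pencilN c A ξ μ (opJ n h)), e3]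
  congr 1
  simp only [map_add, map_smul, e1, e2]
  module

/-- An abstract left kernel functional is thereby a continuous row vector. Since `opRJ` is bounded
and linear, analytic dependence survives the passage to continuous functions. -/
lemma rowCLM_opRJ_pencilZ (ξ μ : ℂ) {ψ : L2per n →L[ℂ] ℂ}
    (hψ : ∀ h, ψ (pencil c A ξ μ h) = 0) :
    rowCLM n (opRJ n (ψ.comp (pencilZ c A ξ μ))) = ψ := by
  rw [rowCLM_opRJ]
  ext1 h
  exact (left_kernel_eq c A ξ μ hψ h).symm

end Pencil

/-! ### Analytic continuation of the simple eigenvalue -/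

section Branch

lemma contDiff_fourierSumOp {X F : Type*} [NormedAddCommGroup X] [NormedSpace ℂ X]
    [NormedAddCommGroup F] [NormedSpace ℂ F] [CompleteSpace F] (L : ℤ → X →L[ℂ] F)
    (hL : ∀ j x, ‖L j x‖ ≤ ‖x‖) {m : ℕ∞ω} : ContDiff ℂ m (fun x => fourierSumOp L hL x) :=
  (fourierSumOp L hL).contDiff

lemma contDiffAt_fourierSumOp_comp {X F : Type*} [NormedAddCommGroup X] [NormedSpace ℂ X]
    [NormedAddCommGroup F] [NormedSpace ℂ F] [CompleteSpace F] {L : ℤ → X →L[ℂ] F}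
    (hL : ∀ j x, ‖L j x‖ ≤ ‖x‖) {m : ℕ∞ω} {f : ℂ → X} {z : ℂ} (hf : ContDiffAt ℂ m f z) :
    ContDiffAt ℂ m (fun z => fourierSumOp L hL (f z)) z :=
  (contDiff_fourierSumOp L hL).contDiffAt.comp z hf

lemma contDiffAt_opRJ_comp {n : ℕ} {m : ℕ∞ω} {f : ℂ → L2per n →L[ℂ] ℂ} {z : ℂ}
    (hf : ContDiffAt ℂ m f z) : ContDiffAt ℂ m (fun z => opRJ n (f z)) z :=
  contDiffAt_fourierSumOp_comp _ hf

variable {n : ℕ} {c : ℝ} {A : C(UnitAddCircle, Cn n →L[ℂ] Cn n)}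

/-- The reduced (Lyapunov–Schmidt) bifurcation function. -/
def reduced (c : ℝ) (A : C(UnitAddCircle, Cn n →L[ℂ] Cn n)) (ℓ : L2per n →L[ℂ] ℂ) (g : L2per n)
    (p : ℂ × ℂ) : ℂ := ℓ (Ring.inverse (bordered (pencil c A p.1 p.2) ℓ g) g)

variable {ℓ : L2per n →L[ℂ] ℂ} {h₀ : L2per n}

lemma contDiffAt_inverse_bordered {g : L2per n} {p : ℂ × ℂ}
    (hT : IsUnit (bordered (pencil c A p.1 p.2) ℓ g)) {m : ℕ∞ω} : ContDiffAt ℂ m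
    (fun p : ℂ × ℂ => Ring.inverse (bordered (pencil c A p.1 p.2) ℓ g)) p := by
  have h1 : ContDiff ℂ m (fun p : ℂ × ℂ => bordered (pencil c A p.1 p.2) ℓ g) :=
    (contDiff_pencil c A).add contDiff_const
  obtain ⟨x, hx⟩ := hT
  have h2 := contDiffAt_ringInverse ℂ (n := m) x
  rw [hx] at h2
  exact h2.comp p h1.contDiffAt

lemma eventually_isUnit_bordered {g : L2per n}
    (hT : IsUnit (bordered (pencil c A 0 0) ℓ g)) :
    ∀ᶠ p : ℂ × ℂ in 𝓝 0, IsUnit (bordered (pencil c A p.1 p.2) ℓ g) := by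
  have h1 : Continuous (fun p : ℂ × ℂ => bordered (pencil c A p.1 p.2) ℓ g) :=
    ((contDiff_pencil c A (m := 0)).add contDiff_const).continuous
  have h2 : IsOpen {T : L2per n →L[ℂ] L2per n | IsUnit T} := Units.isOpen
  exact (h2.preimage h1).mem_nhds hT

lemma inverse_bordered_zero (hker : pencil c A 0 0 h₀ = 0) (hℓ : ℓ h₀ = 1)
    (hT : IsUnit (bordered (pencil c A 0 0) ℓ (opJ n h₀))) :
    Ring.inverse (bordered (pencil c A 0 0) ℓ (opJ n h₀)) (opJ n h₀) = h₀ := by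
  have := inverse_bordered_apply hT h₀
  rwa [hker, zero_add, hℓ, one_smul] at this

/-- With `T` the bordered operator, `∂_μ T = -opJ`, so `∂_μ (T⁻¹g) = T⁻¹ opJ T⁻¹ g`. At the origin
`T⁻¹g = h₀`, and the choice `g = opJ h₀` makes `T⁻¹ opJ h₀ = h₀` again, so the derivative is `ℓ(h₀)
= 1`. -/
lemma hasDerivAt_reduced (hker : pencil c A 0 0 h₀ = 0) (hℓ : ℓ h₀ = 1)
    (hT : IsUnit (bordered (pencil c A 0 0) ℓ (opJ n h₀))) :
    HasDerivAt (fun μ : ℂ => reduced c A ℓ (opJ n h₀) (0, μ)) 1 0 := by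
  have h1 : HasDerivAt (fun μ : ℂ => bordered (pencil c A 0 μ) ℓ (opJ n h₀)) (-opJ n) 0 := by
    have e : (fun μ : ℂ => bordered (pencil c A 0 μ) ℓ (opJ n h₀)) =
        fun μ : ℂ => bordered (pencil c A 0 0) ℓ (opJ n h₀) + μ • (-opJ n) := by
      ext1 μ
      ext1 h
      change pencil c A 0 μ h + ℓ h • opJ n h₀ =
        pencil c A 0 0 h + ℓ h • opJ n h₀ + μ • (-opJ n h)
      rw [pencil_eq_sub]
      module
    rw [e]
    simpa using ((hasDerivAt_id (0 : ℂ)).smul_const (-opJ n)).const_add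
      (bordered (pencil c A 0 0) ℓ (opJ n h₀))
  have hinv := inverse_bordered_zero hker hℓ hT
  obtain ⟨x, hx⟩ := hT
  have h2 := hasFDerivAt_ringInverse (𝕜 := ℂ) x
  rw [hx] at h2
  have h3 := h2.comp_hasDerivAt (0 : ℂ) h1
  have h4 := (((ContinuousLinearMap.apply ℂ (L2per n) (opJ n h₀))).hasFDerivAt.comp_hasDerivAt
    (0 : ℂ) h3)
  have h5 := ℓ.hasFDerivAt.comp_hasDerivAt (0 : ℂ) h4
  have e1 : (↑x⁻¹ : L2per n →L[ℂ] L2per n) (opJ n h₀) = h₀ := by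
    rw [← Ring.inverse_unit x, hx]
    exact hinv
  have e2 : ℓ (((ContinuousLinearMap.apply ℂ (L2per n)) (opJ n h₀))
      ((-((ContinuousLinearMap.mulLeftRight ℂ (L2per n →L[ℂ] L2per n)) ↑x⁻¹) ↑x⁻¹)
        (-opJ n))) = 1 := by
    change ℓ (-((↑x⁻¹ : L2per n →L[ℂ] L2per n) (-(opJ n ((↑x⁻¹ : L2per n →L[ℂ] L2per n)
      (opJ n h₀)))))) = 1
    rw [e1]
    simp [e1, hℓ]
  rw [e2] at h5
  exact h5

/-- Implicit function theorem in the analytic class for the scalar equation `reduced (ξ, μ) = 1`,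
whose `μ`-derivative at the origin is `1`. -/
lemma exists_eigenvalue_branch (hker : pencil c A 0 0 h₀ = 0) (hℓ : ℓ h₀ = 1)
    (hT : IsUnit (bordered (pencil c A 0 0) ℓ (opJ n h₀))) :
    ∃ m : ℂ → ℂ, m 0 = 0 ∧ ContDiffAt ℂ ω m 0 ∧
      ∀ᶠ ξ in 𝓝 (0 : ℂ), reduced c A ℓ (opJ n h₀) (ξ, m ξ) = 1 := by
  have hc : ContDiffAt ℂ ω (reduced c A ℓ (opJ n h₀)) ((0, 0) : ℂ × ℂ) :=
    ℓ.contDiff.contDiffAt.comp ((0, 0) : ℂ × ℂ)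
      ((contDiffAt_inverse_bordered (p := (0, 0)) hT).clm_apply contDiffAt_const)
  have h0 : reduced c A ℓ (opJ n h₀) (0, 0) = 1 := by
    rw [reduced, inverse_bordered_zero hker hℓ hT, hℓ]
  have hinv : (fderiv ℂ (reduced c A ℓ (opJ n h₀)) ((0, 0) : ℂ × ℂ) ∘L
      .inr ℂ ℂ ℂ).IsInvertible := by
    have h1 : HasDerivAt (fun μ : ℂ => ((0, μ) : ℂ × ℂ)) (0, 1) 0 :=
      (hasDerivAt_const _ _).prodMk (hasDerivAt_id _)
    have h2 := (hc.differentiableAt (by simp)).hasFDerivAt.comp_hasDerivAt (0 : ℂ) h1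
    have h3 := h2.unique (hasDerivAt_reduced hker hℓ hT)
    have h4 : fderiv ℂ (reduced c A ℓ (opJ n h₀)) ((0, 0) : ℂ × ℂ) ∘L .inr ℂ ℂ ℂ =
        ContinuousLinearMap.id ℂ ℂ := by
      ext
      simpa using h3
    rw [h4]
    exact ⟨ContinuousLinearEquiv.refl ℂ ℂ, rfl⟩
  refine ⟨hc.implicitFunction (by simp) hinv, hc.implicitFunction_apply_self (by simp) hinv,
    hc.contDiffAt_implicitFunction (by simp) hinv, ?_⟩
  have := hc.eventually_apply_implicitFunction (by simp) hinv
  rw [h0] at this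
  exact this

lemma eventually_analyticAt_ofReal {E : Type*} [NormedAddCommGroup E] [NormedSpace ℂ E]
    [CompleteSpace E] {f : ℂ → E} (hf : ContDiffAt ℂ ω f 0) :
    ∀ᶠ ξ : ℝ in 𝓝 0, AnalyticAt ℝ (fun ξ : ℝ => f ξ) ξ := by
  have h1 := hf.analyticAt.eventually_analyticAt
  have h2 : Tendsto (fun ξ : ℝ => (ξ : ℂ)) (𝓝 0) (𝓝 0) := by
    have := Complex.continuous_ofReal.tendsto 0
    rwa [Complex.ofReal_zero] at this
  filter_upwards [h2.eventually h1] with ξ hξ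
  exact (hξ.restrictScalars (𝕜 := ℝ)).comp (Complex.ofRealCLM.analyticAt ξ)

/-- Analytic perturbation of a simple eigenvalue of the pencil, with right and left
eigenfunctions that are analytic in the topology of continuous functions. -/
theorem exists_analytic_branch (hker : pencil c A 0 0 h₀ = 0) (hℓ : ℓ h₀ = 1)
    (hT : IsUnit (bordered (pencil c A 0 0) ℓ (opJ n h₀))) :
    ∃ (δ : ℝ) (mu : ℝ → ℂ) (q : ℝ → C(UnitAddCircle, Cn n))
      (qt : ℝ → C(UnitAddCircle, Cn n →L[ℂ] ℂ)), 0 < δ ∧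
      AnalyticOnNhd ℝ mu (Ioo (-δ) δ) ∧ AnalyticOnNhd ℝ q (Ioo (-δ) δ) ∧
      AnalyticOnNhd ℝ qt (Ioo (-δ) δ) ∧ mu 0 = 0 ∧ q 0 = opJc n h₀ ∧
      ∀ ξ ∈ Ioo (-δ) δ, (∃ h, q ξ = opJc n h ∧ pencil c A ξ (mu ξ) h = 0) ∧
        (∀ h, rowCLM n (qt ξ) (pencil c A ξ (mu ξ) h) = 0) ∧
        rowCLM n (qt ξ) (toL2per (q ξ)) = 1 := by
  obtain ⟨m, m0, mc, mE⟩ := exists_eigenvalue_branch hker hℓ hT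
  set g := opJ n h₀ with hg
  have hp : ContDiffAt ℂ ω (fun z : ℂ => (z, m z)) 0 := contDiffAt_id.prodMk mc
  have hp0 : (fun z : ℂ => (z, m z)) 0 = ((0, 0) : ℂ × ℂ) := by simp [m0]
  set R : ℂ → L2per n →L[ℂ] L2per n := fun z => Ring.inverse (bordered (pencil c A z (m z)) ℓ g)
    with hR
  have hRc : ContDiffAt ℂ ω R 0 := by
    have h1 := contDiffAt_inverse_bordered (p := (0, 0)) hT (m := ω)
    rw [← hp0] at h1
    exact h1.comp (0 : ℂ) hp
  have hR0 : R 0 g = h₀ := by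
    rw [hR]
    simp only [m0]
    exact inverse_bordered_zero hker hℓ hT
  have hU : ∀ᶠ z : ℂ in 𝓝 0, IsUnit (bordered (pencil c A z (m z)) ℓ g) := by
    have h1 := eventually_isUnit_bordered hT
    have h2 : Tendsto (fun z : ℂ => (z, m z)) (𝓝 0) (𝓝 ((0, 0) : ℂ × ℂ)) := by
      have := hp.continuousAt.tendsto
      simpa only [m0] using this
    exact h2.eventually h1
  set Q : ℂ → C(UnitAddCircle, Cn n) := fun z => opJc n (R z g) with hQ
  have hQc : ContDiffAt ℂ ω Q 0 :=
    (opJc n).contDiff.contDiffAt.comp (0 : ℂ) (hRc.clm_apply contDiffAt_const)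
  set ψ : ℂ → L2per n →L[ℂ] ℂ := fun z => ℓ.comp (R z) with hψ
  have hψc : ContDiffAt ℂ ω ψ 0 := contDiffAt_const.clm_comp hRc
  set P : ℂ → C(UnitAddCircle, Cn n →L[ℂ] ℂ) := fun z =>
    opRJ n ((ψ z).comp (pencilZ c A z (m z))) with hP
  have hZc : ContDiffAt ℂ ω (fun z : ℂ => pencilZ c A z (m z)) 0 := by
    have h1 : ContDiffAt ℂ ω (fun p : ℂ × ℂ => pencilZ c A p.1 p.2) ((0 : ℂ), m 0) :=
      (contDiff_pencilZ c A).contDiffAt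
    exact ContDiffAt.comp (g := fun p : ℂ × ℂ => pencilZ c A p.1 p.2)
      (f := fun z : ℂ => (z, m z)) (0 : ℂ) h1 hp
  have hPc : ContDiffAt ℂ ω P 0 := contDiffAt_opRJ_comp (hψc.clm_comp hZc)
  -- The pairing of the unnormalized left and right eigenfunctions. It equals `ℓ(h₀) = 1` at the
  -- origin because `g = opJ h₀`, so dividing by it is harmless for small `z`.
  set N : ℂ → ℂ := fun z => ψ z (opJ n (R z g)) with hN
  have hNc : ContDiffAt ℂ ω N 0 :=
    hψc.clm_apply ((opJ n).contDiff.contDiffAt.comp (0 : ℂ) (hRc.clm_apply contDiffAt_const))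
  have hN0 : N 0 = 1 := by
    rw [hN]
    simp only [hψ, ContinuousLinearMap.comp_apply]
    rw [hR0, ← hg, hR0, hℓ]
  have hNne : ∀ᶠ z : ℂ in 𝓝 0, N z ≠ 0 :=
    hNc.continuousAt.eventually_ne (by rw [hN0]; exact one_ne_zero)
  have hPNc : ContDiffAt ℂ ω (fun z => (N z)⁻¹ • P z) 0 :=
    (hNc.inv (by rw [hN0]; exact one_ne_zero)).smul hPc
  have htend : Tendsto (fun ξ : ℝ => (ξ : ℂ)) (𝓝 0) (𝓝 0) := by
    have := Complex.continuous_ofReal.tendsto 0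
    rwa [Complex.ofReal_zero] at this
  have hall := ((eventually_analyticAt_ofReal mc).and (eventually_analyticAt_ofReal hQc)).and
    ((eventually_analyticAt_ofReal hPNc).and (htend.eventually (hU.and (hNne.and mE))))
  obtain ⟨δ, hδ, hball⟩ := Metric.eventually_nhds_iff_ball.1 hall
  rw [Real.ball_eq_Ioo, zero_sub, zero_add] at hball
  refine ⟨δ, fun ξ => m ξ, fun ξ => Q ξ, fun ξ => (N ξ)⁻¹ • P ξ, hδ, fun ξ hξ => (hball ξ hξ).1.1,
    fun ξ hξ => (hball ξ hξ).1.2, fun ξ hξ => (hball ξ hξ).2.1, by simp [m0], ?_, ?_⟩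
  · simp only [Complex.ofReal_zero, hQ, hR0]
  intro ξ hξ
  obtain ⟨hu, hne, hE⟩ := (hball ξ hξ).2.2
  have hleft : ∀ h, ψ ξ (pencil c A ξ (m ξ) h) = 0 := fun h =>
    bordered_left_kernel_of_normalized hu hE h
  have hrow : rowCLM n (P ξ) = ψ ξ := rowCLM_opRJ_pencilZ c A ξ (m ξ) hleft
  refine ⟨⟨R ξ g, rfl, bordered_kernel_of_normalized hu hE⟩, fun h => ?_, ?_⟩
  · rw [map_smul, smul_apply, hrow, hleft, smul_zero]
  · rw [map_smul, smul_apply, hrow, toL2per_opJc, smul_eq_mul]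
    exact inv_mul_cancel₀ hne

end Branch

/-! ### Fourier coefficients and classical derivatives of Banach-valued functions -/

section FourierDerivative

variable {E : Type*} [NormedAddCommGroup E] [NormedSpace ℂ E] [CompleteSpace E]

omit [NormedSpace ℂ E] [CompleteSpace E] in
lemma continuous_coe_circle (p : C(UnitAddCircle, E)) : Continuous fun y : ℝ => p y :=
  p.continuous.comp (AddCircle.continuous_mk' 1)

omit [CompleteSpace E] in
lemma fourierCoeff_eq_integral_zero_one (p : C(UnitAddCircle, E)) (j : ℤ) :
    fourierCoeff p j = ∫ y in (0 : ℝ)..1, fourier (-j) (y : UnitAddCircle) • p y := by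
  rw [fourierCoeff_eq_intervalIntegral p j 0]
  simp

/-- Integration by parts over one period; the boundary terms cancel. -/
lemma fourierCoeff_of_hasDerivAt {p r : C(UnitAddCircle, E)}
    (h : ∀ y : ℝ, HasDerivAt (fun y : ℝ => p y) (r y) y) (j : ℤ) :
    fourierCoeff r j = (2 * Real.pi * Complex.I * j : ℂ) • fourierCoeff p j := by
  rw [fourierCoeff_eq_integral_zero_one, fourierCoeff_eq_integral_zero_one]
  have hd : ∀ y : ℝ, HasDerivAt (fun y : ℝ => (fourier (-j) (y : UnitAddCircle) : ℂ))
      (-2 * Real.pi * Complex.I * j * fourier (-j) (y : UnitAddCircle)) y := by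
    intro y
    simpa using hasDerivAt_fourier_neg 1 j y
  have h1 : ∀ y : ℝ, HasDerivAt (fun y : ℝ => (fourier (-j) (y : UnitAddCircle) : ℂ) • p y)
      ((fourier (-j) (y : UnitAddCircle) : ℂ) • r y +
      (-2 * Real.pi * Complex.I * j * fourier (-j) (y : UnitAddCircle)) • p y) y :=
    fun y => (hd y).smul (h y)
  have hf : Continuous fun y : ℝ => (fourier (-j) (y : UnitAddCircle) : ℂ) :=
    continuous_coe_circle _
  have c1 : Continuous fun y : ℝ => (fourier (-j) (y : UnitAddCircle) : ℂ) • r y :=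
    hf.smul (continuous_coe_circle r)
  have c2 : Continuous fun y : ℝ =>
      (-2 * Real.pi * Complex.I * j * fourier (-j) (y : UnitAddCircle) : ℂ) • p y :=
    (continuous_const.mul hf).smul (continuous_coe_circle p)
  have h2 := intervalIntegral.integral_eq_sub_of_hasDerivAt (a := 0) (b := 1)
    (fun y _ => h1 y) ((c1.add c2).intervalIntegrable 0 1)
  rw [intervalIntegral.integral_add (c1.intervalIntegrable 0 1) (c2.intervalIntegrable 0 1)] at h2
  have e1 : ((1 : ℝ) : UnitAddCircle) = ((0 : ℝ) : UnitAddCircle) := by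
    simp
  rw [e1, sub_self] at h2
  simp only [mul_smul (-2 * Real.pi * Complex.I * j : ℂ)] at h2
  rw [intervalIntegral.integral_smul] at h2
  rw [eq_neg_of_add_eq_zero_left h2, ← neg_smul]
  congr 1
  ring

lemma eq_zero_of_fourierCoeff_scalar {p : C(UnitAddCircle, ℂ)} (h : ∀ j, fourierCoeff p j = 0) :
    p = 0 := by
  apply ContinuousMap.toLp_injective (p := 2) (𝕜 := ℂ)
    (AddCircle.haarAddCircle : Measure UnitAddCircle)
  apply (fourierBasis (T := (1 : ℝ))).repr.injective
  ext j
  rw [map_zero, map_zero, fourierBasis_repr, fourierCoeff_congr_ae (ContinuousMap.coeFn_toLp _ p),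
    h j]
  rfl

lemma clm_fourierCoeff (φ : E →L[ℂ] ℂ) (p : C(UnitAddCircle, E)) (j : ℤ) :
    fourierCoeff (fun x => φ (p x)) j = φ (fourierCoeff p j) := by
  rw [fourierCoeff, fourierCoeff,
    ← ContinuousLinearMap.integral_comp_comm φ ((integrable_of_continuous p).fourier_smul _)]
  simp

/-- Continuous functionals commute with coefficients and separate points, which reduces to scalars.
A general Banach space `E` is needed, since later `E` is a space of continuous functions of `ξ`. -/
lemma eq_zero_of_fourierCoeff {p : C(UnitAddCircle, E)} (h : ∀ j, fourierCoeff p j = 0) :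
    p = 0 := by
  ext x
  apply SeparatingDual.eq_zero_of_forall_dual_eq_zero (R := ℂ)
  intro φ
  have h1 : (⟨fun x => φ (p x), φ.continuous.comp p.continuous⟩ : C(UnitAddCircle, ℂ)) = 0 := by
    apply eq_zero_of_fourierCoeff_scalar
    intro j
    refine (clm_fourierCoeff φ p j).trans ?_
    rw [h j, map_zero]
  exact DFunLike.congr_fun h1 x

omit [CompleteSpace E] in
lemma fourierCoeff_sub_continuous (p r : C(UnitAddCircle, E)) (j : ℤ) :
    fourierCoeff (p - r : C(UnitAddCircle, E)) j = fourierCoeff p j - fourierCoeff r j := by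
  rw [fourierCoeff, fourierCoeff, fourierCoeff,
    ← integral_sub ((integrable_of_continuous p).fourier_smul _)
    ((integrable_of_continuous r).fourier_smul _)]
  simp [smul_sub]

lemma eq_of_fourierCoeff {p r : C(UnitAddCircle, E)}
    (h : ∀ j, fourierCoeff p j = fourierCoeff r j) : p = r := by
  rw [← sub_eq_zero]
  apply eq_zero_of_fourierCoeff
  intro j
  rw [fourierCoeff_sub_continuous, h j, sub_self]

omit [NormedSpace ℂ E] [CompleteSpace E] in
/-- A periodic continuous function as a function on the circle. -/
lemma exists_lift_circle {f : ℝ → E} (hf : Continuous f) (hp : Function.Periodic f 1) :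
    ∃ p : C(UnitAddCircle, E), ∀ y : ℝ, p y = f y := by
  refine ⟨⟨hp.lift, ?_⟩, fun y => hp.lift_coe y⟩
  exact continuous_coinduced_dom.2 hf

/-- The primitive `∫₀ʸ r` is periodic because `r` has mean zero; a constant then adjusts its mean to
`e`. -/
lemma exists_primitive_circle {r : C(UnitAddCircle, E)} (hr : fourierCoeff r 0 = 0) (e : E) :
    ∃ R : C(UnitAddCircle, E), (∀ y : ℝ, HasDerivAt (fun y : ℝ => R y) (r y) y) ∧
      fourierCoeff R 0 = e := by
  have hc := continuous_coe_circle r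
  have hper : Function.Periodic (fun y : ℝ => ∫ s in (0 : ℝ)..y, r s) 1 := by
    intro y
    have h0 : ∫ s in (0 : ℝ)..1, r (s : UnitAddCircle) = 0 := by
      rw [fourierCoeff_eq_integral_zero_one] at hr
      simpa using hr
    have hpr : Function.Periodic (fun s : ℝ => r (s : UnitAddCircle)) 1 := fun s => by
      simp
    have h1 := hpr.intervalIntegral_add_eq y 0
    rw [zero_add, h0] at h1
    change ∫ s in (0 : ℝ)..(y + 1), r (s : UnitAddCircle) = ∫ s in (0 : ℝ)..y, r s
    rw [← intervalIntegral.integral_add_adjacent_intervals (hc.intervalIntegrable 0 y)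
      (hc.intervalIntegrable y (y + 1)), h1, add_zero]
  have hd : ∀ y : ℝ, HasDerivAt (fun y : ℝ => ∫ s in (0 : ℝ)..y, r (s : UnitAddCircle)) (r y) y :=
    fun y => hc.integral_hasStrictDerivAt 0 y |>.hasDerivAt
  obtain ⟨R, hR⟩ := exists_lift_circle
    (continuous_iff_continuousAt.2 fun y => (hd y).continuousAt) hper
  refine ⟨R + ContinuousMap.const _ (e - fourierCoeff R 0), fun y => ?_, ?_⟩
  · have : (fun y : ℝ => (R + ContinuousMap.const UnitAddCircle (e - fourierCoeff R 0) :
        C(UnitAddCircle, E)) (y : UnitAddCircle)) =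
        fun y => (∫ s in (0 : ℝ)..y, r s) + (e - fourierCoeff R 0) := by
      ext1 y
      rw [ContinuousMap.add_apply, hR]
      rfl
    rw [this]
    exact (hd y).add_const _
  · have h1 : ∀ p : C(UnitAddCircle, E), fourierCoeff p 0 = ∫ x, p x ∂AddCircle.haarAddCircle := by
      intro p
      simp [fourierCoeff]
    rw [h1, h1]
    simp only [ContinuousMap.add_apply, ContinuousMap.const_apply]
    rw [integral_add (integrable_of_continuous R) (integrable_const _), integral_const]
    simp

/-- The primitive of `r` with the mean of `p` has the same Fourier coefficients as `p`, hence is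
`p`. Weak relations between coefficients become classical derivatives. -/
lemma hasDerivAt_of_fourierCoeff {p r : C(UnitAddCircle, E)}
    (h : ∀ j, fourierCoeff r j = (2 * Real.pi * Complex.I * j : ℂ) • fourierCoeff p j) (y : ℝ) :
    HasDerivAt (fun y : ℝ => p y) (r y) y := by
  have h0 : fourierCoeff r 0 = 0 := by rw [h 0]; simp
  obtain ⟨R, hR, hR0⟩ := exists_primitive_circle h0 (fourierCoeff p 0)
  have : R = p := by
    apply eq_of_fourierCoeff
    intro j
    rcases eq_or_ne j 0 with rfl | hj
    · exact hR0
    · have h1 := (fourierCoeff_of_hasDerivAt hR j).symm.trans (h j)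
      refine smul_right_injective E ?_ h1
      simp [hj, Real.pi_ne_zero]
  rw [← this]
  exact hR y

end FourierDerivative

/-! ### Regularity of the profile and of the linearized coefficient -/

section Profile

variable {n K : ℕ} {c : ℝ} {f : EuclideanSpace ℝ (Fin n) → EuclideanSpace ℝ (Fin n)}
  {u : ℝ → EuclideanSpace ℝ (Fin n)}

/-- The inclusion `ℝⁿ → ℂⁿ` as a continuous linear map. -/
def toCnCLM (n : ℕ) : EuclideanSpace ℝ (Fin n) →L[ℝ] Cn n :=
  LinearMap.toContinuousLinearMap
    { toFun := toCn
      map_add' := fun v w => by ext i; simp [toCn]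
      map_smul' := fun a v => by ext i; simp [toCn] }

lemma toCnCLM_apply (v : EuclideanSpace ℝ (Fin n)) : toCnCLM n v = toCn v := rfl

/-- Complexification of real linear maps. -/
def complexify (n : ℕ) :
    (EuclideanSpace ℝ (Fin n) →L[ℝ] EuclideanSpace ℝ (Fin n)) →L[ℝ] (Cn n →L[ℂ] Cn n) :=
  LinearMap.toContinuousLinearMap
    { toFun := fun T => Matrix.toEuclideanCLM (𝕜 := ℂ) (Matrix.of fun i j =>
        (((T (EuclideanSpace.single j (1 : ℝ))) i : ℝ) : ℂ))
      map_add' := fun S T => by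
        rw [← map_add]
        congr 1
        ext i j
        simp
      map_smul' := fun a T => by
        rw [RingHom.id_apply, ← Complex.coe_smul, ← map_smul]
        congr 1
        ext i j
        simp }

lemma complexify_fderiv (v : EuclideanSpace ℝ (Fin n)) :
    complexify n (fderiv ℝ f v) = jac f v := rfl

lemma complexify_toCn (T : EuclideanSpace ℝ (Fin n) →L[ℝ] EuclideanSpace ℝ (Fin n))
    (v : EuclideanSpace ℝ (Fin n)) : complexify n T (toCn v) = toCn (T v) := by
  ext i
  have h1 : complexify n T (toCn v) i =
      ∑ j, (((T (EuclideanSpace.single j (1 : ℝ))) i : ℝ) : ℂ) * ((v j : ℝ) : ℂ) := by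
    rfl
  rw [h1]
  have h2 : v = ∑ j, v j • EuclideanSpace.single j (1 : ℝ) := by
    ext i
    simp [Pi.single_apply]
  conv_rhs => rw [h2]
  simp only [map_sum, map_smul, toCn]
  simp [mul_comm]

/-- Bootstrap on `u'' = -c u' - f(u)`: each round gains one derivative, until the regularity of `f`
is exhausted. -/
lemma IsPeriodicProfile.contDiff (hf : ContDiff ℝ K f) (hu : IsPeriodicProfile c f u) :
    ∀ m : ℕ, m ≤ K → ContDiff ℝ (m + 2 : ℕ) u := by
  intro m
  induction m with
  | zero => intro _; exact_mod_cast hu.smooth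
  | succ m ih =>
    intro hm
    have h1 := ih (by omega)
    have h2 : ContDiff ℝ (m + 1 : ℕ) (deriv u) :=
      ((contDiff_succ_iff_deriv (n := ((m + 1 : ℕ) : ℕ∞ω))).1 (by exact_mod_cast h1)).2.2
    have h3 : ContDiff ℝ (m + 1 : ℕ) (deriv (deriv u)) := by
      have e : deriv (deriv u) = fun x => -(c • deriv u x) - f (u x) := by
        ext1 x
        have := hu.eqn x
        rw [add_assoc] at this
        rw [eq_neg_of_add_eq_zero_left this]
        abel
      rw [e]
      refine ((h2.const_smul c).neg).sub ((hf.of_le ?_).comp (h1.of_le ?_))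
      · exact_mod_cast hm
      · exact_mod_cast Nat.le_succ _
    have h4 : ContDiff ℝ (m + 1 + 1 : ℕ) (deriv u) := by
      have := (contDiff_succ_iff_deriv (n := ((m + 1 : ℕ) : ℕ∞ω)) (f := deriv u)).2
        ⟨h2.differentiable (by simp), by simp, h3⟩
      exact_mod_cast this
    have := (contDiff_succ_iff_deriv (n := ((m + 1 + 1 : ℕ) : ℕ∞ω)) (f := u)).2
        ⟨h1.differentiable (by simp), by simp, h4⟩
    exact_mod_cast this

lemma IsPeriodicProfile.contDiff_jac (hK : 1 ≤ K) (hf : ContDiff ℝ K f)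
    (hu : IsPeriodicProfile c f u) : ContDiff ℝ (K - 1 : ℕ) (fun x => jac f (u x)) := by
  obtain ⟨k, rfl⟩ : ∃ k, K = k + 1 := ⟨K - 1, by omega⟩
  have h1 : ContDiff ℝ (k : ℕ) (fderiv ℝ f) :=
    hf.fderiv_right (by exact_mod_cast le_refl _)
  have h2 : ContDiff ℝ (k : ℕ) u := (hu.contDiff hf k (by omega)).of_le (by
    exact_mod_cast (by omega : k ≤ k + 2))
  exact (complexify n).contDiff.comp (h1.comp h2)

lemma IsPeriodicProfile.exists_coeff (hK : 1 ≤ K) (hf : ContDiff ℝ K f)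
    (hu : IsPeriodicProfile c f u) : ∃ A : C(UnitAddCircle, Cn n →L[ℂ] Cn n),
      coeffA f u = A ∧ ∀ y : ℝ, A y = jac f (u y) := by
  have hp : Function.Periodic (fun x => jac f (u x)) 1 := fun x => by
    change jac f (u (x + 1)) = _
    rw [hu.periodic x]
  obtain ⟨A, hA⟩ := exists_lift_circle (hu.contDiff_jac hK hf).continuous hp
  refine ⟨A, ?_, hA⟩
  ext1 x
  obtain ⟨y, hy, rfl⟩ := AddCircle.coe_image_Ico_eq (1 : ℝ) 0 ▸ Set.mem_univ x
  rw [coeffA, AddCircle.liftIco_coe_apply hy, hA]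

end Profile

/-! ### Generalized kernels in terms of graphs -/

section Graph

lemma graph_map_iff {H : Type*} [NormedAddCommGroup H] [NormedSpace ℂ H] (L : H →ₗ.[ℂ] H)
    (w z : H) : (w, z) ∈ L.graph ↔ ∃ hd : w ∈ L.domain, L ⟨w, hd⟩ = z := by
  rw [LinearPMap.mem_graph_iff]
  constructor
  · rintro ⟨y, rfl, hy⟩
    exact ⟨y.2, hy⟩
  · rintro ⟨hd, h⟩
    exact ⟨⟨w, hd⟩, rfl, h⟩

variable {H : Type*} [NormedAddCommGroup H] [NormedSpace ℂ H] {L : H →ₗ.[ℂ] H} {lam : ℂ}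

lemma mem_genKernel_succ {m : ℕ} {h : H} : h ∈ genKernel L lam (m + 1) ↔
    ∃ z, (h, z) ∈ L.graph ∧ z - lam • h ∈ genKernel L lam m := by
  constructor
  · rintro ⟨hd, hm⟩
    exact ⟨_, (graph_map_iff L _ _).2 ⟨hd, rfl⟩, hm⟩
  · rintro ⟨z, hz, hm⟩
    obtain ⟨hd, rfl⟩ := (graph_map_iff L _ _).1 hz
    exact ⟨hd, hm⟩

lemma mem_genKernel_one {h : H} (hh : (h, lam • h) ∈ L.graph) : h ∈ genKernel L lam 1 :=
  mem_genKernel_succ.2 ⟨_, hh, by rw [sub_self]; exact rfl⟩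

end Graph

/-! ### Existence of a critical branch -/

section ExistsBranch

variable {n K : ℕ} {c : ℝ} {f : EuclideanSpace ℝ (Fin n) → EuclideanSpace ℝ (Fin n)}
  {u : ℝ → EuclideanSpace ℝ (Fin n)}

lemma hasDerivAt_toCn {v : ℝ → EuclideanSpace ℝ (Fin n)} {v' : EuclideanSpace ℝ (Fin n)} {y : ℝ}
    (h : HasDerivAt v v' y) : HasDerivAt (fun y => toCn (v y)) (toCn v') y :=
  (toCnCLM n).hasFDerivAt.comp_hasDerivAt y h

lemma isPerDeriv_toL2per {p r : C(UnitAddCircle, Cn n)}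
    (h : ∀ y : ℝ, HasDerivAt (fun y : ℝ => p y) (r y) y) :
    IsPerDeriv (toL2per p) (toL2per r) := by
  intro j
  rw [fourierCoeff_congr_ae (coeFn_toL2per p), fourierCoeff_congr_ae (coeFn_toL2per r)]
  exact fourierCoeff_of_hasDerivAt h j

lemma periodic_deriv {E : Type*} [NormedAddCommGroup E] [NormedSpace ℝ E] {v : ℝ → E}
    (h : Function.Periodic v 1) : Function.Periodic (deriv v) 1 := by
  intro x
  rw [← deriv_comp_add_const]
  congr 1
  ext1 y
  exact h y

/-- The derivative of the profile is in the kernel of the linearization. -/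
lemma IsPeriodicProfile.exists_kernel (hK : 1 ≤ K) (hf : ContDiff ℝ K f)
    (hu : IsPeriodicProfile c f u) {A : C(UnitAddCircle, Cn n →L[ℂ] Cn n)}
    (hA : ∀ y : ℝ, A y = jac f (u y)) :
    ∃ (w : C(UnitAddCircle, Cn n)) (h₀ : L2per n), (∀ y : ℝ, w y = toCn (deriv u y)) ∧
      w ≠ 0 ∧ opJ n h₀ = toL2per w ∧ pencil c A 0 0 h₀ = 0 := by
  have hu3 : ContDiff ℝ (3 : ℕ) u := hu.contDiff hf 1 hK
  have c1 : ContDiff ℝ (2 : ℕ) (deriv u) :=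
    ((contDiff_succ_iff_deriv (n := ((2 : ℕ) : ℕ∞ω))).1 (by exact_mod_cast hu3)).2.2
  have c2 : ContDiff ℝ (1 : ℕ) (deriv (deriv u)) :=
    ((contDiff_succ_iff_deriv (n := ((1 : ℕ) : ℕ∞ω))).1 (by exact_mod_cast c1)).2.2
  have c3 : ContDiff ℝ (0 : ℕ) (deriv (deriv (deriv u))) :=
    ((contDiff_succ_iff_deriv (n := ((0 : ℕ) : ℕ∞ω))).1 (by exact_mod_cast c2)).2.2
  have p1 := periodic_deriv hu.periodic
  have p2 := periodic_deriv p1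
  have p3 := periodic_deriv p2
  have hlift : ∀ v : ℝ → EuclideanSpace ℝ (Fin n), Continuous v → Function.Periodic v 1 →
      ∃ p : C(UnitAddCircle, Cn n), ∀ y : ℝ, p y = toCn (v y) := fun v hv hp =>
    exists_lift_circle ((toCnCLM n).continuous.comp hv) (fun x => by
      rw [hp x])
  obtain ⟨w, hw⟩ := hlift _ c1.continuous p1
  obtain ⟨w1, hw1⟩ := hlift _ c2.continuous p2
  obtain ⟨w2, hw2⟩ := hlift _ c3.continuous p3
  have d1 : ∀ y : ℝ, HasDerivAt (fun y : ℝ => w y) (w1 y) y := by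
    intro y
    simp only [hw, hw1]
    exact hasDerivAt_toCn ((c1.differentiable (by simp)) y).hasDerivAt
  have d2 : ∀ y : ℝ, HasDerivAt (fun y : ℝ => w1 y) (w2 y) y := by
    intro y
    simp only [hw1, hw2]
    exact hasDerivAt_toCn ((c2.differentiable (by simp)) y).hasDerivAt
  -- Translation invariance: differentiating the profile equation gives `L_0 u' = 0`.
  have hode : ∀ x : UnitAddCircle, w2 x + (c : ℂ) • w1 x + A x (w x) = 0 := by
    intro x
    obtain ⟨y, rfl⟩ := QuotientAddGroup.mk_surjective x
    have e0 : ∀ z : ℝ, ((QuotientAddGroup.mk z : UnitAddCircle)) = (z : UnitAddCircle) :=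
      fun _ => rfl
    rw [e0, hw2, hw1, hw, hA, ← complexify_fderiv, complexify_toCn, Complex.coe_smul,
      ← toCnCLM_apply, ← toCnCLM_apply, ← toCnCLM_apply, ← map_smul, ← map_add, ← map_add]
    have h1 : HasDerivAt (fun x => deriv (deriv u) x + c • deriv u x + f (u x))
        (deriv (deriv (deriv u)) y + c • deriv (deriv u) y + fderiv ℝ f (u y) (deriv u y)) y := by
      refine ((((c2.differentiable (by simp)) y).hasDerivAt).add
        ((((c1.differentiable (by simp)) y).hasDerivAt).const_smul c)).add ?_
      have h2 : DifferentiableAt ℝ f (u y) := (hf.differentiable (by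
        exact_mod_cast (by omega : K ≠ 0))) (u y)
      exact h2.hasFDerivAt.comp_hasDerivAt y ((hu3.differentiable (by simp)) y).hasDerivAt
    have h2 : (fun x => deriv (deriv u) x + c • deriv u x + f (u x)) = fun _ => 0 :=
      funext hu.eqn
    rw [h2] at h1
    rw [h1.unique (hasDerivAt_const y _), map_zero]
  have hgr : (toL2per w, 0) ∈ (blochOp c A ((0 : ℝ))).graph := by
    rw [blochOp_graph]
    refine ⟨toL2per w1, toL2per w2, isPerDeriv_toL2per d1, isPerDeriv_toL2per d2, ?_⟩
    filter_upwards [coeFn_toL2per w, coeFn_toL2per w1, coeFn_toL2per w2,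
      Lp.coeFn_zero (Cn n) 2 (AddCircle.haarAddCircle : Measure UnitAddCircle)] with x h1 h2 h3 h4
    rw [h1, h2, h3, h4, Pi.zero_apply, ← hode x]
    simp
  obtain ⟨h₀, e1, e2⟩ := (mem_blochGraph_iff c A 0 _ _).1 hgr
  refine ⟨w, h₀, hw, ?_, e1.symm, ?_⟩
  · rintro rfl
    obtain ⟨x, y, hxy⟩ := hu.nonconst
    apply hxy
    refine is_const_of_deriv_eq_zero (hu3.differentiable (by simp)) (fun z => ?_) x y
    have := hw z
    rw [ContinuousMap.zero_apply] at this
    ext i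
    have h5 := congrArg (fun v : Cn n => v i) this.symm
    simpa [toCn] using h5
  · rw [Complex.ofReal_zero] at e2
    exact e2.symm

variable {A : C(UnitAddCircle, Cn n →L[ℂ] Cn n)}

/-- By the Fredholm alternative only injectivity matters, and this is where algebraic simplicity
enters. If `B h = -ℓ(h) opJ h₀` for the pencil `B`, then `opJ h` lies in the kernel of `L_0²`, so
simplicity gives `h = ℓ(h) h₀`. Then `B h = 0`, hence `ℓ(h) = 0` and `h = 0`. -/
lemma isUnit_bordered_of_simple {h₀ : L2per n} (h0 : h₀ ≠ 0) (hker : pencil c A 0 0 h₀ = 0)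
    (hD1 : IsSimpleEigenvalue (blochOp c A 0) 0) {ℓ : L2per n →L[ℂ] ℂ} (hℓ : ℓ h₀ = 1) :
    IsUnit (bordered (pencil c A 0 0) ℓ (opJ n h₀)) := by
  obtain ⟨v, hv0, hv⟩ := hD1
  have hgr : ∀ h, (opJ n h, pencil c A 0 0 h) ∈ (blochOp c A 0).graph := fun h =>
    (mem_blochGraph_iff c A 0 _ _).2 ⟨h, rfl, by simp⟩
  have hg1 : opJ n h₀ ∈ genKernel (blochOp c A 0) 0 1 := by
    apply mem_genKernel_one
    rw [zero_smul, ← hker]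
    exact hgr h₀
  obtain ⟨b, hb⟩ := (hv _).1 ⟨1, hg1⟩
  have hb0 : b ≠ 0 := by
    rintro rfl
    rw [zero_smul] at hb
    exact h0 (opJ_injective (hb.trans (map_zero _).symm))
  have key : ∀ h, opJ n h ∈ genEigenspace (blochOp c A 0) 0 → h = ℓ h • h₀ := by
    intro h hh
    obtain ⟨a, ha⟩ := (hv _).1 hh
    have h1 : h = (a / b) • h₀ := by
      apply opJ_injective
      rw [map_smul, ha, hb, smul_smul, div_mul_cancel₀ _ hb0]
    have h2 := congrArg ℓ h1
    rw [map_smul, hℓ, smul_eq_mul, mul_one] at h2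
    rw [h2, ← h1]
  apply isUnit_of_compact_of_injective
  · have h1 := isCompactOperator_pencil_add_one c A 0 0
    have h2 : IsCompactOperator (ℓ.smulRight (opJ n h₀)) := by
      have h3 : IsCompactOperator (ContinuousLinearMap.toSpanSingleton ℂ (opJ n h₀)) := by
        rw [isCompactOperator_iff_exists_mem_nhds_image_subset_compact]
        exact ⟨Metric.closedBall 0 1, Metric.closedBall_mem_nhds _ one_pos, _,
          (isCompact_closedBall 0 1).image
            (ContinuousLinearMap.toSpanSingleton ℂ (opJ n h₀)).continuous, subset_rfl⟩
      exact h3.comp_clm ℓ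
    have e : (⇑(bordered (pencil c A 0 0) ℓ (opJ n h₀) + 1 : L2per n →L[ℂ] L2per n) :
        L2per n → L2per n) = ⇑(pencil c A 0 0 + 1 : L2per n →L[ℂ] L2per n) +
        ⇑(ℓ.smulRight (opJ n h₀)) := by
     ext1 h
     change pencil c A 0 0 h + ℓ h • opJ n h₀ + h = pencil c A 0 0 h + h + ℓ h • opJ n h₀
     abel
    rw [e]
    exact h1.add h2
  · intro h hh
    rw [bordered_apply] at hh
    have h1 : opJ n h ∈ genEigenspace (blochOp c A 0) 0 := by
      -- A chain of length two: `L_0` sends `opJ h` to a multiple of `opJ h₀`, which `L_0`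
      -- annihilates.
      refine ⟨2, mem_genKernel_succ.2 ⟨_, hgr h, ?_⟩⟩
      rw [zero_smul, sub_zero, eq_neg_of_add_eq_zero_left hh, ← neg_smul]
      apply mem_genKernel_one
      have h2 := hgr (-ℓ h • h₀)
      rw [map_smul, map_smul, hker, smul_zero] at h2
      rwa [zero_smul]
    have h2 := key h h1
    have h3 : pencil c A 0 0 h = 0 := by rw [h2, map_smul, hker, smul_zero]
    rw [h3, zero_add] at hh
    have h4 : ℓ h = 0 := by
      rcases smul_eq_zero.1 hh with h5 | h5
      · exact h5
      · exact absurd (opJ_injective (h5.trans (map_zero _).symm)) h0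
    rw [h2, h4, zero_smul]

lemma exists_normalized_functional {h₀ : L2per n} (h0 : h₀ ≠ 0) :
    ∃ ℓ : L2per n →L[ℂ] ℂ, ℓ h₀ = 1 := by
  refine ⟨((inner ℂ h₀ h₀ : ℂ)⁻¹) • innerSL ℂ h₀, ?_⟩
  rw [smul_apply, innerSL_apply_apply, smul_eq_mul]
  exact inv_mul_cancel₀ (inner_self_ne_zero.2 h0)

theorem exists_isCriticalBranch (hK : 1 ≤ K) (hf : ContDiff ℝ K f)
    (hu : IsPeriodicProfile c f u) (hD1 : CondD1 c f u) :
    ∃ (δ : ℝ) (mu : ℝ → ℂ) (q : ℝ → C(UnitAddCircle, Cn n))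
      (qt : ℝ → C(UnitAddCircle, Cn n →L[ℂ] ℂ)), IsCriticalBranch c f u δ mu q qt := by
  obtain ⟨A, hA, hAy⟩ := hu.exists_coeff hK hf
  obtain ⟨w, h₀, hw, hw0, hJ, hker⟩ := hu.exists_kernel hK hf hAy
  have hc : opJc n h₀ = w := toL2per_injective (by rw [toL2per_opJc, hJ])
  have h0 : h₀ ≠ 0 := by
    rintro rfl
    exact hw0 (by rw [← hc, map_zero])
  obtain ⟨ℓ, hℓ⟩ := exists_normalized_functional h0
  rw [CondD1, linBloch, hA] at hD1
  obtain ⟨δ, mu, q, qt, hδ, a1, a2, a3, m0, q0, hall⟩ :=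
    exists_analytic_branch hker hℓ (isUnit_bordered_of_simple h0 hker hD1 hℓ)
  refine ⟨δ, mu, q, qt, hδ, a1, a2, a3, m0, fun x => ?_, fun ξ hξ => ?_, fun ξ hξ z => ?_,
    fun ξ hξ => ?_⟩
  · rw [q0, hc, hw]
  · obtain ⟨⟨h, hq, hp⟩, -⟩ := hall ξ hξ
    rw [linBloch, hA, mem_blochGraph_iff]
    refine ⟨h, by rw [hq, toL2per_opJc], ?_⟩
    rw [pencil_eq_sub, sub_eq_zero] at hp
    rw [hp, hq, toL2per_opJc]
  · obtain ⟨-, hl, -⟩ := hall ξ hξ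
    rw [← rowCLM_apply, ← rowCLM_apply]
    have hz : ((z : L2per n), linBloch c f u ξ z) ∈ (blochOp c A ξ).graph := by
      rw [← hA]
      exact LinearPMap.mem_graph _ z
    obtain ⟨h, e1, e2⟩ := (mem_blochGraph_iff c A ξ _ _).1 hz
    have h1 := hl h
    rw [pencil_eq_sub, map_sub, map_smul, sub_eq_zero] at h1
    rw [e1, e2, h1, smul_eq_mul]
  · obtain ⟨-, -, h1⟩ := hall ξ hξ
    rw [rowCLM_apply] at h1
    rw [← h1]
    apply integral_congr_ae
    filter_upwards [coeFn_toL2per (q ξ)] with x hx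
    rw [hx]

end ExistsBranch

/-! ### Bounded perturbation of contraction semigroups -/

section Perturbation

open scoped BoundedContinuousFunction

variable {H : Type*} [NormedAddCommGroup H] [NormedSpace ℂ H]

/-- `T` is a strongly continuous semigroup on `t ≥ 0` whose generator has graph `G`. -/
structure IsSemigroupWithGraph (G : Set (H × H)) (T : ℝ → H →L[ℂ] H) : Prop where
  zero : T 0 = ContinuousLinearMap.id ℂ H
  add : ∀ s t : ℝ, 0 ≤ s → 0 ≤ t → T (s + t) = (T s).comp (T t)
  cont : ∀ h : H, Tendsto (fun t => T t h) (𝓝[>] 0) (𝓝 h)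
  gen : ∀ h z : H,
    Tendsto (fun t : ℝ => ((t : ℂ)⁻¹) • (T t h - h)) (𝓝[>] 0) (𝓝 z) ↔ (h, z) ∈ G

/-- Product rule at `t = 0`: multiplying the semigroup by `e^{at}` adds `a` to the generator. -/
lemma IsSemigroupWithGraph.rescale {G G' : Set (H × H)} {T : ℝ → H →L[ℂ] H}
    (hT : IsSemigroupWithGraph G T) (a : ℂ) (hG : ∀ h z, (h, z) ∈ G' ↔ (h, z - a • h) ∈ G) :
    IsSemigroupWithGraph G' (fun t => Complex.exp (a * t) • T t) where
  zero := by simp [hT.zero]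
  add s t hs ht := by
    ext1 h
    simp only [hT.add s t hs ht, smul_apply, ContinuousLinearMap.comp_apply, map_smul, smul_smul,
      ← Complex.exp_add]
    congr 2
    push_cast
    ring
  cont h := by
    have h1 : Tendsto (fun t : ℝ => Complex.exp (a * t)) (𝓝[>] 0) (𝓝 1) := by
      have : Continuous fun t : ℝ => Complex.exp (a * t) := by fun_prop
      have h2 := this.tendsto 0
      simp only [Complex.ofReal_zero, mul_zero, Complex.exp_zero] at h2
      exact h2.mono_left nhdsWithin_le_nhds
    simpa using h1.smul (hT.cont h)
  gen h z := by
    rw [hG, ← hT.gen]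
    have hE : Continuous fun t : ℝ => Complex.exp (a * t) := by fun_prop
    have h1 : Tendsto (fun t : ℝ => Complex.exp (a * t)) (𝓝[>] 0) (𝓝 1) := by
      have h2 := hE.tendsto 0
      simp only [Complex.ofReal_zero, mul_zero, Complex.exp_zero] at h2
      exact h2.mono_left nhdsWithin_le_nhds
    have h2 : Tendsto (fun t : ℝ => (t : ℂ)⁻¹ * (Complex.exp (a * t) - 1)) (𝓝[>] 0) (𝓝 a) := by
      have hd : HasDerivAt (fun t : ℝ => Complex.exp (a * t)) a 0 := by
        have := (((hasDerivAt_id (0 : ℝ)).ofReal_comp).const_mul a).cexp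
        simpa using this
      have := hd.tendsto_slope_zero_right
      simpa using this
    have e1 : ∀ t : ℝ, (t : ℂ)⁻¹ • ((Complex.exp (a * t) • T t) h - h) =
        Complex.exp (a * t) • ((t : ℂ)⁻¹ • (T t h - h)) +
        ((t : ℂ)⁻¹ * (Complex.exp (a * t) - 1)) • h := by
      intro t
      rw [smul_apply]
      module
    simp only [e1]
    constructor
    · intro h3
      have h4 := (h3.sub (h2.smul_const h))
      have h5 := (h1.inv₀ one_ne_zero).smul h4
      rw [inv_one, one_smul] at h5
      refine h5.congr fun t => ?_
      rw [add_sub_cancel_right, smul_smul, inv_mul_cancel₀ (Complex.exp_ne_zero _), one_smul]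
    · intro h3
      have := (h1.smul h3).add (h2.smul_const h)
      simpa using this

variable {U : ℝ → H →L[ℂ] H} {lam : ℝ}

lemma continuous_uncurry_of_strong (hU : ∀ t, ‖U t‖ ≤ 1) (hc : ∀ h, Continuous fun t => U t h) :
    Continuous fun p : ℝ × H => U p.1 p.2 := by
  rw [continuous_iff_continuousAt]
  rintro ⟨t, h⟩
  rw [ContinuousAt, tendsto_iff_norm_sub_tendsto_zero]
  have h1 : Tendsto (fun p : ℝ × H => ‖p.2 - h‖ + ‖U p.1 h - U t h‖) (𝓝 (t, h)) (𝓝 0) := by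
    have : Continuous fun p : ℝ × H => ‖p.2 - h‖ + ‖U p.1 h - U t h‖ :=
      ((continuous_snd.sub continuous_const).norm).add
        ((((hc h).comp continuous_fst).sub continuous_const).norm)
    simpa using this.tendsto (t, h)
  refine squeeze_zero (fun _ => norm_nonneg _) (fun p => ?_) h1
  have e : U p.1 p.2 - U t h = U p.1 (p.2 - h) + (U p.1 h - U t h) := by
    rw [map_sub]; abel
  rw [e]
  refine (norm_add_le _ _).trans (add_le_add_left ?_ _)
  exact ((U p.1).le_of_opNorm_le (hU _) _).trans_eq (one_mul _)

lemma integral_exp_decay_le (hlam : 0 < lam) {t : ℝ} :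
    ∫ s in (0 : ℝ)..t, Real.exp (-lam * (t - s)) ≤ lam⁻¹ := by
  have hd : ∀ s, HasDerivAt (fun s => lam⁻¹ * Real.exp (-lam * (t - s)))
      (Real.exp (-lam * (t - s))) s := by
    intro s
    have h1 : HasDerivAt (fun s => -lam * (t - s)) lam s := by
      simpa using ((hasDerivAt_id s).const_sub t).const_mul (-lam)
    have h2 := h1.exp.const_mul lam⁻¹
    rwa [mul_comm (Real.exp _), inv_mul_cancel_left₀ hlam.ne'] at h2
  rw [intervalIntegral.integral_eq_sub_of_hasDerivAt (fun s _ => hd s)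
    ((by fun_prop : Continuous fun s => Real.exp (-lam * (t - s))).intervalIntegrable _ _)]
  simp only [sub_self, mul_zero, Real.exp_zero, mul_one, sub_zero]
  have : 0 ≤ lam⁻¹ * Real.exp (-lam * t) := by positivity
  linarith

/-- The Volterra operator `v ↦ ∫₀ᵗ U(t-s) A v(s) ds`. -/
def volterra (hlam : 0 < lam) (hU : ∀ t, ‖U t‖ ≤ Real.exp (-lam * max t 0))
    (hc : ∀ h, Continuous fun t => U t h) (A : H →L[ℂ] H) : (ℝ →ᵇ H) →L[ℂ] (ℝ →ᵇ H) :=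
  have hU1 : ∀ t, ‖U t‖ ≤ 1 := fun t => (hU t).trans (by
    rw [Real.exp_le_one_iff]
    nlinarith [le_max_right t 0])
  have hF : ∀ v : ℝ →ᵇ H, Continuous fun p : ℝ × ℝ => U (max p.1 0 - p.2) (A (v p.2)) :=
    fun v => (continuous_uncurry_of_strong hU1 hc).comp
      (((continuous_fst.max continuous_const).sub continuous_snd).prodMk
        (A.continuous.comp (v.continuous.comp continuous_snd)))
  -- The weight `e^{-λ(t-s)}` integrates to at most `1/λ`, uniformly in `t`. Replacing `t` by `max t
  -- 0` freezes the function for negative times, so that it is bounded and continuous on the whole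
  -- line.
  have hb : ∀ (v : ℝ →ᵇ H) (t : ℝ),
      ‖∫ s in (0 : ℝ)..max t 0, U (max t 0 - s) (A (v s))‖ ≤ (‖A‖ / lam) * ‖v‖ := by
    intro v t
    set τ := max t 0
    have h0 : 0 ≤ τ := le_max_right _ _
    have h1 : ‖∫ s in (0 : ℝ)..τ, U (τ - s) (A (v s))‖ ≤
        ∫ s in (0 : ℝ)..τ, Real.exp (-lam * (τ - s)) * (‖A‖ * ‖v‖) := by
      refine intervalIntegral.norm_integral_le_of_norm_le h0 ?_
        ((by fun_prop : Continuous fun s =>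
          Real.exp (-lam * (τ - s)) * (‖A‖ * ‖v‖)).intervalIntegrable _ _)
      refine Eventually.of_forall fun s hs => ?_
      refine ((U (τ - s)).le_opNorm _).trans ?_
      refine mul_le_mul ((hU _).trans_eq ?_) ((A.le_opNorm _).trans ?_) (norm_nonneg _)
        (Real.exp_pos _).le
      · rw [max_eq_left (by linarith [hs.2])]
      · exact mul_le_mul_of_nonneg_left (v.norm_coe_le_norm s) (norm_nonneg _)
    refine h1.trans ?_
    rw [intervalIntegral.integral_mul_const]
    have := mul_le_mul_of_nonneg_right (integral_exp_decay_le hlam (t := τ))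
      (by positivity : 0 ≤ ‖A‖ * ‖v‖)
    refine this.trans_eq ?_
    ring
  LinearMap.mkContinuous
    { toFun := fun v => BoundedContinuousFunction.ofNormedAddCommGroup
        (fun t => ∫ s in (0 : ℝ)..max t 0, U (max t 0 - s) (A (v s)))
        (intervalIntegral.continuous_parametric_intervalIntegral_of_continuous (μ := volume)
          (f := fun t s => U (max t 0 - s) (A (v s))) (a₀ := 0)
          (hF v) (continuous_id.max continuous_const))
        ((‖A‖ / lam) * ‖v‖) (hb v)
      map_add' := fun v w => by
        ext1 t
        have i1 : ∀ v : ℝ →ᵇ H, IntervalIntegrable (fun s => U (max t 0 - s) (A (v s))) volume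
            0 (max t 0) := fun v =>
          ((hF v).comp (Continuous.prodMk_right t)).intervalIntegrable _ _
        change ∫ s in (0 : ℝ)..max t 0, U (max t 0 - s) (A ((v + w) s)) =
          (∫ s in (0 : ℝ)..max t 0, U (max t 0 - s) (A (v s))) +
          ∫ s in (0 : ℝ)..max t 0, U (max t 0 - s) (A (w s))
        rw [← intervalIntegral.integral_add (i1 v) (i1 w)]
        simp
      map_smul' := fun a v => by
        ext1 t
        change ∫ s in (0 : ℝ)..max t 0, U (max t 0 - s) (A ((a • v) s)) =
          a • ∫ s in (0 : ℝ)..max t 0, U (max t 0 - s) (A (v s))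
        rw [← intervalIntegral.integral_smul]
        simp }
    (‖A‖ / lam) (fun v => BoundedContinuousFunction.norm_ofNormedAddCommGroup_le _
      (mul_nonneg (div_nonneg (norm_nonneg _) hlam.le) (norm_nonneg _)) (hb v))

lemma norm_volterra_le (hlam : 0 < lam) (hU : ∀ t, ‖U t‖ ≤ Real.exp (-lam * max t 0))
    (hc : ∀ h, Continuous fun t => U t h) (A : H →L[ℂ] H) :
    ‖volterra hlam hU hc A‖ ≤ ‖A‖ / lam := by
  unfold volterra
  exact LinearMap.mkContinuous_norm_le _ (div_nonneg (norm_nonneg A) hlam.le) _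

/-- The orbit map `h ↦ U(·) h`. -/
def orbitMap (hU : ∀ t, ‖U t‖ ≤ 1) (hc : ∀ h, Continuous fun t => U t h) : H →L[ℂ] (ℝ →ᵇ H) :=
  LinearMap.mkContinuous
    { toFun := fun h => BoundedContinuousFunction.ofNormedAddCommGroup (fun t => U t h) (hc h) ‖h‖
        (fun t => ((U t).le_of_opNorm_le (hU t) h).trans_eq (one_mul _))
      map_add' := fun h k => by
        ext1 t
        exact map_add (U t) h k
      map_smul' := fun a h => by
        ext1 t
        exact map_smul (U t) a h } 1
    (fun h => BoundedContinuousFunction.norm_ofNormedAddCommGroup_le _ (by positivity)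
      (fun t => (U t).le_of_opNorm_le (hU t) h))

variable [CompleteSpace H]

/-- Bounded perturbation of a strongly continuous contraction semigroup. -/
theorem exists_perturbed_semigroup {A : H →L[ℂ] H} {G G' : Set (H × H)} (hA : ‖A‖ < lam)
    (hG : IsSemigroupWithGraph G U) (hU : ∀ t, ‖U t‖ ≤ Real.exp (-lam * max t 0))
    (hc : ∀ h, Continuous fun t => U t h) (hmax : ∀ t, U t = U (max t 0))
    (hG' : ∀ h z, (h, z) ∈ G' ↔ (h, z - A h) ∈ G) :
    ∃ T : ℝ → H →L[ℂ] H, IsSemigroupWithGraph G' T := by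
  have hlam : 0 < lam := (norm_nonneg A).trans_lt hA
  have hU1 : ∀ t, ‖U t‖ ≤ 1 := fun t => (hU t).trans (by
    rw [Real.exp_le_one_iff]
    nlinarith [le_max_right t 0])
  have hjoint := continuous_uncurry_of_strong hU1 hc
  set V := volterra hlam hU hc A with hV
  have hVn : ‖V‖ < 1 := by
    refine (norm_volterra_le hlam hU hc A).trans_lt ?_
    rwa [div_lt_one hlam]
  -- Neumann series: the Duhamel equation `w = U(·)h + V w` has exactly one bounded continuous
  -- solution, `W (ι h)`. Its existence defines the semigroup, its uniqueness gives the semigroup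
  -- law.
  have hunit : IsUnit (1 - V) := isUnit_one_sub_of_norm_lt_one hVn
  set W := Ring.inverse (1 - V) with hW
  set ι := orbitMap hU1 hc
  have hsol : ∀ h t, W (ι h) t =
      U t h + ∫ s in (0 : ℝ)..max t 0, U (max t 0 - s) (A (W (ι h) s)) := by
    intro h t
    have h1 : W (ι h) - V (W (ι h)) = ι h :=
      DFunLike.congr_fun (Ring.mul_inverse_cancel _ hunit) (ι h)
    rw [sub_eq_iff_eq_add] at h1
    exact DFunLike.congr_fun h1 t
  have huniq : ∀ (h : H) (w : ℝ →ᵇ H), (∀ t, w t =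
      U t h + ∫ s in (0 : ℝ)..max t 0, U (max t 0 - s) (A (w s))) → w = W (ι h) := by
    intro h w hw
    have h1 : (1 - V) w = ι h := by
      change w - V w = ι h
      rw [sub_eq_iff_eq_add]
      ext1 t
      exact hw t
    have h2 : W ((1 - V) w) = w :=
      DFunLike.congr_fun (Ring.inverse_mul_cancel _ hunit) w
    rw [← h2, h1]
  have hF : ∀ v : ℝ →ᵇ H, Continuous fun p : ℝ × ℝ => U (p.1 - p.2) (A (v p.2)) :=
    fun v => hjoint.comp ((continuous_fst.sub continuous_snd).prodMk
        (A.continuous.comp (v.continuous.comp continuous_snd)))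
  have hFi : ∀ (v : ℝ →ᵇ H) (t a b : ℝ),
      IntervalIntegrable (fun s => U (t - s) (A (v s))) volume a b := fun v t a b =>
    ((hF v).comp (Continuous.prodMk_right t)).intervalIntegrable _ _
  have hzero : ∀ h, W (ι h) 0 = h := by
    intro h
    rw [hsol, max_self, intervalIntegral.integral_same, hG.zero, add_zero]
    rfl
  refine ⟨fun t => (BoundedContinuousFunction.evalCLM ℂ t).comp (W.comp ι), ?_, ?_, ?_, ?_⟩
  · ext1 h
    exact hzero h
  · intro s t hs ht
    ext1 h
    change W (ι h) (s + t) = W (ι (W (ι h) t)) s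
    -- The orbit shifted by `t` solves the Duhamel equation with initial value `W (ι h) t`: the
    -- integral over `[0, t]` is absorbed by `U σ`, and the rest is a translation.
    set w : ℝ →ᵇ H := (W (ι h)).compContinuous ⟨fun τ => max τ 0 + t, by fun_prop⟩ with hw
    have hwa : ∀ τ, w τ = W (ι h) (max τ 0 + t) := fun τ => rfl
    have h1 : w = W (ι (W (ι h) t)) := by
      apply huniq
      intro τ
      rw [hmax τ]
      have hτ : 0 ≤ max τ 0 := le_max_right _ _
      rw [hwa τ]
      have e1 : ∀ s ∈ uIcc 0 (max τ 0), U (max τ 0 - s) (A (w s)) =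
          U (max τ 0 - s) (A (W (ι h) (s + t))) := by
        intro s hs
        rw [uIcc_of_le hτ] at hs
        rw [hwa, max_eq_left hs.1]
      rw [intervalIntegral.integral_congr e1]
      set σ := max τ 0
      rw [hsol h (σ + t), hsol h t, max_eq_left (by positivity), max_eq_left ht, map_add,
        hG.add σ t hτ ht, ← ContinuousLinearMap.intervalIntegral_comp_comm _ (hFi _ _ _ _),
        ← intervalIntegral.integral_add_adjacent_intervals (hFi _ _ 0 t) (hFi _ _ t (σ + t)),
        ContinuousLinearMap.comp_apply, add_assoc]
      congr 2
      · apply intervalIntegral.integral_congr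
        intro r hr
        rw [uIcc_of_le ht] at hr
        change U (σ + t - r) _ = U σ (U (t - r) _)
        rw [add_sub_assoc, hG.add σ (t - r) hτ (by linarith [hr.2])]
        rfl
      · have h2 := intervalIntegral.integral_comp_add_right (a := 0) (b := σ)
          (fun r => U (σ + t - r) (A (W (ι h) r))) t
        rw [zero_add] at h2
        rw [← h2]
        congr 1
        ext1 r
        rw [add_sub_add_right_eq_sub]
    rw [← h1, hwa, max_eq_left hs]
  · intro h
    have h1 := (W (ι h)).continuous.tendsto 0
    rw [hzero] at h1
    exact h1.mono_left nhdsWithin_le_nhds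
  · intro h z
    rw [hG', ← hG.gen]
    -- The integrand is close to `A h` for small times, so the Duhamel term contributes exactly `A
    -- h` to the difference quotient; the two generators differ by `A` on the same domain.
    have key : Tendsto (fun t : ℝ => ((t : ℂ)⁻¹) •
        ∫ s in (0 : ℝ)..t, U (t - s) (A (W (ι h) s))) (𝓝[>] 0) (𝓝 (A h)) := by
      rw [Metric.tendsto_nhdsWithin_nhds]
      intro ε hε
      have h1 := (hF (W (ι h))).tendsto (0, 0)
      simp only [sub_self, hG.zero, hzero, ContinuousLinearMap.id_apply] at h1
      obtain ⟨δ, hδ, hball⟩ := Metric.tendsto_nhds_nhds.1 h1 (ε / 2) (by positivity)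
      refine ⟨δ, hδ, fun {t} ht htd => ?_⟩
      have ht0 : (0 : ℝ) < t := ht
      rw [Real.dist_eq, sub_zero, abs_of_pos ht0] at htd
      have e1 : ((t : ℂ)⁻¹) • (∫ s in (0 : ℝ)..t, U (t - s) (A (W (ι h) s))) - A h =
          ((t : ℂ)⁻¹) • ∫ s in (0 : ℝ)..t, (U (t - s) (A (W (ι h) s)) - A h) := by
        rw [intervalIntegral.integral_sub (hFi _ _ _ _) (by simp), intervalIntegral.integral_const,
          smul_sub, sub_zero, ← Complex.coe_smul, smul_smul,
          inv_mul_cancel₀ (by exact_mod_cast ht0.ne'), one_smul]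
      rw [dist_eq_norm, e1, norm_smul, norm_inv, Complex.norm_real, Real.norm_of_nonneg ht0.le]
      have h2 : ‖∫ s in (0 : ℝ)..t, (U (t - s) (A (W (ι h) s)) - A h)‖ ≤ (ε / 2) * |t - 0| := by
        apply intervalIntegral.norm_integral_le_of_norm_le_const
        intro s hs
        rw [uIoc_of_le ht0.le] at hs
        have := hball (x := (t, s)) (by
          rw [Prod.dist_eq, max_lt_iff, Real.dist_eq, Real.dist_eq, sub_zero, sub_zero,
            abs_of_pos ht0, abs_of_pos hs.1]
          exact ⟨htd, hs.2.trans_lt htd⟩)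
        rw [dist_eq_norm] at this
        exact this.le
      rw [sub_zero, abs_of_pos ht0] at h2
      calc t⁻¹ * ‖∫ s in (0 : ℝ)..t, (U (t - s) (A (W (ι h) s)) - A h)‖
          ≤ t⁻¹ * (ε / 2 * t) := mul_le_mul_of_nonneg_left h2 (by positivity)
        _ = ε / 2 := by field_simp
        _ < ε := by linarith
    have e2 : ∀ᶠ t : ℝ in 𝓝[>] 0, ((t : ℂ)⁻¹) • (W (ι h) t - h) =
        ((t : ℂ)⁻¹) • (U t h - h) +
        ((t : ℂ)⁻¹) • ∫ s in (0 : ℝ)..t, U (t - s) (A (W (ι h) s)) := by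
      filter_upwards [self_mem_nhdsWithin] with t ht
      have ht0 : (0 : ℝ) < t := ht
      rw [hsol h t, max_eq_left ht0.le]
      module
    change Tendsto (fun t : ℝ => ((t : ℂ)⁻¹) • (W (ι h) t - h)) (𝓝[>] 0) (𝓝 z) ↔ _
    rw [tendsto_congr' e2]
    constructor
    · intro h3
      have := h3.sub key
      simpa using this
    · intro h3
      have := h3.add key
      simpa using this

end Perturbation

/-! ### Semigroups of Fourier multipliers -/

section MultiplierSemigroup

variable {n : ℕ}

/-- The semigroup of Fourier multipliers generated by the symbol `m`. -/
def symSemigroup (n : ℕ) (m : ℤ → ℂ) (t : ℝ) : L2per n →L[ℂ] L2per n :=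
  multiplier n fun j => Complex.exp (m j * (max t 0 : ℝ))

variable {m : ℤ → ℂ} {lam : ℝ}

lemma norm_symSemigroup_symbol (hm : ∀ j, (m j).re ≤ -lam) (t : ℝ) (j : ℤ) :
    ‖Complex.exp (m j * (max t 0 : ℝ))‖ ≤ Real.exp (-lam * max t 0) := by
  rw [Complex.norm_exp, Real.exp_le_exp, Complex.re_mul_ofReal]
  exact mul_le_mul_of_nonneg_right (hm j) (le_max_right _ _)

lemma norm_symSemigroup_le (hm : ∀ j, (m j).re ≤ -lam) (t : ℝ) :
    ‖symSemigroup n m t‖ ≤ Real.exp (-lam * max t 0) :=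
  norm_multiplier_le (norm_symSemigroup_symbol hm t)

lemma coeffCLM_symSemigroup (hm : ∀ j, (m j).re ≤ -lam) (t : ℝ) (h : L2per n) (j : ℤ) :
    coeffCLM n j (symSemigroup n m t h) =
      Complex.exp (m j * (max t 0 : ℝ)) • coeffCLM n j h :=
  coeffCLM_multiplier (norm_symSemigroup_symbol hm t) h j

/-- Orbits of exponentials are explicit. Since the operators are contractions, orbits of
trigonometric polynomials converge uniformly in `t` to the orbit of their limit. -/
lemma continuous_symSemigroup (hlam : 0 ≤ lam) (hm : ∀ j, (m j).re ≤ -lam) (h : L2per n) :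
    Continuous fun t => symSemigroup n m t h := by
  have hU1 : ∀ t, ‖symSemigroup n m t‖ ≤ 1 := fun t => (norm_symSemigroup_le hm t).trans (by
    rw [Real.exp_le_one_iff]
    nlinarith [le_max_right t 0])
  let M : Submodule ℂ (L2per n) :=
    { carrier := {h | Continuous fun t => symSemigroup n m t h}
      add_mem' := fun {a b} ha hb => by
        simp only [Set.mem_ofPred_eq, map_add]
        exact Continuous.add ha hb
      zero_mem' := by simp only [Set.mem_ofPred_eq, map_zero]; exact continuous_const
      smul_mem' := fun a x hx => by
        simp only [Set.mem_ofPred_eq, map_smul]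
        exact Continuous.const_smul hx a }
  have hM : Submodule.span ℂ {w : L2per n | ∃ j v, w = expVec n j v} ≤ M := by
    rw [Submodule.span_le]
    rintro _ ⟨j, v, rfl⟩
    change Continuous fun t => symSemigroup n m t (expVec n j v)
    have : (fun t => symSemigroup n m t (expVec n j v)) =
        fun t => Complex.exp (m j * (max t 0 : ℝ)) • expVec n j v := by
      ext1 t
      exact multiplier_expVec (norm_symSemigroup_symbol hm t) j v
    rw [this]
    fun_prop
  refine continuous_of_uniform_approx_of_continuous fun s hs => ?_
  obtain ⟨ε, hε, hs⟩ := Metric.mem_uniformity_dist.1 hs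
  obtain ⟨k, hk, hd⟩ := Metric.mem_closure_iff.1 (dense_span_expVec h) ε hε
  refine ⟨fun t => symSemigroup n m t k, hM hk, fun t => hs ?_⟩
  rw [dist_eq_norm, ← map_sub]
  refine ((symSemigroup n m t).le_of_opNorm_le (hU1 t) _).trans_lt ?_
  rwa [one_mul, ← dist_eq_norm]

/-- A limit of difference quotients is identified coefficient by coefficient. Conversely, if `z` has
coefficients `m j • ĥ(j)`, then `T(t)h - h = ∫₀ᵗ T(s)z ds`, and strong continuity gives the limit in
norm. -/
lemma isSemigroupWithGraph_symSemigroup (hlam : 0 ≤ lam) (hm : ∀ j, (m j).re ≤ -lam) :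
    IsSemigroupWithGraph {p : L2per n × L2per n | ∀ j, coeffCLM n j p.2 = m j • coeffCLM n j p.1}
      (symSemigroup n m) where
  zero := by
    ext1 h
    apply L2per_ext'
    intro j
    rw [coeffCLM_symSemigroup hm]
    simp
  add s t hs ht := by
    ext1 h
    apply L2per_ext'
    intro j
    rw [ContinuousLinearMap.comp_apply, coeffCLM_symSemigroup hm, coeffCLM_symSemigroup hm,
      coeffCLM_symSemigroup hm, smul_smul, ← Complex.exp_add, max_eq_left hs, max_eq_left ht,
      max_eq_left (add_nonneg hs ht)]
    congr 2
    push_cast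
    ring
  cont h := by
    have h1 := (continuous_symSemigroup hlam hm h).tendsto 0
    have h2 : symSemigroup n m 0 h = h := by
      apply L2per_ext'
      intro j
      rw [coeffCLM_symSemigroup hm]
      simp
    rw [h2] at h1
    exact h1.mono_left nhdsWithin_le_nhds
  gen h z := by
    constructor
    · intro hz j
      have h1 := ((coeffCLM n j).continuous.tendsto z).comp hz
      have h2 : Tendsto (fun t : ℝ => ((t : ℂ)⁻¹ * (Complex.exp (m j * t) - 1)) • coeffCLM n j h)
          (𝓝[>] 0) (𝓝 (m j • coeffCLM n j h)) := by
        have hd : HasDerivAt (fun t : ℝ => Complex.exp (m j * t)) (m j) 0 := by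
          have := (((hasDerivAt_id (0 : ℝ)).ofReal_comp).const_mul (m j)).cexp
          simpa using this
        have := hd.tendsto_slope_zero_right
        refine Tendsto.smul_const ?_ _
        simpa using this
      refine tendsto_nhds_unique (h1.congr' ?_) h2
      filter_upwards [self_mem_nhdsWithin] with t ht
      have ht0 : (0 : ℝ) < t := ht
      rw [Function.comp_apply, map_smul, map_sub, coeffCLM_symSemigroup hm, max_eq_left ht0.le]
      module
    · intro hz
      have hcz := continuous_symSemigroup hlam hm z
      have hd : HasDerivAt (fun t => ∫ s in (0 : ℝ)..t, symSemigroup n m s z)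
          (symSemigroup n m 0 z) 0 := (hcz.integral_hasStrictDerivAt 0 0).hasDerivAt
      have h0 : symSemigroup n m 0 z = z := by
        apply L2per_ext'
        intro j
        rw [coeffCLM_symSemigroup hm]
        simp
      rw [h0] at hd
      have h1 := hd.tendsto_slope_zero_right
      refine h1.congr' ?_
      filter_upwards [self_mem_nhdsWithin] with t ht
      have ht0 : (0 : ℝ) < t := ht
      have hs : ∀ x : L2per n, (t⁻¹ : ℝ) • x = ((t : ℂ)⁻¹) • x := fun x => by
        rw [← Complex.ofReal_inv]
        exact (Complex.coe_smul _ _).symm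
      rw [zero_add, intervalIntegral.integral_same, sub_zero, hs]
      congr 1
      apply L2per_ext'
      intro j
      rw [← ContinuousLinearMap.intervalIntegral_comp_comm _ (hcz.intervalIntegrable _ _),
        map_sub, coeffCLM_symSemigroup hm, max_eq_left ht0.le]
      have h2 : ∀ s ∈ uIcc 0 t, HasDerivAt (fun s : ℝ => Complex.exp (m j * s) • coeffCLM n j h)
          (coeffCLM n j (symSemigroup n m s z)) s := by
        intro s hs
        rw [uIcc_of_le ht0.le] at hs
        rw [coeffCLM_symSemigroup hm, hz j, max_eq_left hs.1, smul_smul]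
        have := (((hasDerivAt_id s).ofReal_comp).const_mul (m j)).cexp.smul_const (coeffCLM n j h)
        simpa using this
      rw [intervalIntegral.integral_eq_sub_of_hasDerivAt h2
        (((coeffCLM n j).continuous.comp hcz).intervalIntegrable _ _)]
      simp

end MultiplierSemigroup

/-- The decay rate `lam` exceeds the norm of the perturbation, so the Neumann series converges;
`rescale` afterwards undoes the shift by `lam`. -/
lemma exists_isSemigroupOf_of_perturbation {H : Type*} [NormedAddCommGroup H] [NormedSpace ℂ H]
    [CompleteSpace H] {L : H →ₗ.[ℂ] H} {A : H →L[ℂ] H} {G : Set (H × H)} {U : ℝ → H →L[ℂ] H}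
    {lam : ℝ} (hA : ‖A‖ < lam) (hG : IsSemigroupWithGraph G U)
    (hU : ∀ t, ‖U t‖ ≤ Real.exp (-lam * max t 0)) (hc : ∀ h, Continuous fun t => U t h)
    (hmax : ∀ t, U t = U (max t 0))
    (hL : ∀ h z, (h, z) ∈ L.graph ↔ (h, z - (lam : ℂ) • h - A h) ∈ G) :
    ∃ T, IsSemigroupOf L T := by
  obtain ⟨T, hT⟩ := exists_perturbed_semigroup (A := A)
    (G' := {p : H × H | (p.1, p.2 - A p.1) ∈ G}) hA hG hU hc hmax (fun h z => Iff.rfl)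
  have h2 := hT.rescale (G' := (L.graph : Set (H × H))) lam (fun h z => hL h z)
  exact ⟨_, h2.zero, h2.add, h2.cont, h2.gen⟩

/-! ### The Bloch operators generate semigroups -/

section BlochSemigroup

variable {n : ℕ} (c : ℝ) (A : C(UnitAddCircle, Cn n →L[ℂ] Cn n)) (ξ : ℝ)

/-- The symbol of the constant-coefficient part of the Bloch operator. -/
def blochSym (j : ℤ) : ℂ :=
  (2 * Real.pi * Complex.I * j + Complex.I * ξ) ^ 2 +
    c * (2 * Real.pi * Complex.I * j + Complex.I * ξ)

lemma blochSym_re (j : ℤ) : (blochSym c ξ j).re = -(2 * Real.pi * j + ξ) ^ 2 := by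
  have e : blochSym c ξ j = ((-(2 * Real.pi * j + ξ) ^ 2 : ℝ) : ℂ) +
      ((c * (2 * Real.pi * j + ξ) : ℝ) : ℂ) * Complex.I := by
    rw [blochSym]
    push_cast
    linear_combination (2 * Real.pi * j + ξ : ℂ) ^ 2 * Complex.I_sq
  rw [e, Complex.add_re, Complex.ofReal_re, Complex.re_ofReal_mul, Complex.I_re, mul_zero,
    add_zero]

lemma coeffCLM_pencil (g : L2per n) (j : ℤ) :
    coeffCLM n j (pencil c A ξ 0 g - mulOp A (opJ n g)) =
      (blochSym c ξ j * jSym j) • coeffCLM n j g := by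
  have e : pencil c A ξ 0 g - mulOp A (opJ n g) = (opJ n g - g) +
      (2 * Complex.I * ξ + c) • opDJ n g +
      ((Complex.I * ξ) ^ 2 + c * (Complex.I * ξ) - 0) • opJ n g := by
    rw [pencil_apply]; abel
  have e2 : blochSym c ξ j * jSym j = (jSym j - 1) + (2 * Complex.I * ξ + c) * djSym j +
      ((Complex.I * ξ) ^ 2 + c * (Complex.I * ξ) - 0) * jSym j := by
    rw [← sq_symbol_mul_jSym, blochSym, djSym]
    ring
  rw [e, e2, map_add, map_add, map_sub, map_smul, map_smul, coeffCLM_opJ, coeffCLM_opDJ]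
  module

/-- Exhibits the Bloch operator as a diagonal operator with maximal domain plus the bounded `mulOp
A`, the form required by the perturbation theorem. The content is that the diagonal relation alone
already forces `h` into `H²_per`. -/
lemma mem_blochGraph_iff_coeff (h z : L2per n) : (h, z) ∈ (blochOp c A ξ).graph ↔
    ∀ j, coeffCLM n j (z - mulOp A h) = blochSym c ξ j • coeffCLM n j h := by
  rw [mem_blochGraph_iff]
  constructor
  · rintro ⟨g, rfl, rfl⟩ j
    rw [coeffCLM_pencil, coeffCLM_opJ, smul_smul]
  · intro hz
    -- The coefficients of `h - (z - mulOp A h)` are `(1 - blochSym) ĥ`, so this symbol recovers a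
    -- preimage of `h` under `opJ`. It is bounded because `1 - blochSym` has real part `1 +
    -- (2πj+ξ)²`, comparable to `1 + (2πj)²`.
    set ρ : ℤ → ℂ := fun j => (jSym j * (1 - blochSym c ξ j))⁻¹ with hρ
    have hre : ∀ j, (1 - blochSym c ξ j).re = 1 + (2 * Real.pi * j + ξ) ^ 2 := fun j => by
      rw [Complex.sub_re, blochSym_re, Complex.one_re]; ring
    have hne : ∀ j, 1 - blochSym c ξ j ≠ 0 := fun j h0 => by
      have := hre j
      rw [h0, Complex.zero_re] at this
      nlinarith [sq_nonneg (2 * Real.pi * j + ξ)]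
    have hinv : ∀ j (x : Cn n), jSym j • (jSym j * (1 - blochSym c ξ j))⁻¹ •
        (x - blochSym c ξ j • x) = x := fun j x => by
      have e : x - blochSym c ξ j • x = (1 - blochSym c ξ j) • x := by module
      have h1 := hne j
      have h2 := jSym_ne_zero j
      rw [e, smul_smul, smul_smul]
      have e2 : jSym j * (jSym j * (1 - blochSym c ξ j))⁻¹ * (1 - blochSym c ξ j) = 1 := by
        field_simp
      rw [e2, one_smul]
    have hb : ∀ j, ‖ρ j‖ ≤ 2 + 2 * ξ ^ 2 := by
      intro j
      rw [hρ]
      simp only [norm_inv, norm_mul, norm_jSym]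
      rw [mul_inv, inv_inv, ← div_eq_mul_inv]
      have h1 : 1 + (2 * Real.pi * j + ξ) ^ 2 ≤ ‖1 - blochSym c ξ j‖ := by
        rw [← hre]; exact Complex.re_le_norm _
      rw [div_le_iff₀ (lt_of_lt_of_le (by positivity) h1)]
      refine le_trans ?_ (mul_le_mul_of_nonneg_left h1 (by positivity))
      nlinarith [sq_nonneg (2 * Real.pi * j + 2 * ξ), sq_nonneg ξ,
        mul_nonneg (sq_nonneg ξ) (sq_nonneg (2 * Real.pi * j + ξ))]
    refine ⟨multiplier n ρ (h - (z - mulOp A h)), ?_, ?_⟩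
    · apply L2per_ext'
      intro j
      rw [coeffCLM_opJ, coeffCLM_multiplier hb, map_sub, hz, hρ]
      exact (hinv j _).symm
    · have hJ : opJ n (multiplier n ρ (h - (z - mulOp A h))) = h := by
        apply L2per_ext'
        intro j
        rw [coeffCLM_opJ, coeffCLM_multiplier hb, map_sub, hz, hρ]
        exact hinv j _
      rw [← sub_left_inj (a := mulOp A h)]
      apply L2per_ext'
      intro j
      have h1 := coeffCLM_pencil c A ξ (multiplier n ρ (h - (z - mulOp A h))) j
      rw [hJ, mul_smul, ← coeffCLM_opJ, hJ] at h1
      rw [hz, h1]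

/-- The diagonal symbol has nonpositive real part; shifting it by some `lam > ‖mulOp A‖` gives decay
strong enough to absorb the multiplication operator. -/
theorem exists_isSemigroupOf_blochOp : ∃ T, IsSemigroupOf (blochOp c A ξ) T := by
  obtain ⟨lam, hlam⟩ : ∃ lam : ℝ, ‖mulOp A‖ < lam := exists_gt _
  have hl0 : 0 ≤ lam := (norm_nonneg _).trans hlam.le
  have hm : ∀ j, (blochSym c ξ j - lam).re ≤ -lam := fun j => by
    rw [Complex.sub_re, blochSym_re, Complex.ofReal_re]
    nlinarith [sq_nonneg (2 * Real.pi * j + ξ)]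
  refine exists_isSemigroupOf_of_perturbation hlam
    (isSemigroupWithGraph_symSemigroup (n := n) hl0 hm) (norm_symSemigroup_le hm)
    (continuous_symSemigroup hl0 hm) (fun t => ?_) (fun h z => ?_)
  · unfold symSemigroup
    rw [max_eq_left (le_max_right t 0)]
  · rw [mem_blochGraph_iff_coeff]
    refine forall_congr' fun j => ?_
    have e : z - (lam : ℂ) • h - mulOp A h = (z - mulOp A h) - (lam : ℂ) • h := by abel
    change _ ↔ coeffCLM n j (z - (lam : ℂ) • h - mulOp A h) = (blochSym c ξ j - lam) • coeffCLM n j h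
    rw [e, map_sub _ (z - mulOp A h), map_smul, sub_smul, sub_left_inj]

end BlochSemigroup

/-! ### Local bounds, continuity and left eigenfunctionals of semigroups -/

section SemigroupProperties

variable {H : Type*} [NormedAddCommGroup H] [NormedSpace ℂ H] [CompleteSpace H]
  {L : H →ₗ.[ℂ] H} {T : ℝ → H →L[ℂ] H}

/-- Otherwise there are times `t k → 0⁺` with unbounded `‖T (t k)‖`, although every orbit `T (t k)
h` converges, against Banach–Steinhaus. -/
lemma IsSemigroupOf.exists_bound (hT : IsSemigroupOf L T) :
    ∃ η > 0, ∃ M, ∀ t ∈ Icc 0 η, ‖T t‖ ≤ M := by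
  by_contra hcon
  push Not at hcon
  have h1 : ∀ k : ℕ, ∃ t ∈ Icc (0 : ℝ) (1 / ((k : ℝ) + 1)), (k : ℝ) + 1 < ‖T t‖ := fun k =>
    hcon _ (by positivity) _
  choose t ht hk using h1
  have hpos : ∀ k, 0 < t k := by
    intro k
    rcases (ht k).1.eq_or_lt with h | h
    · have h2 := hk k
      rw [← h, hT.zero] at h2
      have h3 : ‖ContinuousLinearMap.id ℂ H‖ ≤ 1 := ContinuousLinearMap.norm_id_le
      have : (0 : ℝ) ≤ k := Nat.cast_nonneg k
      linarith
    · exact h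
  have htend : Tendsto t atTop (𝓝[>] 0) := by
    refine tendsto_nhdsWithin_iff.2 ⟨?_, Eventually.of_forall hpos⟩
    exact squeeze_zero (fun k => (hpos k).le) (fun k => (ht k).2) tendsto_one_div_add_atTop_nhds_zero_nat
  obtain ⟨C, hC⟩ := banach_steinhaus (g := fun k => T (t k)) (fun x => by
    have h2 := ((hT.cont x).comp htend).norm.bddAbove_range
    obtain ⟨C, hC⟩ := h2
    exact ⟨C, fun k => hC ⟨k, rfl⟩⟩)
  obtain ⟨k, hk2⟩ := exists_nat_gt C
  have := hC k
  have := hk k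
  linarith

lemma IsSemigroupOf.exists_bound_Icc (hT : IsSemigroupOf L T) (b : ℝ) :
    ∃ M, ∀ t ∈ Icc 0 b, ‖T t‖ ≤ M := by
  obtain ⟨η, hη, M, hM⟩ := hT.exists_bound
  have h1 : ∀ k : ℕ, ∃ M', ∀ t ∈ Icc 0 (k * η), ‖T t‖ ≤ M' := by
    intro k
    induction k with
    | zero =>
      refine ⟨‖T 0‖, fun t ht => ?_⟩
      simp only [Nat.cast_zero, zero_mul, Icc_self, mem_singleton_iff] at ht
      rw [ht]
    | succ k ih =>
      obtain ⟨M', hM'⟩ := ih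
      refine ⟨max M' (M * M'), fun t ht => ?_⟩
      rcases le_or_gt t (k * η) with h | h
      · exact (hM' t ⟨ht.1, h⟩).trans (le_max_left _ _)
      · have hk : (0 : ℝ) ≤ k * η := by positivity
        have e : t = (t - k * η) + k * η := by ring
        have h2 : t - k * η ≤ η := by
          have := ht.2
          push_cast at this
          linarith
        rw [e, hT.add _ _ (by linarith) hk]
        refine (ContinuousLinearMap.opNorm_comp_le _ _).trans (le_trans ?_ (le_max_right _ _))
        exact mul_le_mul (hM _ ⟨by linarith, h2⟩) (hM' _ ⟨hk, le_refl _⟩) (norm_nonneg _)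
          ((norm_nonneg _).trans (hM 0 ⟨le_refl _, hη.le⟩))
  obtain ⟨k, hk⟩ := exists_nat_ge (b / η)
  obtain ⟨M', hM'⟩ := h1 k
  refine ⟨M', fun t ht => hM' t ⟨ht.1, ht.2.trans ?_⟩⟩
  rwa [div_le_iff₀ hη] at hk

lemma IsSemigroupOf.continuousOn (hT : IsSemigroupOf L T) (h : H) (b : ℝ) :
    ContinuousOn (fun t => T t h) (Icc 0 b) := by
  obtain ⟨M, hM⟩ := hT.exists_bound_Icc b
  intro t ht
  have hM0 : 0 ≤ M := (norm_nonneg _).trans (hM t ht)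
  have hz : ∀ ε > 0, ∃ δ > 0, ∀ s, 0 ≤ s → s < δ → ‖T s h - h‖ < ε := by
    intro ε hε
    obtain ⟨δ, hδ, h1⟩ := Metric.tendsto_nhdsWithin_nhds.1 (hT.cont h) ε hε
    refine ⟨δ, hδ, fun s hs hsδ => ?_⟩
    rcases hs.eq_or_lt with h2 | h2
    · rw [← h2, hT.zero]
      simpa using hε
    · have := h1 (x := s) h2 (by rwa [Real.dist_eq, sub_zero, abs_of_pos h2])
      rwa [dist_eq_norm] at this
  rw [ContinuousWithinAt, Metric.tendsto_nhdsWithin_nhds]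
  intro ε hε
  obtain ⟨δ, hδ, h1⟩ := hz (ε / (M + 1)) (by positivity)
  have key : ∀ r s, r ∈ Icc 0 b → s ∈ Icc 0 b → r ≤ s → s - r < δ → ‖T s h - T r h‖ < ε := by
    intro r s hr hs hrs hd
    have e : T s h - T r h = T r (T (s - r) h - h) := by
      have h2 := hT.add r (s - r) hr.1 (by linarith)
      rw [add_sub_cancel] at h2
      rw [h2, map_sub]
      rfl
    rw [e]
    refine ((T r).le_of_opNorm_le (hM r hr) _).trans_lt ?_
    have h3 := h1 (s - r) (by linarith) hd
    calc M * ‖T (s - r) h - h‖ ≤ (M + 1) * ‖T (s - r) h - h‖ := by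
          nlinarith [norm_nonneg (T (s - r) h - h)]
      _ < (M + 1) * (ε / (M + 1)) := by
          apply mul_lt_mul_of_pos_left h3; positivity
      _ = ε := by field_simp
  refine ⟨δ, hδ, fun {s} hs hd => ?_⟩
  rw [Real.dist_eq] at hd
  rw [dist_eq_norm]
  rcases le_total s t with h2 | h2
  · rw [norm_sub_rev]
    refine key s t hs ht h2 ?_
    rwa [abs_sub_comm, abs_of_nonneg (by linarith)] at hd
  · refine key t s ht hs h2 ?_
    rwa [abs_of_nonneg (by linarith)] at hd

/-- A left eigenfunctional of the generator is a left eigenfunctional of the semigroup. -/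
lemma IsSemigroupOf.left_eigenfunctional (hT : IsSemigroupOf L T) (hdense : Dense (L.domain : Set H))
    {ψ : H →L[ℂ] ℂ} {μ : ℂ} (hψ : ∀ w z, (w, z) ∈ L.graph → ψ z = μ * ψ w) {t : ℝ} (ht : 0 ≤ t)
    (h : H) : ψ (T t h) = Complex.exp (μ * t) * ψ h := by
  have key : ∀ w ∈ (L.domain : Set H), ψ (T t w) = Complex.exp (μ * t) * ψ w := by
    intro w hw
    obtain ⟨z, hz⟩ : ∃ z, (w, z) ∈ L.graph := ⟨_, (graph_map_iff L w _).2 ⟨hw, rfl⟩⟩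
    -- For `w` in the domain this function has right derivative zero and is therefore constant. Only
    -- right derivatives are available from the definition of the generator. Density of the domain
    -- extends the result to all `h`.
    set F : ℝ → ℂ := fun s => Complex.exp (-μ * s) * ψ (T s w) with hF
    have hc : ContinuousOn F (Icc 0 t) := by
      refine ContinuousOn.mul (by fun_prop) ?_
      exact ψ.continuous.comp_continuousOn (hT.continuousOn w t)
    have hd : ∀ s ∈ Ico 0 t, HasDerivWithinAt F 0 (Ici s) s := by
      intro s hs
      have h1 : Tendsto (fun r : ℝ => ((r : ℂ)⁻¹) • (T r (T s w) - T s w)) (𝓝[>] 0)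
          (𝓝 (T s z)) := by
        have h2 := ((T s).continuous.tendsto z).comp ((hT.gen w z).2 hz)
        refine h2.congr' ?_
        filter_upwards [self_mem_nhdsWithin] with r hr
        have hr0 : (0 : ℝ) < r := hr
        rw [Function.comp_apply, map_smul, map_sub]
        have h3 := hT.add s r hs.1 hr0.le
        have h4 := hT.add r s hr0.le hs.1
        rw [add_comm] at h4
        have h5 : T s (T r w) = T r (T s w) := DFunLike.congr_fun (h3.symm.trans h4) w
        rw [h5]
      have h2 := hψ _ _ ((hT.gen (T s w) (T s z)).1 h1)
      have h3 : HasDerivWithinAt (fun s => ψ (T s w)) (ψ (T s z)) (Ici s) s := by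
        rw [← hasDerivWithinAt_Ioi_iff_Ici, hasDerivWithinAt_iff_tendsto_slope' (by simp)]
        have h4 := ((ψ.continuous.tendsto _).comp h1)
        have h5 : Tendsto (fun x : ℝ => x - s) (𝓝[>] s) (𝓝[>] 0) := by
          refine tendsto_nhdsWithin_iff.2 ⟨?_, ?_⟩
          · have : Tendsto (fun x : ℝ => x - s) (𝓝 s) (𝓝 (s - s)) :=
              (continuous_id.sub continuous_const).tendsto s
            rw [sub_self] at this
            exact this.mono_left nhdsWithin_le_nhds
          · filter_upwards [self_mem_nhdsWithin] with x hx
            have hx' : s < x := hx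
            exact sub_pos.2 hx'
        refine (h4.comp h5).congr' ?_
        filter_upwards [self_mem_nhdsWithin] with x hx
        have hx0 : s < x := hx
        have h6 := hT.add (x - s) s (by linarith) hs.1
        rw [sub_add_cancel] at h6
        rw [slope_def_module, h6]
        simp only [Function.comp_apply, map_smul, map_sub, ContinuousLinearMap.comp_apply]
        rw [← Complex.coe_smul]
        push_cast
        rfl
      have h4 : HasDerivWithinAt (fun s : ℝ => Complex.exp (-μ * s))
          (Complex.exp (-μ * s) * -μ) (Ici s) s := by
        have := (((hasDerivAt_id s).ofReal_comp).const_mul (-μ)).cexp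
        simpa using this.hasDerivWithinAt
      have h5 := h4.mul h3
      rw [h2] at h5
      have e : Complex.exp (-μ * s) * -μ * ψ (T s w) +
          Complex.exp (-μ * s) * (μ * ψ (T s w)) = 0 := by ring
      rw [e] at h5
      exact h5
    have h1 := constant_of_has_deriv_right_zero hc hd t ⟨ht, le_refl _⟩
    simp only [hF, Complex.ofReal_zero, mul_zero, Complex.exp_zero, one_mul, hT.zero,
      ContinuousLinearMap.id_apply] at h1
    rw [← h1, ← mul_assoc, ← Complex.exp_add]
    simp
  have h1 : Continuous fun h => ψ (T t h) := ψ.continuous.comp (T t).continuous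
  have h2 : Continuous fun h => Complex.exp (μ * t) * ψ h := continuous_const.mul ψ.continuous
  exact congrFun (Continuous.ext_on hdense h1 h2 key) h

end SemigroupProperties

lemma expSemigroup_spec {H : Type*} [NormedAddCommGroup H] [NormedSpace ℂ H] {L : H →ₗ.[ℂ] H}
    (h : ∃ T, IsSemigroupOf L T) : IsSemigroupOf L (expSemigroup L) := by
  rw [expSemigroup, dif_pos h]
  exact h.choose_spec

/-! ### Rank-one eigenprojections -/

section Eigenprojection

variable {H : Type*} [NormedAddCommGroup H] [NormedSpace ℂ H] {L : H →ₗ.[ℂ] H} {μ : ℂ}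

lemma mem_domain_of_mem_graph {w z : H} (h : (w, z) ∈ L.graph) : w ∈ L.domain :=
  ((graph_map_iff L w z).1 h).1

lemma apply_eq_of_mem_graph {w z : H} (h : (w, z) ∈ L.graph) (hd : w ∈ L.domain) :
    L ⟨w, hd⟩ = z :=
  ((graph_map_iff L w z).1 h).2

/-- If `μ` is an eigenvalue with right eigenvector `w` and left eigenfunctional `ψ`, `ψ w = 1`, with
one-dimensional kernel and range `ker ψ`, then the eigenprojection is `ψ ⊗ w`. -/
theorem eigenprojection_eq_smulRight {w : H} {ψ : H →L[ℂ] ℂ} (hw : (w, μ • w) ∈ L.graph)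
    (hψw : ψ w = 1) (hψ : ∀ v z, (v, z) ∈ L.graph → ψ z = μ * ψ v)
    (hker : ∀ v, (v, μ • v) ∈ L.graph → ∃ a : ℂ, v = a • w)
    (hran : ∀ h, ψ h = 0 → ∃ v, (v, μ • v - h) ∈ L.graph) :
    eigenprojection L μ = ψ.smulRight w := by
  have hsmul : ∀ a : ℂ, (a • w, μ • a • w) ∈ L.graph := fun a => by
    rw [smul_comm]; exact L.graph.smul_mem a hw
  -- There are no Jordan chains: if `(L - μ)h = a w`, applying `ψ` gives `0 = a ψ(w) = a`.
  have hgen : ∀ m h, h ∈ genKernel L μ m → ∃ a : ℂ, h = a • w := by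
    intro m
    induction m with
    | zero => exact fun h hh => ⟨0, by rw [zero_smul]; exact hh⟩
    | succ m ih =>
      intro h hh
      obtain ⟨z, hz, hm⟩ := mem_genKernel_succ.1 hh
      obtain ⟨a, ha⟩ := ih _ hm
      have h1 := congrArg ψ ha
      rw [map_sub, map_smul, map_smul, hψ _ _ hz, hψw, smul_eq_mul, smul_eq_mul, mul_one,
        sub_self] at h1
      rw [← h1, zero_smul, sub_eq_zero] at ha
      rw [ha] at hz
      exact hker h hz
  have hspan : ∀ h, ψ.smulRight w h = h ↔ h ∈ genEigenspace L μ := by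
    intro h
    rw [ContinuousLinearMap.smulRight_apply]
    constructor
    · intro hh
      rw [← hh]
      exact ⟨1, mem_genKernel_one (hsmul _)⟩
    · rintro ⟨m, hm⟩
      obtain ⟨a, rfl⟩ := hgen m h hm
      rw [map_smul, hψw, smul_eq_mul, mul_one]
  have hP : IsEigenprojection L μ (ψ.smulRight w) := by
    refine ⟨fun h => ?_, fun v => ?_, hspan, fun h hh => ?_⟩
    · simp [hψw]
    · have h1 := hsmul (ψ v)
      refine ⟨mem_domain_of_mem_graph h1, ?_⟩
      have h2 := apply_eq_of_mem_graph h1 (mem_domain_of_mem_graph h1)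
      refine h2.trans ?_
      rw [ContinuousLinearMap.smulRight_apply, hψ _ _ (L.mem_graph v), smul_smul]
    · have hw0 : w ≠ 0 := by
        rintro rfl
        simp at hψw
      have hz : ∀ h, ψ.smulRight w h = 0 ↔ ψ h = 0 := fun h => by
        rw [ContinuousLinearMap.smulRight_apply, smul_eq_zero, or_iff_left hw0]
      rw [hz] at hh
      obtain ⟨v, hv⟩ := hran h hh
      -- Removing the component `ψ(v) w` moves the solution into the kernel of the projection
      -- without changing the right-hand side.
      have h1 := L.graph.sub_mem hv (hsmul (ψ v))
      have e : (v, μ • v - h) - (ψ v • w, μ • ψ v • w) =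
          (v - ψ v • w, μ • (v - ψ v • w) - h) := by
        rw [Prod.mk_sub_mk]
        congr 1
        module
      rw [e] at h1
      refine ⟨⟨_, mem_domain_of_mem_graph h1⟩, ⟨?_, ?_⟩, ?_⟩
      · rw [hz, map_sub, map_smul, hψw, smul_eq_mul, mul_one, sub_self]
      · rw [apply_eq_of_mem_graph h1]
        simp
      · rintro ⟨v', hd⟩ ⟨h2, h3⟩
        rw [hz] at h2
        have h4 : (v', μ • v' - h) ∈ L.graph := by
          rw [graph_map_iff]
          refine ⟨hd, ?_⟩
          rw [← h3]
          simp
        have h5 := L.graph.sub_mem h4 h1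
        have e2 : (v', μ • v' - h) - (v - ψ v • w, μ • (v - ψ v • w) - h) =
            (v' - (v - ψ v • w), μ • (v' - (v - ψ v • w))) := by
          rw [Prod.mk_sub_mk]
          congr 1
          module
        rw [e2] at h5
        obtain ⟨a, ha⟩ := hker _ h5
        have h6 := congrArg ψ ha
        simp only [map_sub, map_smul, h2, hψw, smul_eq_mul, mul_one, sub_self] at h6
        rw [← h6, zero_smul, sub_eq_zero] at ha
        exact Subtype.ext ha
  have hex : ∃ P, IsEigenprojection L μ P := ⟨_, hP⟩
  rw [eigenprojection, dif_pos hex]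
  have hQ := hex.choose_spec
  set P := hex.choose
  -- Uniqueness of the chosen projection: its kernel lies in the range of `μ - L`, on which `ψ`
  -- vanishes, and its range is the span of `w`. Together these force `P h = ψ(h) w`.
  have hkerP : ∀ h, P h = 0 → ψ h = 0 := by
    intro h hh
    obtain ⟨v, ⟨-, hv⟩, -⟩ := hQ.compl h hh
    rw [← hv, map_sub, map_smul, hψ _ _ (L.mem_graph v), smul_eq_mul, sub_self]
  ext1 h
  have h1 := hkerP (h - P h) (by rw [map_sub, hQ.idem, sub_self])
  rw [map_sub, sub_eq_zero] at h1
  have h2 := (hspan (P h)).2 ((hQ.range _).1 (hQ.idem h))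
  rw [← h2, ContinuousLinearMap.smulRight_apply, ContinuousLinearMap.smulRight_apply, h1]

end Eigenprojection

/-! ### Eigenprojections of the Bloch operators -/

section BlochEigenprojection

variable {n : ℕ} {c : ℝ} {A : C(UnitAddCircle, Cn n →L[ℂ] Cn n)} {ξ : ℝ} {μ : ℂ}

lemma mem_blochGraph_iff_pencil (v h : L2per n) : (v, μ • v + h) ∈ (blochOp c A ξ).graph ↔
    ∃ k, v = opJ n k ∧ h = pencil c A ξ μ k := by
  rw [mem_blochGraph_iff]
  refine exists_congr fun k => and_congr_right fun hv => ?_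
  rw [pencil_eq_sub c A ξ μ, hv, eq_sub_iff_add_eq, add_comm]

lemma dense_domain_blochOp : Dense ((blochOp c A ξ).domain : Set (L2per n)) := by
  refine dense_range_opJ.mono ?_
  rintro _ ⟨h, rfl⟩
  exact mem_domain_of_mem_graph ((mem_blochGraph_iff c A ξ _ _).2 ⟨h, rfl, rfl⟩)

/-- Invertibility of one bordered operator supplies both hypotheses of
`eigenprojection_eq_smulRight`: the kernel is spanned by `w`, and every `h` with `ψ(h) = 0` is in
the range. -/
theorem eigenprojection_blochOp {ℓ : L2per n →L[ℂ] ℂ} {g : L2per n}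
    (hT : IsUnit (bordered (pencil c A ξ μ) ℓ g)) {w : L2per n} {ψ : L2per n →L[ℂ] ℂ}
    (hw : (w, μ • w) ∈ (blochOp c A ξ).graph) (hψw : ψ w = 1)
    (hψ : ∀ v z, (v, z) ∈ (blochOp c A ξ).graph → ψ z = μ * ψ v) :
    eigenprojection (blochOp c A ξ) μ = ψ.smulRight w := by
  have hw' : (w, μ • w + 0) ∈ (blochOp c A ξ).graph := by rwa [add_zero]
  obtain ⟨k, hk, hk0⟩ := (mem_blochGraph_iff_pencil w 0).1 hw'
  have hk1 : k ≠ 0 := by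
    rintro rfl
    rw [hk, map_zero, map_zero] at hψw
    exact zero_ne_one hψw
  have hψB : ∀ h, ψ (pencil c A ξ μ h) = 0 := by
    intro h
    have h1 := hψ _ _ ((mem_blochGraph_iff_pencil (μ := μ) _ _).2 ⟨h, rfl, rfl⟩)
    rw [map_add, map_smul, smul_eq_mul] at h1
    exact add_eq_left.1 h1
  have hlk := eq_of_bordered_kernel hT hk0.symm
  have hlk0 : ℓ k ≠ 0 := by
    intro h0
    rw [h0, zero_smul] at hlk
    exact hk1 hlk
  refine eigenprojection_eq_smulRight hw hψw hψ (fun v hv => ?_) (fun h hh => ?_)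
  · have hv' : (v, μ • v + 0) ∈ (blochOp c A ξ).graph := by rwa [add_zero]
    obtain ⟨k', hk', hk0'⟩ := (mem_blochGraph_iff_pencil v 0).1 hv'
    refine ⟨ℓ k' * (ℓ k)⁻¹, ?_⟩
    have h1 := eq_of_bordered_kernel hT hk0'.symm
    rw [hk', hk, ← map_smul, mul_smul]
    congr 1
    rw [(inv_smul_eq_iff₀ hlk0).2 hlk]
    exact h1
  · have h1 := eq_of_bordered_left_kernel hT hψB
    have hg : ψ g ≠ 0 := by
      intro h0
      rw [h1, h0, zero_mul] at hψw
      exact zero_ne_one hψw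
    have h2 : ℓ (Ring.inverse (bordered (pencil c A ξ μ) ℓ g) h) = 0 := by
      rw [h1] at hh
      exact (mul_eq_zero.1 hh).resolve_left hg
    have h3 := bordered_solve hT h2
    refine ⟨opJ n (-Ring.inverse (bordered (pencil c A ξ μ) ℓ g) h), ?_⟩
    rw [sub_eq_add_neg, mem_blochGraph_iff_pencil]
    exact ⟨_, rfl, by rw [map_neg, h3]⟩

end BlochEigenprojection

/-! ### Consequences for an arbitrary critical branch -/

section CriticalBranch

variable {n K : ℕ} {c : ℝ} {f : EuclideanSpace ℝ (Fin n) → EuclideanSpace ℝ (Fin n)}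
  {u : ℝ → EuclideanSpace ℝ (Fin n)} {δ : ℝ} {mu : ℝ → ℂ} {q : ℝ → C(UnitAddCircle, Cn n)}
  {qt : ℝ → C(UnitAddCircle, Cn n →L[ℂ] ℂ)} {ξ : ℝ}

lemma IsCriticalBranch.rowCLM_graph (hb : IsCriticalBranch c f u δ mu q qt) (hξ : ξ ∈ Ioo (-δ) δ)
    (v z : L2per n) (h : (v, z) ∈ (linBloch c f u ξ).graph) :
    rowCLM n (qt ξ) z = mu ξ * rowCLM n (qt ξ) v := by
  obtain ⟨hd, rfl⟩ := (graph_map_iff _ _ _).1 h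
  have := hb.left_eigen ξ hξ ⟨v, hd⟩
  rwa [rowCLM_apply, rowCLM_apply]

lemma IsCriticalBranch.rowCLM_normalized (hb : IsCriticalBranch c f u δ mu q qt)
    (hξ : ξ ∈ Ioo (-δ) δ) : rowCLM n (qt ξ) (toL2per (q ξ)) = 1 := by
  rw [rowCLM_apply, ← hb.normalized ξ hξ]
  apply integral_congr_ae
  filter_upwards [coeFn_toL2per (q ξ)] with x hx
  rw [hx]

/-- For small `ξ` the eigenprojection is `q̃ ⊗ q`. -/
theorem IsCriticalBranch.eventually_eigenprojection (hK : 1 ≤ K) (hf : ContDiff ℝ K f)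
    (hu : IsPeriodicProfile c f u) (hD1 : CondD1 c f u)
    (hb : IsCriticalBranch c f u δ mu q qt) :
    ∀ᶠ ξ in 𝓝 (0 : ℝ), eigenprojection (linBloch c f u ξ) (mu ξ) =
      (rowCLM n (qt ξ)).smulRight (toL2per (q ξ)) := by
  obtain ⟨A, hA, hAy⟩ := hu.exists_coeff hK hf
  obtain ⟨w, h₀, hw, hw0, hJ, hker⟩ := hu.exists_kernel hK hf hAy
  have hc : opJc n h₀ = w := toL2per_injective (by rw [toL2per_opJc, hJ])
  have h0 : h₀ ≠ 0 := by
    rintro rfl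
    exact hw0 (by rw [← hc, map_zero])
  obtain ⟨ℓ, hℓ⟩ := exists_normalized_functional h0
  have hD1' := hD1
  rw [CondD1, linBloch, hA] at hD1'
  have hT := isUnit_bordered_of_simple h0 hker hD1' hℓ
  have h1 := eventually_isUnit_bordered hT
  -- Since `(ξ, mu ξ) → (0, 0)`, the bordered operator stays invertible along this branch, whatever
  -- the branch is.
  have h2 : ContinuousAt (fun ξ : ℝ => ((ξ : ℂ), mu ξ)) 0 :=
    Complex.continuous_ofReal.continuousAt.prodMk
      (hb.analytic_mu 0 ⟨neg_lt_zero.2 hb.pos, hb.pos⟩).continuousAt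
  have h3 : Tendsto (fun ξ : ℝ => ((ξ : ℂ), mu ξ)) (𝓝 0) (𝓝 0) := by
    have := h2.tendsto
    rwa [hb.mu_zero, Complex.ofReal_zero] at this
  filter_upwards [h3.eventually h1, Ioo_mem_nhds (neg_lt_zero.2 hb.pos) hb.pos] with ξ hξ hξδ
  have h4 := hb.right_eigen ξ hξδ
  have h5 := hb.rowCLM_graph hξδ
  rw [linBloch, hA] at h4 h5 ⊢
  exact eigenprojection_blochOp hξ h4 (hb.rowCLM_normalized hξδ) h5

/-- The eigenvalue belongs to the spectrum: a resolvent would annihilate the eigenfunction, whose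
pairing with `qt ξ` is `1`. -/
lemma IsCriticalBranch.re_mu_le (hb : IsCriticalBranch c f u δ mu q qt) (hξ : ξ ∈ Ioo (-δ) δ)
    (hξπ : ξ ∈ Icc (-Real.pi) Real.pi) {θ : ℝ}
    (hθ : ∀ ξ ∈ Icc (-Real.pi) Real.pi, ∀ lam ∈ opSpectrum (linBloch c f u ξ),
      lam.re ≤ -θ * |ξ| ^ 2) : (mu ξ).re ≤ -θ * ξ ^ 2 := by
  rw [← sq_abs ξ]
  refine hθ ξ hξπ _ ?_
  rintro ⟨R, -, hR⟩
  have h1 := hb.right_eigen ξ hξ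
  obtain ⟨hd, hz⟩ := (graph_map_iff _ _ _).1 h1
  have h2 := hR ⟨_, hd⟩
  rw [hz, sub_self, map_zero] at h2
  have h3 := hb.rowCLM_normalized hξ
  rw [show toL2per (q ξ) = 0 from h2.symm, map_zero] at h3
  exact zero_ne_one h3

/-- The continuous representative of `P(ξ) e^{L_ξ t} w`. -/
lemma IsCriticalBranch.contRep_eigenprojection_expSemigroup (hK : 1 ≤ K) (hf : ContDiff ℝ K f)
    (hu : IsPeriodicProfile c f u) (hb : IsCriticalBranch c f u δ mu q qt) (hξ : ξ ∈ Ioo (-δ) δ)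
    (hP : eigenprojection (linBloch c f u ξ) (mu ξ) =
      (rowCLM n (qt ξ)).smulRight (toL2per (q ξ))) {t : ℝ} (ht : 0 ≤ t) (w : L2per n)
    (x : UnitAddCircle) :
    contRep (eigenprojection (linBloch c f u ξ) (mu ξ) (expSemigroup (linBloch c f u ξ) t w)) x =
      (Complex.exp (mu ξ * t) * rowCLM n (qt ξ) w) • q ξ x := by
  obtain ⟨A, hA, hAy⟩ := hu.exists_coeff hK hf
  have h1 : IsSemigroupOf (linBloch c f u ξ) (expSemigroup (linBloch c f u ξ)) := by
    rw [linBloch, hA]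
    exact expSemigroup_spec (exists_isSemigroupOf_blochOp c A ξ)
  have hd : Dense ((linBloch c f u ξ).domain : Set (L2per n)) := by
    rw [linBloch, hA]
    exact dense_domain_blochOp
  rw [hP, ContinuousLinearMap.smulRight_apply,
    h1.left_eigenfunctional hd (hb.rowCLM_graph hξ) ht, ← toL2perCLM_apply, ← map_smul,
    toL2perCLM_apply, contRep_toL2per]
  rfl

end CriticalBranch

/-! ### The Bloch transform of Schwartz functions -/

section BlochTransform

variable {E : Type*} [NormedAddCommGroup E] [NormedSpace ℂ E]

lemma norm_exp_neg_I_mul (ξ y : ℝ) : ‖Complex.exp (-(Complex.I * ξ * y))‖ = 1 := by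
  have : -(Complex.I * ξ * y : ℂ) = ((-(ξ * y) : ℝ) : ℂ) * Complex.I := by push_cast; ring
  rw [this, Complex.norm_exp_ofReal_mul_I]

lemma integrable_exp_circle_smul {g : ℝ → E} (hg : Integrable g) (ξ : ℝ) (h : C(UnitAddCircle, ℂ)) :
    Integrable fun y : ℝ => Complex.exp (-(Complex.I * ξ * y)) • h y • g y := by
  have h1 : Continuous fun y : ℝ => Complex.exp (-(Complex.I * ξ * y)) * h y :=
    (by fun_prop : Continuous fun y : ℝ => Complex.exp (-(Complex.I * ξ * y))).mul
      (h.continuous.comp (AddCircle.continuous_mk' 1))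
  have h2 := hg.bdd_smul (φ := fun y : ℝ => Complex.exp (-(Complex.I * ξ * y)) * h y) ‖h‖
    h1.aestronglyMeasurable
    (Eventually.of_forall fun y => by
      rw [norm_mul, norm_exp_neg_I_mul, one_mul]; exact h.norm_coe_le_norm _)
  refine h2.congr (Eventually.of_forall fun y => ?_)
  simp only [Pi.smul_apply', smul_smul]

/-- Integration of `e^{-iξ·} h g` over the line, as an operator acting on the periodic factor `h`. -/
def lineIntegralCLM {g : ℝ → E} (hg : Integrable g) (ξ : ℝ) : C(UnitAddCircle, ℂ) →L[ℂ] E :=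
  LinearMap.mkContinuous
    { toFun := fun h => ∫ y : ℝ, Complex.exp (-(Complex.I * ξ * y)) • h y • g y
      map_add' := fun h k => by
        rw [← integral_add (integrable_exp_circle_smul hg ξ h) (integrable_exp_circle_smul hg ξ k)]
        simp only [ContinuousMap.add_apply, add_smul, smul_add]
      map_smul' := fun a h => by
        rw [RingHom.id_apply, ← integral_smul]
        congr 1
        ext1 y
        rw [ContinuousMap.smul_apply, smul_comm a, smul_assoc] } (∫ y, ‖g y‖)
    (fun h => by
      change ‖∫ y : ℝ, Complex.exp (-(Complex.I * ξ * y)) • h y • g y‖ ≤ _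
      rw [mul_comm (∫ y, ‖g y‖), ← integral_const_mul]
      refine norm_integral_le_of_norm_le (hg.norm.const_mul _) (Eventually.of_forall fun y => ?_)
      rw [norm_smul, norm_smul, norm_exp_neg_I_mul, one_mul]
      gcongr
      exact h.norm_coe_le_norm _)

/-- Integration against a fixed continuous function on the circle. -/
def circleIntegralCLM (S : C(UnitAddCircle, E)) : C(UnitAddCircle, ℂ) →L[ℂ] E :=
  have hi : ∀ h : C(UnitAddCircle, ℂ),
      Integrable (fun x => h x • S x) AddCircle.haarAddCircle := fun h =>
    integrable_of_continuous (⟨fun x => h x • S x, by fun_prop⟩ : C(UnitAddCircle, E))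
  LinearMap.mkContinuous
    { toFun := fun h => ∫ x, h x • S x ∂AddCircle.haarAddCircle
      map_add' := fun h k => by
        rw [← integral_add (hi h) (hi k)]
        simp only [ContinuousMap.add_apply, add_smul]
      map_smul' := fun a h => by
        rw [RingHom.id_apply, ← integral_smul]
        simp only [ContinuousMap.smul_apply, smul_assoc] } ‖S‖
    (fun h => by
      change ‖∫ x, h x • S x ∂AddCircle.haarAddCircle‖ ≤ _
      refine (norm_integral_le_of_norm_le_const (C := ‖S‖ * ‖h‖)
        (Eventually.of_forall fun x => ?_)).trans_eq (by simp)
      rw [norm_smul, mul_comm]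
      gcongr
      · exact S.norm_coe_le_norm _
      · exact h.norm_coe_le_norm _)

/-- If the Fourier coefficients of `S` are the Fourier transform of `g` at `ξ + 2πk`, then integrals
of `S` over the circle against periodic functions agree with integrals of `e^{-iξ·} g` over the
line. -/
lemma integral_circle_smul_eq [CompleteSpace E] {S : C(UnitAddCircle, E)} {g : ℝ → E}
    (hg : Integrable g) (ξ : ℝ) (hS : ∀ k : ℤ, fourierCoeff S k =
      ∫ y : ℝ, Complex.exp (-(Complex.I * ((ξ + 2 * Real.pi * k : ℝ) : ℂ) * y)) • g y)
    (h : C(UnitAddCircle, ℂ)) : ∫ x, h x • S x ∂AddCircle.haarAddCircle =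
      ∫ y : ℝ, Complex.exp (-(Complex.I * ξ * y)) • h y • g y := by
  -- Both sides are continuous and linear in the periodic factor. On `fourier k` they agree by the
  -- hypothesis at `-k`, and trigonometric polynomials are uniformly dense.
  have key : circleIntegralCLM S = lineIntegralCLM hg ξ := by
    refine ContinuousLinearMap.ext_on (s := range (@fourier 1)) ?_ ?_
    · rw [Submodule.dense_iff_topologicalClosure_eq_top]
      exact span_fourier_closure_eq_top
    · rintro _ ⟨k, rfl⟩
      change ∫ x, fourier k x • S x ∂AddCircle.haarAddCircle =
        ∫ y : ℝ, Complex.exp (-(Complex.I * ξ * y)) • fourier k (y : UnitAddCircle) • g y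
      have h1 := hS (-k)
      rw [fourierCoeff, neg_neg] at h1
      rw [h1]
      congr 1
      ext1 y
      rw [fourier_coe_apply, smul_smul, ← Complex.exp_add]
      congr 2
      push_cast
      ring
  exact DFunLike.congr_fun key h

variable {n : ℕ}

lemma fourierT_eq_fourier (g : 𝓢(ℝ, Cn n)) (η : ℝ) :
    fourierT g η = FourierTransform.fourier g (η / (2 * Real.pi)) := by
  rw [SchwartzMap.fourier_coe, Real.fourier_real_eq_integral_exp_smul, fourierT]
  congr 1
  ext1 y
  congr 2
  have : (Real.pi : ℂ) ≠ 0 := by exact_mod_cast Real.pi_ne_zero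
  push_cast
  field_simp

lemma summable_norm_fourierT (g : 𝓢(ℝ, Cn n)) (ξ : ℝ) :
    Summable fun j : ℤ => ‖fourierT g (ξ + 2 * Real.pi * j)‖ := by
  obtain ⟨C, hC0, hC⟩ := (FourierTransform.fourier g).decay 2 0
  have h1 := ((Real.summable_one_div_int_add_rpow (ξ / (2 * Real.pi)) 2).2 one_lt_two).mul_left C
  refine h1.of_norm_bounded_eventually ?_
  -- At most one frequency makes the comparison denominator vanish; it is discarded, and elsewhere
  -- quadratic Schwartz decay suffices.
  have h2 : {j : ℤ | (j : ℝ) + ξ / (2 * Real.pi) = 0}.Subsingleton := by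
    intro a ha b hb
    rw [Set.mem_ofPred_eq] at ha hb
    have : (a : ℝ) = b := by linarith
    exact_mod_cast this
  filter_upwards [h2.finite.compl_mem_cofinite] with j hj
  have hj0 : (j : ℝ) + ξ / (2 * Real.pi) ≠ 0 := hj
  have e : (ξ + 2 * Real.pi * j) / (2 * Real.pi) = (j : ℝ) + ξ / (2 * Real.pi) := by
    field_simp
    ring
  rw [norm_norm, fourierT_eq_fourier, e]
  have h3 := hC ((j : ℝ) + ξ / (2 * Real.pi))
  rw [norm_iteratedFDeriv_zero, Real.norm_eq_abs] at h3
  rw [Real.rpow_two, mul_one_div, le_div_iff₀ (by positivity), mul_comm]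
  exact h3

/-- The series converges absolutely in the sup norm, so `blochTransform` is never the default value
zero and its coefficients can be read off termwise. -/
lemma exists_blochTransform (g : 𝓢(ℝ, Cn n)) (ξ : ℝ) : ∃ S : C(UnitAddCircle, Cn n),
    blochTransform g ξ = toL2per S ∧
      ∀ k : ℤ, fourierCoeff S k = fourierT g (ξ + 2 * Real.pi * k) := by
  have hsum : Summable fun j : ℤ => expFun (Cn n) j (fourierT g (ξ + 2 * Real.pi * j)) := by
    refine Summable.of_norm_bounded (summable_norm_fourierT g ξ) fun j => ?_
    exact ((expFun (Cn n) j).le_of_opNorm_le (norm_expFun_le _ j) _).trans_eq (one_mul _)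
  obtain ⟨S, hS⟩ := hsum
  have hfun : blochFun g ξ = S := by
    ext1 x
    exact (ContinuousMap.hasSum_apply hS x).tsum_eq
  refine ⟨S, ?_, fun k => ?_⟩
  · have hm : MemLp (blochFun g ξ) 2 (AddCircle.haarAddCircle : Measure UnitAddCircle) := by
      rw [hfun]
      exact (Lp.memLp (toL2per S)).ae_eq (coeFn_toL2per S)
    rw [blochTransform, dif_pos hm]
    apply Lp.ext
    refine hm.coeFn_toLp.trans ?_
    rw [hfun]
    exact (coeFn_toL2per S).symm
  · have h1 := hS.mapL ((coeffCLM n k).comp (toL2perCLM n))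
    have h2 : ∀ v, ((coeffCLM n k).comp (toL2perCLM n)) v = fourierCoeff v k := fun v => by
      rw [ContinuousLinearMap.comp_apply, coeffCLM_apply]
      exact congrFun (fourierCoeff_congr_ae (coeFn_toL2per v)) k
    rw [h2] at h1
    refine h1.unique ?_
    have h3 : ∀ j, ((coeffCLM n k).comp (toL2perCLM n))
        (expFun (Cn n) j (fourierT g (ξ + 2 * Real.pi * j))) =
        if k = j then fourierT g (ξ + 2 * Real.pi * j) else 0 := fun j => by
      rw [h2]
      exact fourierCoeff_fourier_smul _ _ _
    simp only [h3]
    have h4 := hasSum_single (f := fun j : ℤ => if k = j then fourierT g (ξ + 2 * Real.pi * j)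
      else 0) k (fun j hj => if_neg hj.symm)
    rwa [if_pos rfl] at h4

/-- The left eigenfunctional applied to the Bloch transform. -/
theorem rowCLM_blochTransform (g : 𝓢(ℝ, Cn n)) (ξ : ℝ) (p : C(UnitAddCircle, Cn n →L[ℂ] ℂ)) :
    rowCLM n p (blochTransform g ξ) =
      ∫ y : ℝ, Complex.exp (-(Complex.I * ξ * y)) * p y (g y) := by
  obtain ⟨S, hS, hk⟩ := exists_blochTransform g ξ
  have hg : Integrable g := g.integrable
  -- Splitting the row vector into coordinates reduces to scalar periodic factors, as
  -- `integral_circle_smul_eq` requires.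
  let e : Fin n → Cn n := fun i => EuclideanSpace.single i 1
  let pc : Fin n → C(UnitAddCircle, ℂ) := fun i => ⟨fun x => p x (e i), by fun_prop⟩
  have hp : ∀ x v, p x v = ∑ i, EuclideanSpace.proj (𝕜 := ℂ) i (pc i x • v) := by
    intro x v
    have hv : v = ∑ i, v i • e i := by
      ext j
      simp [e, Finset.sum_apply, Pi.single_apply]
    conv_lhs => rw [hv]
    rw [map_sum]
    refine Finset.sum_congr rfl fun i _ => ?_
    rw [map_smul, map_smul, smul_eq_mul, smul_eq_mul, mul_comm]
    rfl
  have h1 : rowCLM n p (blochTransform g ξ) = ∫ x, p x (S x) ∂AddCircle.haarAddCircle := by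
    rw [hS, rowCLM_apply]
    apply integral_congr_ae
    filter_upwards [coeFn_toL2per S] with x hx
    rw [hx]
  have hi : ∀ i, Integrable (fun x => pc i x • S x) AddCircle.haarAddCircle := fun i =>
    integrable_of_continuous (⟨fun x => pc i x • S x, by fun_prop⟩ : C(UnitAddCircle, Cn n))
  have h2 : ∫ x, p x (S x) ∂AddCircle.haarAddCircle =
      ∑ i, EuclideanSpace.proj (𝕜 := ℂ) i (∫ x, pc i x • S x ∂AddCircle.haarAddCircle) := by
    simp only [hp]
    rw [integral_finsetSum _ fun i _ => (EuclideanSpace.proj (𝕜 := ℂ) i).integrable_comp (hi i)]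
    exact Finset.sum_congr rfl fun i _ => (EuclideanSpace.proj (𝕜 := ℂ) i).integral_comp_comm (hi i)
  have hi' := fun i => integrable_exp_circle_smul hg ξ (pc i)
  have h3 : ∫ y : ℝ, Complex.exp (-(Complex.I * ξ * y)) * p y (g y) =
      ∑ i, EuclideanSpace.proj (𝕜 := ℂ) i
        (∫ y : ℝ, Complex.exp (-(Complex.I * ξ * y)) • pc i y • g y) := by
    have e1 : ∀ y : ℝ, Complex.exp (-(Complex.I * ξ * y)) * p y (g y) =
        ∑ i, EuclideanSpace.proj (𝕜 := ℂ) i (Complex.exp (-(Complex.I * ξ * y)) • pc i y • g y) := by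
      intro y
      rw [hp, Finset.mul_sum]
      exact Finset.sum_congr rfl fun i _ => by rw [map_smul _ (Complex.exp _), smul_eq_mul]
    simp only [e1]
    rw [integral_finsetSum _ fun i _ => (EuclideanSpace.proj (𝕜 := ℂ) i).integrable_comp (hi' i)]
    exact Finset.sum_congr rfl fun i _ => (EuclideanSpace.proj (𝕜 := ℂ) i).integral_comp_comm (hi' i)
  rw [h1, h2, h3]
  exact Finset.sum_congr rfl fun i _ => by
    rw [integral_circle_smul_eq hg ξ (fun k => hk k) (pc i)]

end BlochTransform

/-! ### Pointwise bilinear operations on spaces of continuous functions -/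

section Pointwise

variable (X : Type*) [TopologicalSpace X] [CompactSpace X]
  {F₁ F₂ F₃ : Type*} [NormedAddCommGroup F₁] [NormedSpace ℂ F₁]
  [NormedAddCommGroup F₂] [NormedSpace ℂ F₂] [NormedAddCommGroup F₃] [NormedSpace ℂ F₃]

/-- A bilinear map applied pointwise to continuous functions. -/
def pointwiseBilin (B : F₁ →L[ℂ] F₂ →L[ℂ] F₃) : C(X, F₁) →L[ℂ] C(X, F₂) →L[ℂ] C(X, F₃) :=
  LinearMap.mkContinuous₂
    (LinearMap.mk₂ ℂ
      (fun f g => (⟨fun x => B (f x) (g x), by fun_prop⟩ : C(X, F₃)))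
      (fun f f' g => by ext x; simp) (fun a f g => by ext x; simp)
      (fun f g g' => by ext x; simp) (fun a f g => by ext x; simp)) ‖B‖
    (fun f g => by
      rw [ContinuousMap.norm_le _ (by positivity)]
      intro x
      refine (B.le_opNorm₂ (f x) (g x)).trans ?_
      gcongr
      · exact f.norm_coe_le_norm x
      · exact g.norm_coe_le_norm x)

@[simp] lemma pointwiseBilin_apply (B : F₁ →L[ℂ] F₂ →L[ℂ] F₃) (f : C(X, F₁)) (g : C(X, F₂)) (x : X) :
    pointwiseBilin X B f g x = B (f x) (g x) := rfl

/-- Constant functions, as a continuous linear map. -/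
def constMapCLM : F₁ →L[ℂ] C(X, F₁) :=
  LinearMap.mkContinuous
    { toFun := fun v => ContinuousMap.const X v
      map_add' := fun v w => rfl
      map_smul' := fun a v => rfl } 1
    (fun v => by
      rw [one_mul, ContinuousMap.norm_le _ (norm_nonneg v)]
      exact fun x => le_refl _)

@[simp] lemma constMapCLM_apply (v : F₁) (x : X) : constMapCLM X v x = v := rfl

variable {X}

lemma contDiff_pointwiseBilin {G : Type*} [NormedAddCommGroup G] [NormedSpace ℝ G] {m : ℕ∞ω}
    (B : F₁ →L[ℂ] F₂ →L[ℂ] F₃) {f : G → C(X, F₁)} {g : G → C(X, F₂)} (hf : ContDiff ℝ m f)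
    (hg : ContDiff ℝ m g) : ContDiff ℝ m (fun y => pointwiseBilin X B (f y) (g y)) := by
  have h1 : ContDiff ℝ m (fun y => ((pointwiseBilin X B).restrictScalars ℝ) (f y)) :=
    ((pointwiseBilin X B).restrictScalars ℝ).contDiff.comp hf
  have h2 : ContDiff ℝ m fun T : C(X, F₂) →L[ℂ] C(X, F₃) => T.restrictScalars ℝ :=
    (ContinuousLinearMap.restrictScalarsL ℂ (C(X, F₂)) (C(X, F₃)) ℝ ℝ).contDiff
  exact (h2.comp h1).clm_apply hg

lemma contDiff_constMapCLM {G : Type*} [NormedAddCommGroup G] [NormedSpace ℝ G] {m : ℕ∞ω}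
    {f : G → F₁} (hf : ContDiff ℝ m f) : ContDiff ℝ m (fun y => constMapCLM X (f y)) :=
  ((constMapCLM X).restrictScalars ℝ).contDiff.comp hf

end Pointwise

/-! ### Elliptic regularity through Fourier coefficients -/

section Regularity

variable {V : Type*} [NormedAddCommGroup V] [NormedSpace ℂ V]

lemma contDiff_succ_of_hasDerivAt {E : Type*} [NormedAddCommGroup E] [NormedSpace ℝ E]
    {f f' : ℝ → E} {m : ℕ} (hd : ∀ y, HasDerivAt f (f' y) y) (hf' : ContDiff ℝ m f') :
    ContDiff ℝ (m + 1 : ℕ) f := by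
  have h1 : deriv f = f' := funext fun y => (hd y).deriv
  have := (contDiff_succ_iff_deriv (n := (m : ℕ∞ω)) (f := f)).2
    ⟨fun y => (hd y).differentiableAt, by simp, by rwa [h1]⟩
  exact_mod_cast this

lemma fourierCoeff_clm_comp [CompleteSpace V] {W : Type*} [NormedAddCommGroup W] [NormedSpace ℂ W]
    [CompleteSpace W] (b : V →L[ℂ] W) (p : C(UnitAddCircle, V)) (k : ℤ) :
    fourierCoeff (fun x => b (p x)) k = b (fourierCoeff p k) := by
  rw [fourierCoeff, fourierCoeff, ← ContinuousLinearMap.integral_comp_comm]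
  · simp only [map_smul]
  · exact integrable_of_continuous (⟨fun x => fourier (-k) x • p x, by fun_prop⟩ :
      C(UnitAddCircle, V))

/-- Regularity for a second-order equation `p'' - b p' = r` given in terms of Fourier
coefficients. -/
theorem contDiff_of_fourierCoeff_eq [CompleteSpace V] {p r : C(UnitAddCircle, V)} (b : V →L[ℂ] V)
    {N : ℕ} (hrel : ∀ k : ℤ, (2 * Real.pi * Complex.I * k : ℂ) •
      ((2 * Real.pi * Complex.I * k : ℂ) • fourierCoeff p k - b (fourierCoeff p k)) =
        fourierCoeff r k)
    (hr : ∀ m : ℕ, m ≤ N → ContDiff ℝ m (fun y : ℝ => p y) → ContDiff ℝ m (fun y : ℝ => r y)) :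
    ContDiff ℝ (N + 2 : ℕ) (fun y : ℝ => p y) := by
  have hr0 : fourierCoeff r 0 = 0 := by rw [← hrel 0]; simp
  -- One integration turns the equation into `p' = b p + R` with `R' = r`. At nonzero frequencies
  -- the factor `2πik` cancels; the mean of `R` is chosen so that the relation also holds at `k =
  -- 0`.
  obtain ⟨R, hR, hR0⟩ := exists_primitive_circle hr0 (-b (fourierCoeff p 0))
  let r₁ : C(UnitAddCircle, V) := ⟨fun x => b (p x) + R x, by fun_prop⟩
  have hp : ∀ y : ℝ, HasDerivAt (fun y : ℝ => p y) (b (p y) + R y) y := by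
    refine hasDerivAt_of_fourierCoeff (r := r₁) fun k => ?_
    have h1 : fourierCoeff r₁ k = b (fourierCoeff p k) + fourierCoeff R k := by
      rw [← fourierCoeff_clm_comp b p k]
      exact congrFun (fourierCoeff.add
        (integrable_of_continuous (⟨fun x => b (p x), by fun_prop⟩ : C(UnitAddCircle, V)))
        (integrable_of_continuous R)) k
    rw [h1]
    rcases eq_or_ne k 0 with rfl | hk
    · rw [hR0]; simp
    · have h2 := (fourierCoeff_of_hasDerivAt hR k).symm.trans (hrel k).symm
      have h3 : fourierCoeff R k =
          (2 * Real.pi * Complex.I * k : ℂ) • fourierCoeff p k - b (fourierCoeff p k) := by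
        refine smul_right_injective V ?_ h2
        simp [hk, Real.pi_ne_zero]
      rw [h3]
      abel
  have hb : ∀ {m : ℕ}, ContDiff ℝ m (fun y : ℝ => p y) → ContDiff ℝ m (fun y : ℝ => R y) →
      ContDiff ℝ (m + 1 : ℕ) (fun y : ℝ => p y) := fun h1 h2 =>
    contDiff_succ_of_hasDerivAt hp (((b.restrictScalars ℝ).contDiff.comp h1).add h2)
  have key : ∀ m : ℕ, m ≤ N + 1 → ContDiff ℝ m (fun y : ℝ => p y) ∧
      ContDiff ℝ m (fun y : ℝ => R y) := by
    intro m
    induction m with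
    | zero =>
      intro _
      exact ⟨contDiff_zero.2 (continuous_coe_circle p), contDiff_zero.2 (continuous_coe_circle R)⟩
    | succ m ih =>
      intro hm
      obtain ⟨h1, h2⟩ := ih (by omega)
      exact ⟨hb h1 h2, contDiff_succ_of_hasDerivAt hR (hr m (by omega) h1)⟩
  obtain ⟨h1, h2⟩ := key (N + 1) le_rfl
  exact hb h1 h2

/-- Regularity in `y`, uniformly in a compact parameter set, of the solution of a family of linear
second-order equations. -/
theorem contDiff_of_fourierCoeff_family {X : Type*} [TopologicalSpace X] [CompactSpace X]
    [CompleteSpace V] {P : C(UnitAddCircle, C(X, V))} {A : C(UnitAddCircle, V →L[ℂ] V)} {N : ℕ}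
    (hA : ContDiff ℝ N (fun y : ℝ => A y)) {m b : C(X, ℂ)}
    (hrel : ∀ (ξ : X) (k : ℤ), (2 * Real.pi * Complex.I * k : ℂ) •
      ((2 * Real.pi * Complex.I * k - b ξ : ℂ) • fourierCoeff (fun x => P x ξ) k) =
        m ξ • fourierCoeff (fun x => P x ξ) k - fourierCoeff (fun x => A x (P x ξ)) k) :
    ContDiff ℝ (N + 2 : ℕ) (fun y : ℝ => P y) := by
  let S := pointwiseBilin X (ContinuousLinearMap.lsmul ℂ ℂ : ℂ →L[ℂ] V →L[ℂ] V)
  let T := pointwiseBilin X (ContinuousLinearMap.id ℂ (V →L[ℂ] V))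
  let r : C(UnitAddCircle, C(X, V)) :=
    ⟨fun x => S m (P x) - T (constMapCLM X (A x)) (P x), by fun_prop⟩
  have hev : ∀ (p : C(UnitAddCircle, C(X, V))) (ξ : X) k, (fourierCoeff p k) ξ =
      fourierCoeff (fun x => p x ξ) k := fun p ξ k =>
    (fourierCoeff_clm_comp (ContinuousMap.evalCLM ℂ ξ) p k).symm
  -- Evaluation at `ξ` commutes with coefficients, so the equations for all `ξ` together form one
  -- equation in the Banach space `C(X, V)`.
  refine contDiff_of_fourierCoeff_eq (r := r) (S b) (fun k => ?_) (fun l hl hP => ?_)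
  · ext ξ
    have h1 := hrel ξ k
    rw [← hev P] at h1
    have h2 : fourierCoeff (fun x => r x ξ) k = m ξ • fourierCoeff (fun x => P x ξ) k -
        fourierCoeff (fun x => A x (P x ξ)) k := by
      have h3 := fourierCoeff_sub_continuous
        (⟨fun x => m ξ • P x ξ, by fun_prop⟩ : C(UnitAddCircle, V))
        (⟨fun x => A x (P x ξ), by fun_prop⟩ : C(UnitAddCircle, V)) k
      rw [← fourierCoeff.const_smul]
      exact h3
    rw [hev r, h2, ← hev P, ← h1, sub_smul]
    rfl
  · exact (contDiff_pointwiseBilin _ contDiff_const hP).sub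
      (contDiff_pointwiseBilin _ (contDiff_constMapCLM (hA.of_le (by exact_mod_cast hl))) hP)

end Regularity

lemma contDiff_clm_comp {F₁ F₂ G : Type*} [NormedAddCommGroup F₁] [NormedSpace ℂ F₁]
    [NormedAddCommGroup F₂] [NormedSpace ℂ F₂] [NormedAddCommGroup G] [NormedSpace ℝ G] {m : ℕ∞ω}
    (L : F₁ →L[ℂ] F₂) {f : G → F₁} (hf : ContDiff ℝ m f) : ContDiff ℝ m fun y => L (f y) :=
  (L.restrictScalars ℝ).contDiff.comp hf

/-! ### Regularity of the left eigenfunctions -/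

section BranchRegularity

variable {n K : ℕ} {c : ℝ} {f : EuclideanSpace ℝ (Fin n) → EuclideanSpace ℝ (Fin n)}
  {u : ℝ → EuclideanSpace ℝ (Fin n)} {δ : ℝ} {mu : ℝ → ℂ} {q : ℝ → C(UnitAddCircle, Cn n)}
  {qt : ℝ → C(UnitAddCircle, Cn n →L[ℂ] ℂ)} {ξ : ℝ}

lemma rowCLM_mulOp (p : C(UnitAddCircle, Cn n →L[ℂ] ℂ)) (A : C(UnitAddCircle, Cn n →L[ℂ] Cn n))
    (w : L2per n) : rowCLM n p (mulOp A w) =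
      rowCLM n (⟨fun x => (p x).comp (A x), by fun_prop⟩ : C(UnitAddCircle, Cn n →L[ℂ] ℂ)) w := by
  rw [rowCLM_apply, rowCLM_apply]
  apply integral_congr_ae
  filter_upwards [coeFn_mulOp A w] with x hx
  rw [hx]
  rfl

/-- The left eigenvalue equation in terms of Fourier coefficients. -/
lemma fourierCoeff_left_eigen {A : C(UnitAddCircle, Cn n →L[ℂ] Cn n)}
    {p : C(UnitAddCircle, Cn n →L[ℂ] ℂ)} {μ : ℂ}
    (hp : ∀ v z, (v, z) ∈ (blochOp c A ξ).graph → rowCLM n p z = μ * rowCLM n p v) (k : ℤ) :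
    (2 * Real.pi * Complex.I * k : ℂ) •
      ((2 * Real.pi * Complex.I * k - (2 * Complex.I * ξ + c) : ℂ) • fourierCoeff p k) =
        (μ - ((Complex.I * ξ) ^ 2 + c * (Complex.I * ξ))) • fourierCoeff p k -
          fourierCoeff (fun x => (p x).comp (A x)) k := by
  ext1 v
  -- Testing at frequency `-k` isolates the `k`-th coefficient of `p`; the common factor `jSym (-k)`
  -- is cancelled at the end.
  have h1 := hp _ _ ((mem_blochGraph_iff c A ξ _ _).2 ⟨expVec n (-k) v, rfl, rfl⟩)
  rw [pencil_apply, opJ_expVec, opDJ_expVec] at h1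
  simp only [map_add, map_sub, map_smul, rowCLM_mulOp, rowCLM_expVec, neg_neg, smul_eq_mul] at h1
  have h2 := sq_symbol_mul_jSym (-k)
  have h3 := jSym_ne_zero (-k)
  simp only [smul_apply, sub_apply, smul_eq_mul]
  rw [djSym] at h1
  push_cast at h1 h2
  apply mul_left_cancel₀ h3
  change _ = jSym (-k) * (_ - fourierCoeff (⟨fun x => (p x).comp (A x), by fun_prop⟩ :
    C(UnitAddCircle, Cn n →L[ℂ] ℂ)) k v)
  linear_combination h1 + (fourierCoeff p k v) * h2

/-- The left eigenfunctions are of class `C^{K+1}` in `y`, uniformly in `ξ`. -/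
theorem IsCriticalBranch.exists_regular_left (hK : 1 ≤ K) (hf : ContDiff ℝ K f)
    (hu : IsPeriodicProfile c f u) (hb : IsCriticalBranch c f u δ mu q qt) {d : ℝ} (hd : d < δ) :
    ∃ P : C(UnitAddCircle, C(Icc (-d) d, Cn n →L[ℂ] ℂ)), (∀ x ξ, P x ξ = qt ξ x) ∧
      ContDiff ℝ (K + 1 : ℕ) (fun y : ℝ => P y) := by
  obtain ⟨A, hA, hAy⟩ := hu.exists_coeff hK hf
  have hmem : ∀ ξ : Icc (-d) d, (ξ : ℝ) ∈ Ioo (-δ) δ := fun ξ =>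
    ⟨by linarith [ξ.2.1], by linarith [ξ.2.2]⟩
  have hqt : Continuous fun ξ : Icc (-d) d => qt ξ :=
    hb.analytic_qt.continuousOn.comp_continuous continuous_subtype_val hmem
  have hmu : Continuous fun ξ : Icc (-d) d => mu ξ :=
    hb.analytic_mu.continuousOn.comp_continuous continuous_subtype_val hmem
  let qI : C(Icc (-d) d, C(UnitAddCircle, Cn n →L[ℂ] ℂ)) := ⟨fun ξ => qt ξ, hqt⟩
  let P : C(UnitAddCircle, C(Icc (-d) d, Cn n →L[ℂ] ℂ)) :=
    ContinuousMap.curry ⟨fun z : UnitAddCircle × Icc (-d) d => qI z.2 z.1, by fun_prop⟩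
  have hP : ∀ x ξ, P x ξ = qt ξ x := fun x ξ => rfl
  refine ⟨P, hP, ?_⟩
  let ρ := (ContinuousLinearMap.compL ℂ (Cn n) (Cn n) ℂ).flip
  let A' : C(UnitAddCircle, (Cn n →L[ℂ] ℂ) →L[ℂ] (Cn n →L[ℂ] ℂ)) := ⟨fun x => ρ (A x), by fun_prop⟩
  have hA' : ContDiff ℝ (K - 1 : ℕ) (fun y : ℝ => A' y) := by
    have h1 : ContDiff ℝ (K - 1 : ℕ) (fun y : ℝ => A y) := by
      simp only [hAy]
      exact hu.contDiff_jac hK hf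
    exact contDiff_clm_comp (F₂ := (Cn n →L[ℂ] ℂ) →L[ℂ] (Cn n →L[ℂ] ℂ)) ρ h1
  -- The coefficient `df(u)` is `C^{K-1}` and the second-order equation gains two derivatives.
  have hK' : K + 1 = K - 1 + 2 := by omega
  rw [hK']
  refine contDiff_of_fourierCoeff_family hA'
    (m := ⟨fun ξ => mu ξ - ((Complex.I * (ξ : ℝ)) ^ 2 + c * (Complex.I * (ξ : ℝ))),
      hmu.sub (by fun_prop)⟩)
    (b := ⟨fun ξ => 2 * Complex.I * (ξ : ℝ) + c, by fun_prop⟩) (fun ξ k => ?_)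
  have h1 := hb.rowCLM_graph (hmem ξ)
  rw [linBloch, hA] at h1
  exact fourierCoeff_left_eigen h1 k

end BranchRegularity

/-! ### Oscillatory integrals over a frequency band -/

section Band

variable {F : Type*} [NormedAddCommGroup F] [NormedSpace ℂ F] {d : ℝ}

/-- Lebesgue measure on the frequency band `[-d, d]`. -/
def bandMeasure (d : ℝ) : Measure (Icc (-d) d) := volume.comap Subtype.val

instance isFiniteMeasure_bandMeasure (d : ℝ) : IsFiniteMeasure (bandMeasure d) :=
  ⟨by
    rw [bandMeasure, comap_subtype_coe_apply measurableSet_Icc, image_univ, Subtype.range_coe,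
      Real.volume_Icc]
    exact ENNReal.ofReal_lt_top⟩

omit [NormedSpace ℂ F] in
lemma integrable_band (f : C(Icc (-d) d, F)) : Integrable f (bandMeasure d) :=
  f.continuous.integrable_of_hasCompactSupport (HasCompactSupport.of_compactSpace _)

/-- Integration over the frequency band `[-d, d]`. -/
def bandIntegral (F : Type*) [NormedAddCommGroup F] [NormedSpace ℂ F] (d : ℝ) :
    C(Icc (-d) d, F) →L[ℂ] F :=
  LinearMap.mkContinuous
    { toFun := fun f => ∫ ξ, f ξ ∂bandMeasure d
      map_add' := fun f g => integral_add (integrable_band f) (integrable_band g)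
      map_smul' := fun a f => integral_smul a f } ((bandMeasure d).real univ)
    (fun f => by
      refine (norm_integral_le_of_norm_le_const
        (Eventually.of_forall fun ξ => f.norm_coe_le_norm ξ)).trans_eq ?_
      rw [mul_comm])

lemma bandIntegral_apply (f : C(Icc (-d) d, F)) : bandIntegral F d f = ∫ ξ, f ξ ∂bandMeasure d := rfl

/-- Scalar multiplication of `F`-valued functions on the band by scalar functions. -/
def bandSMul (F : Type*) [NormedAddCommGroup F] [NormedSpace ℂ F] (d : ℝ) :
    C(Icc (-d) d, ℂ) →L[ℂ] C(Icc (-d) d, F) →L[ℂ] C(Icc (-d) d, F) :=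
  pointwiseBilin (Icc (-d) d) (ContinuousLinearMap.lsmul ℂ ℂ : ℂ →L[ℂ] F →L[ℂ] F)

@[simp] lemma bandSMul_apply (a : C(Icc (-d) d, ℂ)) (f : C(Icc (-d) d, F)) (ξ : Icc (-d) d) :
    bandSMul F d a f ξ = a ξ • f ξ := rfl

lemma bandSMul_mul (a b : C(Icc (-d) d, ℂ)) (f : C(Icc (-d) d, F)) :
    bandSMul F d (a * b) f = bandSMul F d a (bandSMul F d b f) := by
  ext ξ
  exact mul_smul _ _ _

lemma bandSMul_one (f : C(Icc (-d) d, F)) : bandSMul F d 1 f = f := by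
  ext ξ
  exact one_smul _ _

/-- The function `ξ ↦ iξ` on the band. -/
def bandX (d : ℝ) : C(Icc (-d) d, ℂ) := ⟨fun ξ => Complex.I * (ξ : ℝ), by fun_prop⟩

@[simp] lemma bandX_apply (ξ : Icc (-d) d) : bandX d ξ = Complex.I * (ξ : ℝ) := rfl

/-- The oscillating factor `ξ ↦ e^{iξx + M(ξ)t}`. -/
def phase (M : C(Icc (-d) d, ℂ)) (x t : ℝ) : C(Icc (-d) d, ℂ) :=
  NormedSpace.exp (x • bandX d + t • M)

lemma phase_apply (M : C(Icc (-d) d, ℂ)) (x t : ℝ) (ξ : Icc (-d) d) :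
    phase M x t ξ = Complex.exp (Complex.I * (ξ : ℝ) * x + M ξ * t) := by
  have h1 := NormedSpace.map_exp (ContinuousMap.evalAlgHom ℂ ℂ ξ)
    (continuous_eval_const ξ) (x • bandX d + t • M)
  have h2 : ContinuousMap.evalAlgHom ℂ ℂ ξ (x • bandX d + t • M) =
      Complex.I * (ξ : ℝ) * x + M ξ * t := by
    change x • (Complex.I * (ξ : ℝ) : ℂ) + t • M ξ = _
    rw [Complex.real_smul, Complex.real_smul]
    ring
  rw [h2, ← Complex.exp_eq_exp_ℂ] at h1
  exact h1

/-- `phase` is an exponential in the Banach algebra `C([-d,d], ℂ)`, so differentiating under the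
integral sign becomes ordinary calculus followed by a bounded linear map. -/
lemma contDiff_phase {G : Type*} [NormedAddCommGroup G] [NormedSpace ℝ G] {m : ℕ∞ω}
    (M : C(Icc (-d) d, ℂ)) {x t : G → ℝ} (hx : ContDiff ℝ m x) (ht : ContDiff ℝ m t) :
    ContDiff ℝ m fun g => phase M (x g) (t g) := by
  have h1 : ContDiff ℝ m (NormedSpace.exp : C(Icc (-d) d, ℂ) → C(Icc (-d) d, ℂ)) :=
    contDiff_iff_contDiffAt.2 fun x => (NormedSpace.exp_analytic (𝕂 := ℝ) x).contDiffAt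
  exact h1.comp ((hx.smul contDiff_const).add (ht.smul contDiff_const))

lemma hasDerivAt_phase_left (M : C(Icc (-d) d, ℂ)) (x t : ℝ) :
    HasDerivAt (fun x => phase M x t) (bandX d * phase M x t) x := by
  have h1 : HasDerivAt (fun x : ℝ => x • bandX d + t • M) (bandX d) x := by
    simpa using ((hasDerivAt_id x).smul_const (bandX d)).add_const (t • M)
  have h2 := (hasFDerivAt_exp (𝕂 := ℝ) (x := x • bandX d + t • M)).comp_hasDerivAt x h1
  rw [mul_comm]
  exact h2

lemma hasDerivAt_phase_right (M : C(Icc (-d) d, ℂ)) (x t : ℝ) :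
    HasDerivAt (fun t => phase M x t) (M * phase M x t) t := by
  have h1 : HasDerivAt (fun t : ℝ => x • bandX d + t • M) M t := by
    simpa using ((hasDerivAt_id t).smul_const M).const_add (x • bandX d)
  have h2 := (hasFDerivAt_exp (𝕂 := ℝ) (x := x • bandX d + t • M)).comp_hasDerivAt t h1
  rw [mul_comm]
  exact h2

/-- The oscillatory integral `∫_{-d}^{d} e^{iξx + M(ξ)t} w(ξ) dξ`. -/
def oscIntegral (M : C(Icc (-d) d, ℂ)) (x t : ℝ) : C(Icc (-d) d, F) →L[ℂ] F :=
  (bandIntegral F d).comp (bandSMul F d (phase M x t))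

lemma oscIntegral_eq (M : C(Icc (-d) d, ℂ)) (x t : ℝ) (w : C(Icc (-d) d, F)) :
    oscIntegral M x t w = bandIntegral F d (bandSMul F d (phase M x t) w) := rfl

lemma oscIntegral_apply (M : C(Icc (-d) d, ℂ)) (x t : ℝ) (w : C(Icc (-d) d, F)) :
    oscIntegral M x t w =
      ∫ ξ : Icc (-d) d, Complex.exp (Complex.I * (ξ : ℝ) * x + M ξ * t) • w ξ ∂bandMeasure d := by
  change ∫ ξ, phase M x t ξ • w ξ ∂bandMeasure d = _
  simp only [phase_apply]

lemma contDiff_oscIntegral {G : Type*} [NormedAddCommGroup G] [NormedSpace ℝ G] {m : ℕ∞ω}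
    (M : C(Icc (-d) d, ℂ)) {x t : G → ℝ} {w : G → C(Icc (-d) d, F)} (hx : ContDiff ℝ m x)
    (ht : ContDiff ℝ m t) (hw : ContDiff ℝ m w) :
    ContDiff ℝ m fun g => oscIntegral M (x g) (t g) (w g) :=
  contDiff_clm_comp (bandIntegral F d) (contDiff_pointwiseBilin _ (contDiff_phase M hx ht) hw)

/-- For fixed `w`, the map `a ↦ ∫ a w`. -/
def bandPairing (w : C(Icc (-d) d, F)) : C(Icc (-d) d, ℂ) →L[ℝ] F :=
  ((bandIntegral F d).comp ((bandSMul F d).flip w)).restrictScalars ℝ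

lemma bandPairing_apply (w : C(Icc (-d) d, F)) (a : C(Icc (-d) d, ℂ)) :
    bandPairing w a = bandIntegral F d (bandSMul F d a w) := rfl

lemma hasDerivAt_oscIntegral_left (M : C(Icc (-d) d, ℂ)) (x t : ℝ) (w : C(Icc (-d) d, F)) :
    HasDerivAt (fun x => oscIntegral M x t w) (oscIntegral M x t (bandSMul F d (bandX d) w)) x := by
  have h1 := (bandPairing w).hasFDerivAt.comp_hasDerivAt x (hasDerivAt_phase_left M x t)
  have h3 : (bandPairing w ∘ fun x => phase M x t) = fun x => oscIntegral M x t w := rfl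
  have h2 : bandPairing w (bandX d * phase M x t) =
      oscIntegral M x t (bandSMul F d (bandX d) w) := by
    rw [mul_comm, bandPairing_apply, bandSMul_mul, oscIntegral_eq]
  rw [h2, h3] at h1
  exact h1

lemma hasDerivAt_oscIntegral_right (M : C(Icc (-d) d, ℂ)) (x t : ℝ) (w : C(Icc (-d) d, F)) :
    HasDerivAt (fun t => oscIntegral M x t w) (oscIntegral M x t (bandSMul F d M w)) t := by
  have h1 := (bandPairing w).hasFDerivAt.comp_hasDerivAt t (hasDerivAt_phase_right M x t)
  have h3 : (bandPairing w ∘ fun t => phase M x t) = fun t => oscIntegral M x t w := rfl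
  have h2 : bandPairing w (M * phase M x t) = oscIntegral M x t (bandSMul F d M w) := by
    rw [mul_comm, bandPairing_apply, bandSMul_mul, oscIntegral_eq]
  rw [h2, h3] at h1
  exact h1

lemma iteratedDeriv_eq_of_hasDerivAt {E : Type*} [NormedAddCommGroup E] [NormedSpace ℝ E]
    {g : ℕ → ℝ → E} (h : ∀ k y, HasDerivAt (g k) (g (k + 1) y) y) (k : ℕ) :
    iteratedDeriv k (g 0) = g k := by
  induction k with
  | zero => exact iteratedDeriv_zero
  | succ k ih => rw [iteratedDeriv_succ, ih]; exact funext fun y => (h k y).deriv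

lemma iteratedDeriv_oscIntegral_left (M : C(Icc (-d) d, ℂ)) (t : ℝ) (w : C(Icc (-d) d, F)) (j : ℕ)
    (x : ℝ) : iteratedDeriv j (fun x => oscIntegral M x t w) x =
      oscIntegral M x t (bandSMul F d (bandX d ^ j) w) := by
  have h1 := iteratedDeriv_eq_of_hasDerivAt
    (g := fun j x => oscIntegral M x t (bandSMul F d (bandX d ^ j) w)) (fun k y => by
      have := hasDerivAt_oscIntegral_left M y t (bandSMul F d (bandX d ^ k) w)
      rwa [← bandSMul_mul, ← pow_succ'] at this) j
  simp only [pow_zero, bandSMul_one] at h1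
  rw [h1]

lemma iteratedDeriv_oscIntegral_right (M : C(Icc (-d) d, ℂ)) (x : ℝ) (w : C(Icc (-d) d, F)) (k : ℕ)
    (t : ℝ) : iteratedDeriv k (fun t => oscIntegral M x t w) t =
      oscIntegral M x t (bandSMul F d (M ^ k) w) := by
  have h1 := iteratedDeriv_eq_of_hasDerivAt
    (g := fun k t => oscIntegral M x t (bandSMul F d (M ^ k) w)) (fun k y => by
      have := hasDerivAt_oscIntegral_right M x y (bandSMul F d (M ^ k) w)
      rwa [← bandSMul_mul, ← pow_succ'] at this) k
  simp only [pow_zero, bandSMul_one] at h1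
  rw [h1]

lemma iteratedDeriv_clm_comp {E : Type*} [NormedAddCommGroup E] [NormedSpace ℂ E] (L : E →L[ℂ] F)
    {w : ℝ → E} {r : ℕ} (hw : ContDiff ℝ r w) (y : ℝ) :
    iteratedDeriv r (fun y => L (w y)) y = L (iteratedDeriv r w y) := by
  rw [iteratedDeriv_eq_iteratedFDeriv, iteratedDeriv_eq_iteratedFDeriv]
  have := (L.restrictScalars ℝ).iteratedFDeriv_comp_left (f := w) (x := y) hw.contDiffAt le_rfl
  exact DFunLike.congr_fun this _

/-- Mixed derivatives of a kernel given by an oscillatory integral. -/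
lemma mixedDeriv_oscIntegral (M : C(Icc (-d) d, ℂ)) {w : ℝ → C(Icc (-d) d, F)} {r : ℕ}
    (hw : ContDiff ℝ r w) (j k : ℕ) (x t y : ℝ) :
    mixedDeriv j k r (fun x t y => oscIntegral M x t (w y)) x t y =
      oscIntegral M x t (bandSMul F d (bandX d ^ j * M ^ k) (iteratedDeriv r w y)) := by
  have h1 : ∀ x t, iteratedDeriv r (fun y => oscIntegral M x t (w y)) y =
      oscIntegral M x t (iteratedDeriv r w y) := fun x t => iteratedDeriv_clm_comp _ hw y
  simp only [mixedDeriv, h1, iteratedDeriv_oscIntegral_right, iteratedDeriv_oscIntegral_left,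
    bandSMul_mul]

end Band

/-! ### Interpolation and folding of the line onto one period -/

section Interpolation

/-- Interpolation between `L²` and `L^∞` from the pointwise bound `‖g‖^p ≤ S^{p-2} ‖g‖²`. The
endpoint `p = ∞` is separate and fits the same formula with `p⁻¹ = 0`. -/
lemma eLpNorm_le_of_sup_of_sq {α F : Type*} [MeasurableSpace α] {ν : Measure α}
    [NormedAddCommGroup F] {g : α → F} {S L : ℝ} (hS : 0 < S) (hL : 0 < L)
    (hs : ∀ x, ‖g x‖ ≤ S) (h2 : ∫⁻ x, ‖g x‖ₑ ^ (2 : ℝ) ∂ν ≤ ENNReal.ofReal (L ^ (2 : ℝ)))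
    {p : ℝ≥0∞} (hp : 2 ≤ p) : eLpNorm g p ν ≤
      ENNReal.ofReal (L ^ (2 * (p⁻¹).toReal) * S ^ (1 - 2 * (p⁻¹).toReal)) := by
  rcases eq_or_ne p ⊤ with rfl | hpt
  · rw [eLpNorm_exponent_top, ENNReal.inv_top, ENNReal.toReal_zero, mul_zero, Real.rpow_zero,
      one_mul, sub_zero, Real.rpow_one]
    exact eLpNormEssSup_le_of_ae_bound (Eventually.of_forall hs)
  have hp0 : p ≠ 0 := (lt_of_lt_of_le (by norm_num) hp).ne'
  rw [eLpNorm_eq_lintegral_rpow_enorm_toReal hp0 hpt, ENNReal.toReal_inv]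
  set r := p.toReal with hr
  have hr2 : 2 ≤ r := by
    have := ENNReal.toReal_mono hpt hp
    simpa using this
  have hr0 : 0 < r := by linarith
  have h3 : ∫⁻ x, ‖g x‖ₑ ^ r ∂ν ≤ ENNReal.ofReal (S ^ (r - 2)) * ENNReal.ofReal (L ^ (2 : ℝ)) := by
    calc ∫⁻ x, ‖g x‖ₑ ^ r ∂ν ≤ ∫⁻ x, ENNReal.ofReal (S ^ (r - 2)) * ‖g x‖ₑ ^ (2 : ℝ) ∂ν := by
          refine lintegral_mono fun x => ?_
          have e : r = (r - 2) + 2 := by ring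
          conv_lhs => rw [e, ENNReal.rpow_add_of_nonneg _ _ (by linarith) (by norm_num)]
          gcongr
          rw [← ENNReal.ofReal_rpow_of_nonneg hS.le (by linarith)]
          refine ENNReal.rpow_le_rpow ?_ (by linarith)
          rw [← ofReal_norm]
          exact ENNReal.ofReal_le_ofReal (hs x)
      _ = ENNReal.ofReal (S ^ (r - 2)) * ∫⁻ x, ‖g x‖ₑ ^ (2 : ℝ) ∂ν :=
          lintegral_const_mul' _ _ ENNReal.ofReal_ne_top
      _ ≤ _ := by gcongr
  refine (ENNReal.rpow_le_rpow h3 (by positivity)).trans_eq ?_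
  rw [← ENNReal.ofReal_mul (by positivity), ENNReal.ofReal_rpow_of_nonneg (by positivity)
    (by positivity), Real.mul_rpow (by positivity) (by positivity), ← Real.rpow_mul hS.le,
    ← Real.rpow_mul hL.le, mul_comm]
  congr 3
  · ring
  · field_simp

lemma lintegral_eq_lintegral_tsum_unit {g : ℝ → ℝ≥0∞} (hg : Measurable g) :
    ∫⁻ x, g x = ∫⁻ x in Ioc (0 : ℝ) 1, ∑' m : ℤ, g (x + m) := by
  rw [lintegral_tsum (f := fun (m : ℤ) x => g (x + m))
      fun m => (hg.comp (measurable_id.add_const _)).aemeasurable,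
    ← setLIntegral_univ, ← iUnion_Ioc_intCast ℝ,
    lintegral_iUnion (fun m => measurableSet_Ioc) (pairwise_disjoint_Ioc_intCast ℝ)]
  refine tsum_congr fun m => ?_
  have h1 := (measurePreserving_add_right (volume : Measure ℝ) (m : ℝ)).setLIntegral_comp_preimage
    (s := Ioc (m : ℝ) (m + 1)) measurableSet_Ioc hg
  rw [← h1]
  congr 2
  ext x
  simp only [mem_preimage, mem_Ioc]
  constructor <;> rintro ⟨h1, h2⟩ <;> constructor <;> linarith

end Interpolation

/-! ### Parseval's identity on a frequency band -/

section Parseval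

variable {d : ℝ}

lemma integral_bandMeasure {E : Type*} [NormedAddCommGroup E] [NormedSpace ℝ E] (f : ℝ → E) :
    ∫ ξ : Icc (-d) d, f ξ ∂bandMeasure d = ∫ ξ in Icc (-d) d, f ξ :=
  integral_subtype_comap measurableSet_Icc f

/-- Parseval's identity on the band. -/
lemma hasSum_sq_integral_band (hd0 : 0 ≤ d) (hd : d < Real.pi) (b : C(Icc (-d) d, ℂ)) :
    HasSum (fun m : ℤ => ‖∫ ξ : Icc (-d) d, Complex.exp (Complex.I * (ξ : ℝ) * m) * b ξ
      ∂bandMeasure d‖ ^ 2) (2 * Real.pi * ∫ ξ, ‖b ξ‖ ^ 2 ∂bandMeasure d) := by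
  have hdd : -d ≤ d := by linarith
  set b' : ℝ → ℂ := fun ξ => b (projIcc (-d) d hdd ξ) with hb'
  have hb'c : Continuous b' := b.continuous.comp continuous_projIcc
  have hb'e : ∀ ξ : Icc (-d) d, b' ξ = b ξ := fun ξ => by rw [hb']; simp
  set B : ℝ → ℂ := (Icc (-d) d).indicator b' with hB
  have hπ : -Real.pi < Real.pi := by linarith [Real.pi_pos]
  have hsub : Icc (-d) d ⊆ Ioc (-Real.pi) Real.pi := fun ξ hξ =>
    ⟨by linarith [hξ.1], by linarith [hξ.2]⟩
  have hI : ∀ {E : Type} [NormedAddCommGroup E] [NormedSpace ℝ E] (F : ℝ → E),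
      ∫ ξ in (-Real.pi)..Real.pi, (Icc (-d) d).indicator F ξ =
        ∫ ξ : Icc (-d) d, F ξ ∂bandMeasure d := fun F => by
    rw [integral_bandMeasure, intervalIntegral.integral_of_le hπ.le,
      setIntegral_indicator measurableSet_Icc, inter_eq_self_of_subset_right hsub]
  have hBm : MemLp B 2 (volume.restrict (Ioc (-Real.pi) Real.pi)) := by
    refine MemLp.of_bound ((hb'c.measurable.indicator measurableSet_Icc).aestronglyMeasurable) ‖b‖
      (Eventually.of_forall fun ξ => ?_)
    rw [hB]
    refine (norm_indicator_le_norm_self _ _).trans ?_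
    exact b.norm_coe_le_norm _
  have h1 := hasSum_sq_fourierCoeffOn hπ hBm
  have h2 : ∫ ξ in (-Real.pi)..Real.pi, ‖B ξ‖ ^ 2 = ∫ ξ, ‖b ξ‖ ^ 2 ∂bandMeasure d := by
    have : (fun ξ => ‖B ξ‖ ^ 2) = (Icc (-d) d).indicator fun ξ => ‖b' ξ‖ ^ 2 := by
      ext ξ
      by_cases hξ : ξ ∈ Icc (-d) d <;> simp [hB, hξ]
    rw [this, hI]
    simp only [hb'e]
  have h3 : ∀ m : ℤ, fourierCoeffOn hπ B m = ((1 / (2 * Real.pi) : ℝ) : ℂ) *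
      ∫ ξ : Icc (-d) d, Complex.exp (Complex.I * (ξ : ℝ) * (-m : ℤ)) * b ξ ∂bandMeasure d := by
    intro m
    rw [fourierCoeffOn_eq_integral]
    have : (fun ξ : ℝ => fourier (-m) (ξ : AddCircle (Real.pi - -Real.pi)) • B ξ) =
        (Icc (-d) d).indicator fun ξ => Complex.exp (Complex.I * ξ * (-m : ℤ)) * b' ξ := by
      ext ξ
      have hpi : (Real.pi : ℂ) ≠ 0 := by exact_mod_cast Real.pi_ne_zero
      have e : 2 * (Real.pi : ℂ) * Complex.I * (-m : ℤ) * ξ / ((Real.pi - -Real.pi : ℝ) : ℂ) =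
          Complex.I * ξ * (-m : ℤ) := by
        push_cast
        field_simp
        ring
      by_cases hξ : ξ ∈ Icc (-d) d
      · simp only [hB, indicator_of_mem hξ, smul_eq_mul, fourier_coe_apply, e]
      · simp [hB, hξ]
    rw [this, hI, Complex.real_smul]
    simp only [hb'e]
    congr 3
    ring
  have h4 := h1.mul_left ((2 * Real.pi) ^ 2)
  -- The `m`-th coefficient carries `e^{-imξ}`; reindexing by `-m` restores the sign of the phase.
  have h5 := (Equiv.neg ℤ).hasSum_iff.2 h4
  rw [h2] at h5
  have e1 : (fun i => (2 * Real.pi) ^ 2 * ‖fourierCoeffOn hπ B i‖ ^ 2) ∘ ⇑(Equiv.neg ℤ) =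
      fun m : ℤ => ‖∫ ξ : Icc (-d) d, Complex.exp (Complex.I * (ξ : ℝ) * m) * b ξ
        ∂bandMeasure d‖ ^ 2 := by
    ext m
    rw [Function.comp_apply, Equiv.neg_apply, h3, neg_neg, norm_mul, Complex.norm_real,
      Real.norm_eq_abs, abs_of_pos (by positivity)]
    generalize ‖∫ ξ : Icc (-d) d, Complex.exp (Complex.I * (ξ : ℝ) * m) * b ξ ∂bandMeasure d‖ = J
    field_simp
  have e2 : ∀ J : ℝ, (2 * Real.pi) ^ 2 * (Real.pi - -Real.pi)⁻¹ • J = 2 * Real.pi * J := fun J => by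
    rw [smul_eq_mul, sub_neg_eq_add, ← two_mul]
    field_simp
  rwa [e1, e2] at h5

end Parseval

/-! ### Parseval for finite-dimensional values -/

section VectorParseval

variable {F : Type*} [NormedAddCommGroup F] [NormedSpace ℂ F]

/-- Parseval in each coordinate of an isomorphism with some `ℂ^N`. The norm of `F`, here an operator
norm, need not be Euclidean; `κ` pays for the comparison and does not depend on the band. -/
lemma exists_tsum_sq_integral_band_le (F : Type*) [NormedAddCommGroup F] [NormedSpace ℂ F]
    [FiniteDimensional ℂ F] : ∃ κ : ℝ, 0 < κ ∧ ∀ {d : ℝ}, 0 ≤ d → d < Real.pi →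
      ∀ b : C(Icc (-d) d, F), ∑' m : ℤ, ‖∫ ξ : Icc (-d) d,
        Complex.exp (Complex.I * (ξ : ℝ) * m) • b ξ ∂bandMeasure d‖ₑ ^ (2 : ℝ) ≤
          ENNReal.ofReal (κ * ∫ ξ, ‖b ξ‖ ^ 2 ∂bandMeasure d) := by
  let e : F ≃L[ℂ] EuclideanSpace ℂ (Fin (Module.finrank ℂ F)) :=
    ContinuousLinearEquiv.ofFinrankEq (by simp)
  set e₁ : F →L[ℂ] EuclideanSpace ℂ (Fin (Module.finrank ℂ F)) :=
    e.toContinuousLinearMap with he₁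
  set e₂ : EuclideanSpace ℂ (Fin (Module.finrank ℂ F)) →L[ℂ] F :=
    e.symm.toContinuousLinearMap with he₂
  let ℓ : Fin (Module.finrank ℂ F) → F →L[ℂ] ℂ := fun i => (EuclideanSpace.proj i).comp e₁
  have hℓ : ∀ v, ∑ i, ‖ℓ i v‖ ^ 2 = ‖e₁ v‖ ^ 2 := fun v =>
    (EuclideanSpace.norm_sq_eq (e₁ v)).symm
  have hv : ∀ v, ‖v‖ ^ 2 ≤ ‖e₂‖ ^ 2 * ∑ i, ‖ℓ i v‖ ^ 2 := fun v => by
    rw [hℓ, ← mul_pow]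
    have h1 : e₂ (e₁ v) = v := e.symm_apply_apply v
    have h2 := e₂.le_opNorm (e₁ v)
    rw [h1] at h2
    gcongr
  refine ⟨‖e₂‖ ^ 2 * (2 * Real.pi * ‖e₁‖ ^ 2) + 1, by positivity, fun {d} hd0 hd b => ?_⟩
  let bi : Fin (Module.finrank ℂ F) → C(Icc (-d) d, ℂ) := fun i => ⟨fun ξ => ℓ i (b ξ), by fun_prop⟩
  set g : ℤ → F := fun m => ∫ ξ : Icc (-d) d, Complex.exp (Complex.I * (ξ : ℝ) * m) • b ξ
    ∂bandMeasure d with hg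
  have hgi : ∀ i m, ℓ i (g m) =
      ∫ ξ : Icc (-d) d, Complex.exp (Complex.I * (ξ : ℝ) * m) * bi i ξ ∂bandMeasure d := by
    intro i m
    rw [hg]
    have hint : Integrable (fun ξ : Icc (-d) d => Complex.exp (Complex.I * (ξ : ℝ) * m) • b ξ)
        (bandMeasure d) := integrable_band
      (⟨fun ξ : Icc (-d) d => Complex.exp (Complex.I * (ξ : ℝ) * m) • b ξ, by fun_prop⟩ :
        C(Icc (-d) d, F))
    simp only
    rw [← (ℓ i).integral_comp_comm hint]
    simp only [map_smul]
    rfl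
  have hsum : HasSum (fun m => ∑ i, ‖ℓ i (g m)‖ ^ 2)
      (∑ i, 2 * Real.pi * ∫ ξ, ‖bi i ξ‖ ^ 2 ∂bandMeasure d) := by
    refine hasSum_sum fun i _ => ?_
    simp only [hgi]
    exact hasSum_sq_integral_band hd0 hd (bi i)
  have hle : ∑ i, 2 * Real.pi * ∫ ξ, ‖bi i ξ‖ ^ 2 ∂bandMeasure d ≤
      2 * Real.pi * ‖e₁‖ ^ 2 * ∫ ξ, ‖b ξ‖ ^ 2 ∂bandMeasure d := by
    have hint : ∀ i, Integrable (fun ξ => ‖bi i ξ‖ ^ 2) (bandMeasure d) := fun i =>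
      integrable_band (⟨fun ξ => ‖bi i ξ‖ ^ 2, by fun_prop⟩ : C(Icc (-d) d, ℝ))
    have hint2 : Integrable (fun ξ => ‖b ξ‖ ^ 2) (bandMeasure d) :=
      integrable_band (⟨fun ξ => ‖b ξ‖ ^ 2, by fun_prop⟩ : C(Icc (-d) d, ℝ))
    rw [← Finset.mul_sum, ← integral_finsetSum _ fun i _ => hint i, mul_assoc (2 * Real.pi) (‖e₁‖ ^ 2), 
      ← integral_const_mul (‖e₁‖ ^ 2)]
    refine mul_le_mul_of_nonneg_left ?_ (by positivity)
    refine integral_mono (integrable_finsetSum _ fun i _ => hint i) (hint2.const_mul _) fun ξ => ?_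
    refine (hℓ (b ξ)).le.trans ?_
    rw [← mul_pow]
    gcongr
    exact e₁.le_opNorm _
  have hJ : 0 ≤ ∫ ξ, ‖b ξ‖ ^ 2 ∂bandMeasure d := integral_nonneg fun ξ => by positivity
  calc ∑' m : ℤ, ‖g m‖ₑ ^ (2 : ℝ)
      ≤ ∑' m : ℤ, ENNReal.ofReal (‖e₂‖ ^ 2 * ∑ i, ‖ℓ i (g m)‖ ^ 2) := by
        refine ENNReal.tsum_le_tsum fun m => ?_
        rw [← ofReal_norm, ENNReal.ofReal_rpow_of_nonneg (norm_nonneg _) zero_le_two,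
          Real.rpow_two]
        exact ENNReal.ofReal_le_ofReal (hv _)
    _ = ENNReal.ofReal (∑' m : ℤ, ‖e₂‖ ^ 2 * ∑ i, ‖ℓ i (g m)‖ ^ 2) :=
        (ENNReal.ofReal_tsum_of_nonneg (fun m => by positivity) (hsum.mul_left _).summable).symm
    _ ≤ _ := by
        rw [(hsum.mul_left _).tsum_eq]
        refine ENNReal.ofReal_le_ofReal ?_
        have h1 := mul_le_mul_of_nonneg_left hle (by positivity : 0 ≤ ‖e₂‖ ^ 2)
        linarith

end VectorParseval

/-! ### Gaussian moments over the band -/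

section Gaussian

lemma integrable_abs_pow_mul_exp (m : ℕ) {b : ℝ} (hb : 0 < b) :
    Integrable fun x : ℝ => |x| ^ m * Real.exp (-b * x ^ 2) := by
  have h1 := (integrable_rpow_mul_exp_neg_mul_sq hb (s := m) (by
    have : (0 : ℝ) ≤ m := Nat.cast_nonneg m
    linarith)).norm
  refine h1.congr (Eventually.of_forall fun x => ?_)
  simp only [norm_mul, Real.rpow_natCast, norm_pow, Real.norm_eq_abs, Real.abs_exp]

/-- Parabolic scaling `x ↦ √s x`; each power of `|x|` is worth `s^{-1/2}`. -/
lemma integral_abs_pow_mul_exp (m : ℕ) (θ : ℝ) {s : ℝ} (hs : 0 < s) :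
    ∫ x : ℝ, |x| ^ m * Real.exp (-(θ * s) * x ^ 2) =
      (∫ x : ℝ, |x| ^ m * Real.exp (-θ * x ^ 2)) * s ^ (-((m : ℝ) + 1) / 2) := by
  have h1 := Measure.integral_comp_mul_left (fun x : ℝ => |x| ^ m * Real.exp (-θ * x ^ 2))
    (Real.sqrt s)
  have hs' : 0 < Real.sqrt s := Real.sqrt_pos.2 hs
  have h2 : ∀ x : ℝ, |Real.sqrt s * x| ^ m * Real.exp (-θ * (Real.sqrt s * x) ^ 2) =
      Real.sqrt s ^ m * (|x| ^ m * Real.exp (-(θ * s) * x ^ 2)) := by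
    intro x
    rw [abs_mul, abs_of_pos hs', mul_pow, mul_pow, Real.sq_sqrt hs.le]
    ring_nf
  simp only [h2] at h1
  rw [integral_const_mul, abs_of_pos (inv_pos.2 hs'), smul_eq_mul] at h1
  have h3 : s ^ (-((m : ℝ) + 1) / 2) = (Real.sqrt s ^ m)⁻¹ * (Real.sqrt s)⁻¹ := by
    rw [← mul_inv, ← pow_succ, Real.sqrt_eq_rpow, ← Real.rpow_natCast, ← Real.rpow_mul hs.le,
      ← Real.rpow_neg hs.le]
    congr 1
    push_cast
    ring
  rw [h3]
  have h4 : (Real.sqrt s ^ m) ≠ 0 := by positivity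
  field_simp
  field_simp at h1
  linarith

/-- On a bounded band `1 ≤ e^{θd²} e^{-θξ²}`, so `t` may be replaced by `1 + t` at fixed cost. This
keeps the bound finite as `t → 0`. -/
lemma exists_integral_band_gaussian_le (d : ℝ) {θ : ℝ} (hθ : 0 < θ) (m : ℕ) :
    ∃ C : ℝ, 0 < C ∧ ∀ t : ℝ, 0 < t →
      ∫ ξ : Icc (-d) d, |(ξ : ℝ)| ^ m * Real.exp (-θ * (ξ : ℝ) ^ 2 * t) ∂bandMeasure d ≤
        C * (1 + t) ^ (-((m : ℝ) + 1) / 2) := by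
  set J := ∫ x : ℝ, |x| ^ m * Real.exp (-θ * x ^ 2) with hJ
  have hJ0 : 0 ≤ J := integral_nonneg fun x => by positivity
  refine ⟨Real.exp (θ * d ^ 2) * J + 1, by positivity, fun t ht => ?_⟩
  rw [integral_bandMeasure fun ξ : ℝ => |ξ| ^ m * Real.exp (-θ * ξ ^ 2 * t)]
  have hint := (integrable_abs_pow_mul_exp m (b := θ * (1 + t)) (by positivity)).const_mul
    (Real.exp (θ * d ^ 2))
  calc ∫ ξ in Icc (-d) d, |ξ| ^ m * Real.exp (-θ * ξ ^ 2 * t)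
      ≤ ∫ ξ in Icc (-d) d, Real.exp (θ * d ^ 2) *
          (|ξ| ^ m * Real.exp (-(θ * (1 + t)) * ξ ^ 2)) := by
        refine setIntegral_mono_on ?_ hint.integrableOn measurableSet_Icc fun ξ hξ => ?_
        · exact (by fun_prop : Continuous fun ξ : ℝ => |ξ| ^ m * Real.exp (-θ * ξ ^ 2 * t)).integrableOn_Icc
        · have h1 : ξ ^ 2 ≤ d ^ 2 := sq_le_sq' hξ.1 hξ.2
          have h2 : Real.exp (-θ * ξ ^ 2 * t) ≤
              Real.exp (θ * d ^ 2) * Real.exp (-(θ * (1 + t)) * ξ ^ 2) := by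
            rw [← Real.exp_add, Real.exp_le_exp]
            nlinarith
          calc |ξ| ^ m * Real.exp (-θ * ξ ^ 2 * t)
              ≤ |ξ| ^ m * (Real.exp (θ * d ^ 2) * Real.exp (-(θ * (1 + t)) * ξ ^ 2)) := by gcongr
            _ = _ := by ring
    _ ≤ ∫ ξ, Real.exp (θ * d ^ 2) * (|ξ| ^ m * Real.exp (-(θ * (1 + t)) * ξ ^ 2)) :=
        setIntegral_le_integral hint (Eventually.of_forall fun ξ => by positivity)
    _ = Real.exp (θ * d ^ 2) * J * (1 + t) ^ (-((m : ℝ) + 1) / 2) := by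
        rw [integral_const_mul, integral_abs_pow_mul_exp m θ (by positivity)]
        ring
    _ ≤ _ := by
        have : 0 ≤ (1 + t) ^ (-((m : ℝ) + 1) / 2) := by positivity
        nlinarith

end Gaussian

/-! ### Diffusive decay in `L^p` -/

section OscDecay

variable {F : Type*} [NormedAddCommGroup F] [NormedSpace ℂ F] {d θ : ℝ}

lemma norm_exp_phase_le {M : ℂ} {ξ x t : ℝ} (hM : M.re ≤ -θ * ξ ^ 2) (ht : 0 ≤ t) :
    ‖Complex.exp (Complex.I * ξ * x + M * t)‖ ≤ Real.exp (-θ * ξ ^ 2 * t) := by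
  rw [Complex.norm_exp, Real.exp_le_exp]
  simp only [Complex.add_re, Complex.mul_re, Complex.I_re, Complex.I_im, Complex.ofReal_re,
    Complex.ofReal_im, mul_zero, zero_mul, sub_zero, zero_add, Complex.mul_im]
  exact mul_le_mul_of_nonneg_right hM ht

lemma continuous_oscIntegral (M : C(Icc (-d) d, ℂ)) (t : ℝ)
    (a : C(UnitAddCircle, C(Icc (-d) d, F))) : Continuous fun x : ℝ => oscIntegral M x t (a x) := by
  have h1 : Continuous fun x : ℝ => a x := a.continuous.comp (AddCircle.continuous_mk' 1)
  exact (contDiff_oscIntegral M (m := 0) contDiff_id contDiff_const (contDiff_zero.2 h1)).continuous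

/-- Diffusive decay of oscillatory integrals with periodic amplitudes that vanish to order `m` at
zero frequency. -/
theorem exists_eLpNorm_oscIntegral_le [FiniteDimensional ℂ F] (hd0 : 0 ≤ d) (hd : d < Real.pi)
    (hθ : 0 < θ) {M : C(Icc (-d) d, ℂ)} (hM : ∀ ξ, (M ξ).re ≤ -θ * (ξ : ℝ) ^ 2) (m : ℕ) (C₀ : ℝ) :
    ∃ C : ℝ, ∀ a : C(UnitAddCircle, C(Icc (-d) d, F)),
      (∀ x ξ, ‖a x ξ‖ ≤ C₀ * |(ξ : ℝ)| ^ m) → ∀ (p : ℝ≥0∞) (t : ℝ), 2 ≤ p → 0 < t →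
        eLpNorm (fun x : ℝ => oscIntegral M x t (a x)) p volume ≤ ENNReal.ofReal
          (C * (1 + t) ^ (-(1 / 2 : ℝ) * (1 - (p⁻¹).toReal) - (m : ℝ) / 2)) := by
  obtain ⟨C₁, hC₁, h1⟩ := exists_integral_band_gaussian_le d hθ m
  obtain ⟨C₂, hC₂, h2⟩ := exists_integral_band_gaussian_le d (by positivity : 0 < 2 * θ) (2 * m)
  obtain ⟨κ, hκ, hpar⟩ := exists_tsum_sq_integral_band_le F
  set D := |C₀| + 1 with hD
  have hD0 : 0 < D := by positivity
  set B := max (D * C₁) (Real.sqrt (κ * (D ^ 2 * C₂))) with hB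
  have hB0 : 0 < B := lt_of_lt_of_le (by positivity) (le_max_left _ _)
  refine ⟨B, fun a ha p t hp ht => ?_⟩
  have ha' : ∀ (x : ℝ) (ξ : Icc (-d) d), ‖phase M x t ξ • a x ξ‖ ≤
      D * (|(ξ : ℝ)| ^ m * Real.exp (-θ * (ξ : ℝ) ^ 2 * t)) := fun x ξ => by
    rw [norm_smul, phase_apply]
    have e1 := norm_exp_phase_le (x := x) (hM ξ) ht.le
    have e2 : ‖a x ξ‖ ≤ D * |(ξ : ℝ)| ^ m := (ha x ξ).trans (by
      gcongr
      exact (le_abs_self _).trans (by linarith))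
    calc _ ≤ Real.exp (-θ * (ξ : ℝ) ^ 2 * t) * (D * |(ξ : ℝ)| ^ m) := by gcongr
      _ = _ := by ring
  have hcont : ∀ (k : ℕ) (η : ℝ), Integrable
      (fun ξ : Icc (-d) d => |(ξ : ℝ)| ^ k * Real.exp (-η * (ξ : ℝ) ^ 2 * t)) (bandMeasure d) :=
    fun k η => integrable_band
      (⟨fun ξ : Icc (-d) d => |(ξ : ℝ)| ^ k * Real.exp (-η * (ξ : ℝ) ^ 2 * t), by fun_prop⟩ :
        C(Icc (-d) d, ℝ))
  have hs0 : 0 < 1 + t := by linarith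
  have hsup : ∀ x : ℝ, ‖oscIntegral M x t (a x)‖ ≤ B * (1 + t) ^ (-((m : ℝ) + 1) / 2) := by
    intro x
    rw [oscIntegral_eq, bandIntegral_apply]
    refine (norm_integral_le_of_norm_le ((hcont m θ).const_mul D)
      (Eventually.of_forall (ha' x))).trans ?_
    rw [integral_const_mul]
    calc _ ≤ D * (C₁ * (1 + t) ^ (-((m : ℝ) + 1) / 2)) :=
          mul_le_mul_of_nonneg_left (h1 t ht) hD0.le
      _ = D * C₁ * (1 + t) ^ (-((m : ℝ) + 1) / 2) := by ring
      _ ≤ _ := by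
          gcongr
          exact le_max_left _ _
  -- Plancherel in `x` does not apply directly, since the amplitude depends on `x`. On each fibre `x
  -- + ℤ` the amplitude is constant and Parseval gives a bound uniform in `x`, which is then
  -- integrated over one period.
  have hsq : ∫⁻ x : ℝ, ‖oscIntegral M x t (a x)‖ₑ ^ (2 : ℝ) ≤
      ENNReal.ofReal ((B * (1 + t) ^ (-((m : ℝ) + 1 / 2) / 2)) ^ (2 : ℝ)) := by
    have hmeas : Measurable fun x : ℝ => ‖oscIntegral M x t (a x)‖ₑ ^ (2 : ℝ) := by
      have := (continuous_oscIntegral M t a).enorm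
      exact this.measurable.pow_const _
    rw [lintegral_eq_lintegral_tsum_unit hmeas]
    have hx : ∀ x : ℝ, ∑' k : ℤ, ‖oscIntegral M (x + k) t (a ((x + k : ℝ) : UnitAddCircle))‖ₑ ^ (2 : ℝ) ≤
        ENNReal.ofReal ((B * (1 + t) ^ (-((m : ℝ) + 1 / 2) / 2)) ^ (2 : ℝ)) := by
      intro x
      have e1 : ∀ k : ℤ, oscIntegral M (x + k) t (a ((x + k : ℝ) : UnitAddCircle)) =
          ∫ ξ : Icc (-d) d, Complex.exp (Complex.I * (ξ : ℝ) * k) •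
            (bandSMul F d (phase M x t) (a x)) ξ ∂bandMeasure d := by
        intro k
        have e2 : ((x + k : ℝ) : UnitAddCircle) = x := by
          rw [AddCircle.coe_add]
          have : ((k : ℝ) : UnitAddCircle) = 0 := by
            rw [AddCircle.coe_eq_zero_iff]
            exact ⟨k, by simp⟩
          rw [this, add_zero]
        rw [e2, oscIntegral_apply]
        congr 1
        ext1 ξ
        rw [bandSMul_apply, phase_apply, smul_smul, ← Complex.exp_add]
        congr 2
        push_cast
        ring
      simp only [e1]
      refine (hpar hd0 hd _).trans (ENNReal.ofReal_le_ofReal ?_)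
      have e3 : ∫ ξ, ‖(bandSMul F d (phase M x t) (a x)) ξ‖ ^ 2 ∂bandMeasure d ≤
          D ^ 2 * (C₂ * (1 + t) ^ (-(((2 * m : ℕ) : ℝ) + 1) / 2)) := by
        refine le_trans ?_ (mul_le_mul_of_nonneg_left (h2 t ht) (by positivity))
        rw [← integral_const_mul]
        refine integral_mono (integrable_band
          (⟨fun ξ => ‖(bandSMul F d (phase M x t) (a x)) ξ‖ ^ 2, by fun_prop⟩ : C(Icc (-d) d, ℝ)))
          ((hcont _ _).const_mul _) fun ξ => ?_
        have e4 := pow_le_pow_left₀ (norm_nonneg _) (ha' x ξ) 2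
        refine e4.trans_eq ?_
        rw [mul_pow, mul_pow, ← Real.exp_nat_mul, ← pow_mul]
        simp only [Nat.cast_ofNat]
        ring_nf
      calc _ ≤ κ * (D ^ 2 * (C₂ * (1 + t) ^ (-(((2 * m : ℕ) : ℝ) + 1) / 2))) :=
            mul_le_mul_of_nonneg_left e3 hκ.le
        _ = (Real.sqrt (κ * (D ^ 2 * C₂)) * (1 + t) ^ (-((m : ℝ) + 1 / 2) / 2)) ^ (2 : ℝ) := by
            rw [Real.mul_rpow (by positivity) (by positivity), ← Real.rpow_mul hs0.le, Real.rpow_two,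
              Real.sq_sqrt (by positivity)]
            have : -(((2 * m : ℕ) : ℝ) + 1) / 2 = -((m : ℝ) + 1 / 2) / 2 * 2 := by
              push_cast
              ring
            rw [this]
            ring
        _ ≤ _ := by
            gcongr
            exact le_max_right _ _
    calc _ ≤ ∫⁻ x in Ioc (0 : ℝ) 1,
          ENNReal.ofReal ((B * (1 + t) ^ (-((m : ℝ) + 1 / 2) / 2)) ^ (2 : ℝ)) :=
          lintegral_mono fun x => hx x
      _ = _ := by simp
  -- The rates `(m+1)/2` in `L^∞` and `(m+1/2)/2` in `L²` interpolate to `(m+1)/2 - 1/(2p)`, which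
  -- is the claimed exponent.
  refine (eLpNorm_le_of_sup_of_sq (by positivity) (by positivity) hsup hsq hp).trans_eq ?_
  congr 1
  rw [Real.mul_rpow hB0.le (by positivity), Real.mul_rpow hB0.le (by positivity),
    ← Real.rpow_mul hs0.le, ← Real.rpow_mul hs0.le]
  have e1 : ∀ P Q R S : ℝ, P * Q * (R * S) = P * R * (Q * S) := fun _ _ _ _ => by ring
  rw [e1, ← Real.rpow_add hB0, ← Real.rpow_add hs0]
  have e2 : 2 * (p⁻¹).toReal + (1 - 2 * (p⁻¹).toReal) = 1 := by ring
  rw [e2, Real.rpow_one]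
  congr 2
  ring

end OscDecay

/-! ### Kernel estimates, splitting and Fubini -/

section KernelEstimates

variable {F F₁ F₂ F₃ : Type*} [NormedAddCommGroup F] [NormedSpace ℂ F]
  [NormedAddCommGroup F₁] [NormedSpace ℂ F₁] [NormedAddCommGroup F₂] [NormedSpace ℂ F₂]
  [NormedAddCommGroup F₃] [NormedSpace ℂ F₃] {d θ : ℝ}

/-- The amplitude `ξ ↦ φ(ξ) e^{-iξy} P(y,ξ)`. -/
def amplitude (χ : C(Icc (-d) d, ℂ)) (P : ℝ → C(Icc (-d) d, F)) (y : ℝ) : C(Icc (-d) d, F) :=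
  bandSMul F d (χ * phase 0 (-y) 0) (P y)

lemma amplitude_apply (χ : C(Icc (-d) d, ℂ)) (P : ℝ → C(Icc (-d) d, F)) (y : ℝ) (ξ : Icc (-d) d) :
    amplitude χ P y ξ = (χ ξ * Complex.exp (-(Complex.I * (ξ : ℝ) * y))) • P y ξ := by
  rw [amplitude, bandSMul_apply, ContinuousMap.mul_apply, phase_apply]
  congr 3
  simp

lemma contDiff_amplitude (χ : C(Icc (-d) d, ℂ)) {P : ℝ → C(Icc (-d) d, F)} {m : ℕ∞ω}
    (hP : ContDiff ℝ m P) : ContDiff ℝ m (amplitude χ P) :=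
  contDiff_pointwiseBilin _ (contDiff_const.mul (contDiff_phase 0 contDiff_neg contDiff_const)) hP

/-- The unimodular multiplier `e^{-iξ}`. -/
def bandShift (F : Type*) [NormedAddCommGroup F] [NormedSpace ℂ F] (d : ℝ) :
    C(Icc (-d) d, F) →L[ℂ] C(Icc (-d) d, F) := bandSMul F d (phase 0 (-1) 0)

lemma norm_bandShift (f : C(Icc (-d) d, F)) : ‖bandShift F d f‖ = ‖f‖ := by
  have h1 : ∀ ξ, ‖bandShift F d f ξ‖ = ‖f ξ‖ := fun ξ => by
    rw [bandShift, bandSMul_apply, norm_smul, phase_apply]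
    have e : Complex.I * (ξ : ℝ) * ((-1 : ℝ) : ℂ) + (0 : C(Icc (-d) d, ℂ)) ξ * ((0 : ℝ) : ℂ) =
        ((-(ξ : ℝ) : ℝ) : ℂ) * Complex.I := by
      have h0 : (0 : C(Icc (-d) d, ℂ)) ξ = 0 := rfl
      rw [h0]
      push_cast
      ring
    rw [e, Complex.norm_exp_ofReal_mul_I, one_mul]
  apply le_antisymm
  · rw [ContinuousMap.norm_le _ (norm_nonneg _)]
    exact fun ξ => (h1 ξ).trans_le (f.norm_coe_le_norm ξ)
  · rw [ContinuousMap.norm_le _ (norm_nonneg _)]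
    exact fun ξ => (h1 ξ).symm.trans_le ((bandShift F d f).norm_coe_le_norm ξ)

/-- The factor `e^{-iξy}` destroys periodicity in `y`, but only by a fixed isometry. Hence norms of
`y`-derivatives are periodic, and compactness of one period bounds them on the whole line. -/
lemma amplitude_add_one (χ : C(Icc (-d) d, ℂ)) {P : ℝ → C(Icc (-d) d, F)}
    (hP : Function.Periodic P 1) (y : ℝ) :
    amplitude χ P (y + 1) = bandShift F d (amplitude χ P y) := by
  ext ξ
  rw [bandShift, bandSMul_apply, amplitude_apply, amplitude_apply, hP, phase_apply, smul_smul]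
  congr 1
  rw [mul_comm (Complex.exp _) (χ ξ * _), mul_assoc (χ ξ), ← Complex.exp_add]
  congr 2
  push_cast
  ring

lemma exists_norm_iteratedDeriv_amplitude_le (χ : C(Icc (-d) d, ℂ)) {P : ℝ → C(Icc (-d) d, F)}
    (hP : Function.Periodic P 1) {r : ℕ} (hPc : ContDiff ℝ r P) :
    ∃ B, ∀ y, ‖iteratedDeriv r (amplitude χ P) y‖ ≤ B := by
  have hc := contDiff_amplitude χ hPc
  have hcont : Continuous fun y => ‖iteratedDeriv r (amplitude χ P) y‖ :=
    (hc.continuous_iteratedDeriv r le_rfl).norm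
  have hper : Function.Periodic (fun y => ‖iteratedDeriv r (amplitude χ P) y‖) 1 := by
    intro y
    have h1 := congrFun (iteratedDeriv_comp_add_const r (amplitude χ P) (1 : ℝ)) y
    have h2 : (fun y => amplitude χ P (y + 1)) = fun y => bandShift F d (amplitude χ P y) :=
      funext fun y => amplitude_add_one χ hP y
    rw [h2, iteratedDeriv_clm_comp _ hc] at h1
    simp only
    rw [← h1, norm_bandShift]
  obtain ⟨B, hB⟩ := (isCompact_Icc (a := (0 : ℝ)) (b := 1)).bddAbove_image hcont.continuousOn
  refine ⟨B, fun y => ?_⟩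
  obtain ⟨z, hz, hyz⟩ := hper.exists_mem_Ico₀ one_pos y
  rw [hyz]
  exact hB ⟨z, ⟨hz.1, hz.2.le⟩, rfl⟩

lemma contDiff_iteratedDeriv_oscIntegral (M : C(Icc (-d) d, ℂ)) {w : ℝ → C(Icc (-d) d, F)}
    {m : ℕ∞ω} (hw : ContDiff ℝ m w) (k : ℕ) : ContDiff ℝ m fun z : ℝ × ℝ × ℝ =>
      iteratedDeriv k (fun t => oscIntegral M z.1 t (w z.2.2)) z.2.1 := by
  simp only [iteratedDeriv_oscIntegral_right]
  exact contDiff_oscIntegral M contDiff_fst (contDiff_fst.comp contDiff_snd)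
    (contDiff_clm_comp _ (hw.comp (contDiff_snd.comp contDiff_snd)))

/-- Decay of the mixed derivatives of the kernel. -/
theorem exists_eLpNorm_mixedDeriv_oscIntegral_le [FiniteDimensional ℂ F] (hd0 : 0 ≤ d)
    (hd : d < Real.pi) (hθ : 0 < θ) {M : C(Icc (-d) d, ℂ)}
    (hM : ∀ ξ, (M ξ).re ≤ -θ * (ξ : ℝ) ^ 2) {CM : ℝ} (hMl : ∀ ξ, ‖M ξ‖ ≤ CM * |(ξ : ℝ)|)
    {w : ℝ → C(Icc (-d) d, F)} {r : ℕ} (hw : ContDiff ℝ r w) {B : ℝ}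
    (hB : ∀ y, ‖iteratedDeriv r w y‖ ≤ B) (j k : ℕ) :
    ∃ C : ℝ, ∀ (p : ℝ≥0∞) (t : ℝ), 2 ≤ p → 0 < t → ∀ y : ℝ,
      eLpNorm (fun x => mixedDeriv j k r (fun x t y => oscIntegral M x t (w y)) x t y) p volume ≤
        ENNReal.ofReal (C * (1 + t) ^
          (-(1 / 2 : ℝ) * (1 - (p⁻¹).toReal) - ((j : ℝ) + k) / 2)) := by
  -- The derivatives `∂_x^j ∂_t^k` insert `(iξ)^j M(ξ)^k`, which vanishes to order `j + k` at `ξ =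
  -- 0`.
  obtain ⟨C, hC⟩ := exists_eLpNorm_oscIntegral_le (F := F) hd0 hd hθ hM (j + k) (CM ^ k * B)
  refine ⟨C, fun p t hp ht y => ?_⟩
  simp only [mixedDeriv_oscIntegral M hw]
  have h1 := hC (ContinuousMap.const UnitAddCircle
    (bandSMul F d (bandX d ^ j * M ^ k) (iteratedDeriv r w y))) (fun x ξ => ?_) p t hp ht
  · push_cast at h1
    exact h1
  · rw [ContinuousMap.const_apply, bandSMul_apply, norm_smul]
    have e1 : ‖(bandX d ^ j * M ^ k) ξ‖ = |(ξ : ℝ)| ^ j * ‖M ξ‖ ^ k := by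
      rw [ContinuousMap.mul_apply, ContinuousMap.pow_apply, ContinuousMap.pow_apply, norm_mul,
        norm_pow, norm_pow, bandX_apply, norm_mul, Complex.norm_I, one_mul, Complex.norm_real,
        Real.norm_eq_abs]
    have e2 : ‖iteratedDeriv r w y ξ‖ ≤ B := ((iteratedDeriv r w y).norm_coe_le_norm ξ).trans (hB y)
    have hCM : 0 ≤ CM * |(ξ : ℝ)| := (norm_nonneg _).trans (hMl ξ)
    rw [e1]
    calc _ ≤ |(ξ : ℝ)| ^ j * (CM * |(ξ : ℝ)|) ^ k * B := by
          gcongr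
          exact hMl ξ
      _ = _ := by
          rw [mul_pow, pow_add]
          ring

/-- Decay of a kernel `∫ e^{iξx + M(ξ)t} b(w(y,ξ), R(x,ξ)) dξ` with `R(x,ξ) = O(ξ)`. -/
theorem exists_eLpNorm_bilin_oscIntegral_le [FiniteDimensional ℂ F₃] (b : F₁ →L[ℂ] F₂ →L[ℂ] F₃)
    (hd0 : 0 ≤ d) (hd : d < Real.pi) (hθ : 0 < θ) {M : C(Icc (-d) d, ℂ)}
    (hM : ∀ ξ, (M ξ).re ≤ -θ * (ξ : ℝ) ^ 2) {w : ℝ → C(Icc (-d) d, F₁)} {B : ℝ}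
    (hB : ∀ y, ‖w y‖ ≤ B) {R : C(UnitAddCircle, C(Icc (-d) d, F₂))} {CR : ℝ}
    (hR : ∀ x ξ, ‖R x ξ‖ ≤ CR * |(ξ : ℝ)|) :
    ∃ C : ℝ, ∀ (p : ℝ≥0∞) (t : ℝ), 2 ≤ p → 0 < t → ∀ y : ℝ,
      eLpNorm (fun x : ℝ => oscIntegral M x t (pointwiseBilin (Icc (-d) d) b (w y) (R x)))
        p volume ≤ ENNReal.ofReal
          (C * (1 + t) ^ (-(1 / 2 : ℝ) * (1 - (p⁻¹).toReal) - 1 / 2)) := by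
  obtain ⟨C, hC⟩ := exists_eLpNorm_oscIntegral_le (F := F₃) hd0 hd hθ hM 1 (‖b‖ * B * CR)
  refine ⟨C, fun p t hp ht y => ?_⟩
  have h1 := hC ⟨fun x => pointwiseBilin (Icc (-d) d) b (w y) (R x), by fun_prop⟩
    (fun x ξ => ?_) p t hp ht
  · rw [Nat.cast_one] at h1
    exact h1
  · have hB0 : 0 ≤ B := (norm_nonneg _).trans (hB y)
    refine (b.le_opNorm₂ (w y ξ) (R x ξ)).trans ?_
    calc _ ≤ ‖b‖ * B * (CR * |(ξ : ℝ)|) := by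
          gcongr
          · exact ((w y).norm_coe_le_norm ξ).trans (hB y)
          · exact hR x ξ
      _ = _ := by rw [pow_one]; ring

lemma oscIntegral_bilin_const [CompleteSpace F₁] [CompleteSpace F₃] (b : F₁ →L[ℂ] F₂ →L[ℂ] F₃)
    (M : C(Icc (-d) d, ℂ)) (x t : ℝ)
    (w : C(Icc (-d) d, F₁)) (v : F₂) :
    oscIntegral M x t (pointwiseBilin (Icc (-d) d) b w (constMapCLM (Icc (-d) d) v)) =
      b (oscIntegral M x t w) v := by
  rw [oscIntegral_eq, oscIntegral_eq, bandIntegral_apply, bandIntegral_apply]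
  have h1 := (b.flip v).integral_comp_comm (integrable_band (bandSMul F₁ d (phase M x t) w))
  have h2 : b (∫ ξ, bandSMul F₁ d (phase M x t) w ξ ∂bandMeasure d) v =
      b.flip v (∫ ξ, bandSMul F₁ d (phase M x t) w ξ ∂bandMeasure d) := rfl
  rw [h2, ← h1]
  refine integral_congr_ae (Eventually.of_forall fun ξ => ?_)
  simp only [bandSMul_apply, pointwiseBilin_apply, constMapCLM_apply, map_smul,
    ContinuousLinearMap.flip_apply]

/-- The decomposition of the kernel in abstract form: freezing the second factor at a value `v`
independent of `ξ` pulls it out of the integral, and the error carries `R - v`. -/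
lemma oscIntegral_bilin_eq_add [CompleteSpace F₁] [CompleteSpace F₃] (b : F₁ →L[ℂ] F₂ →L[ℂ] F₃)
    (M : C(Icc (-d) d, ℂ)) (x t : ℝ) (w : C(Icc (-d) d, F₁)) (R : C(Icc (-d) d, F₂)) (v : F₂) :
    oscIntegral M x t (pointwiseBilin (Icc (-d) d) b w R) = b (oscIntegral M x t w) v +
      oscIntegral M x t (pointwiseBilin (Icc (-d) d) b w (R - constMapCLM (Icc (-d) d) v)) := by
  rw [map_sub, map_sub, oscIntegral_bilin_const, add_sub_cancel]

lemma continuous_bilin_oscIntegral (b : F₁ →L[ℂ] F₂ →L[ℂ] F₃) (M : C(Icc (-d) d, ℂ)) (t : ℝ)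
    {w : ℝ → C(Icc (-d) d, F₁)} (hw : Continuous w) (R : C(UnitAddCircle, C(Icc (-d) d, F₂))) :
    Continuous fun z : ℝ × ℝ =>
      oscIntegral M z.1 t (pointwiseBilin (Icc (-d) d) b (w z.2) (R z.1)) := by
  have h1 : Continuous fun z : ℝ × ℝ => R z.1 :=
    R.continuous.comp ((AddCircle.continuous_mk' 1).comp continuous_fst)
  have h2 : Continuous fun z : ℝ × ℝ => w z.2 := hw.comp continuous_snd
  exact (contDiff_oscIntegral M (m := 0) contDiff_fst contDiff_const
    (contDiff_pointwiseBilin b (contDiff_zero.2 h2) (contDiff_zero.2 h1))).continuous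

/-- Fubini for kernels of the form `∫ e^{iξx + M(ξ)t} w(y,ξ) ⊗ R(ξ) dξ` acting on integrable
functions. -/
lemma integral_smulRight_oscIntegral {E : Type*} [NormedAddCommGroup E] [NormedSpace ℂ E]
    [CompleteSpace E] (M : C(Icc (-d) d, ℂ)) (x t : ℝ) {w : ℝ → C(Icc (-d) d, E →L[ℂ] ℂ)}
    (hw : Continuous w) {B : ℝ} (hB : ∀ y, ‖w y‖ ≤ B) (R : C(Icc (-d) d, E)) {g : ℝ → E}
    (hg : Continuous g) (hgi : Integrable g) :
    Integrable (fun y => oscIntegral M x t (pointwiseBilin (Icc (-d) d)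
        (ContinuousLinearMap.smulRightL ℂ E E) (w y) R) (g y)) ∧
      ∫ y, oscIntegral M x t (pointwiseBilin (Icc (-d) d)
        (ContinuousLinearMap.smulRightL ℂ E E) (w y) R) (g y) =
      ∫ ξ : Icc (-d) d, (phase M x t ξ * ∫ y, w y ξ (g y)) • R ξ ∂bandMeasure d := by
  -- The whole `y`-dependence is an integrable function with values in `C([-d,d])`. Exchanging the
  -- two integrals is then commuting a bounded linear map with a Bochner integral.
  let v : ℝ → C(Icc (-d) d, ℂ) := fun y => pointwiseBilin (Icc (-d) d)
    (ContinuousLinearMap.id ℂ (E →L[ℂ] ℂ)) (w y) (constMapCLM (Icc (-d) d) (g y))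
  have hv : ∀ y ξ, v y ξ = w y ξ (g y) := fun y ξ => rfl
  have hvc : Continuous v := (contDiff_pointwiseBilin (ContinuousLinearMap.id ℂ (E →L[ℂ] ℂ))
    (contDiff_zero.2 hw) (contDiff_constMapCLM (contDiff_zero.2 hg))).continuous
  have hvi : Integrable v := by
    refine (hgi.norm.const_mul B).mono' hvc.aestronglyMeasurable (Eventually.of_forall fun y => ?_)
    have hB0 : 0 ≤ B := (norm_nonneg (w y)).trans (hB y)
    rw [ContinuousMap.norm_le _ (by positivity)]
    intro ξ
    rw [hv]
    refine ((w y ξ).le_opNorm (g y)).trans ?_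
    gcongr
    exact ((w y).norm_coe_le_norm ξ).trans (hB y)
  let L : C(Icc (-d) d, ℂ) →L[ℂ] E := (bandIntegral E d).comp
    (((bandSMul E d).flip R).comp (ContinuousLinearMap.mul ℂ C(Icc (-d) d, ℂ) (phase M x t)))
  have hL : ∀ s, L s = ∫ ξ, (phase M x t ξ * s ξ) • R ξ ∂bandMeasure d := fun s => rfl
  have hker : ∀ y, oscIntegral M x t (pointwiseBilin (Icc (-d) d)
      (ContinuousLinearMap.smulRightL ℂ E E) (w y) R) (g y) = L (v y) := by
    intro y
    rw [oscIntegral_eq, bandIntegral_apply, hL, ContinuousLinearMap.integral_apply (integrable_band _)]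
    refine integral_congr_ae (Eventually.of_forall fun ξ => ?_)
    simp only [bandSMul_apply, pointwiseBilin_apply, smul_apply, hv, mul_smul]
    rfl
  simp only [hker]
  refine ⟨L.integrable_comp hvi, ?_⟩
  rw [L.integral_comp_comm hvi, hL]
  refine integral_congr_ae (Eventually.of_forall fun ξ => ?_)
  simp only
  congr 2
  exact (ContinuousMap.evalCLM ℂ ξ).integral_comp_comm hvi |>.symm

end KernelEstimates

/-! ### The low-frequency kernel and its decomposition -/

section LowFrequency

lemma integral_eq_integral_bandMeasure {E : Type*} [NormedAddCommGroup E] [NormedSpace ℝ E] {d : ℝ}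
    {F : ℝ → E} (h : ∀ ξ ∉ Icc (-d) d, F ξ = 0) :
    ∫ ξ, F ξ = ∫ ξ : Icc (-d) d, F ξ ∂bandMeasure d := by
  rw [integral_bandMeasure, setIntegral_eq_integral_of_forall_compl_eq_zero h]

lemma intervalIntegral_eq_integral_bandMeasure {E : Type*} [NormedAddCommGroup E] [NormedSpace ℝ E]
    {d : ℝ} (hd : d < Real.pi) {F : ℝ → E} (h : ∀ ξ ∉ Icc (-d) d, F ξ = 0) :
    ∫ ξ in (-Real.pi)..Real.pi, F ξ = ∫ ξ : Icc (-d) d, F ξ ∂bandMeasure d := by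
  have hsub : Icc (-d) d ⊆ Ioc (-Real.pi) Real.pi := fun ξ hξ =>
    ⟨by linarith [hξ.1], by linarith [hξ.2]⟩
  rw [intervalIntegral.integral_of_le (by linarith [Real.pi_pos]), ← integral_eq_integral_bandMeasure h]
  exact setIntegral_eq_integral_of_forall_compl_eq_zero fun ξ hξ => h ξ fun h' => hξ (hsub h')

variable {n K : ℕ} {c : ℝ} {f : EuclideanSpace ℝ (Fin n) → EuclideanSpace ℝ (Fin n)}
  {u : ℝ → EuclideanSpace ℝ (Fin n)} {δ d : ℝ} {mu : ℝ → ℂ} {q : ℝ → C(UnitAddCircle, Cn n)}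
  {qt : ℝ → C(UnitAddCircle, Cn n →L[ℂ] ℂ)} {φ : ℝ → ℝ}

lemma eTilde_eq_oscIntegral {M χ : C(Icc (-d) d, ℂ)} (hM : ∀ ξ : Icc (-d) d, M ξ = mu ξ)
    (hχ : ∀ ξ : Icc (-d) d, χ ξ = 1 / (2 * Real.pi) * (φ ξ : ℂ))
    {P : C(UnitAddCircle, C(Icc (-d) d, Cn n →L[ℂ] ℂ))}
    (hP : ∀ (x : UnitAddCircle) (ξ : Icc (-d) d), P x ξ = qt ξ x)
    (hφ : ∀ ξ ∉ Icc (-d) d, φ ξ = 0) (x t y : ℝ) :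
    eTilde mu φ qt x t y = oscIntegral M x t (amplitude χ (fun y : ℝ => P y) y) := by
  rw [eTilde, oscIntegral_apply, integral_eq_integral_bandMeasure (d := d), ← integral_smul]
  · refine integral_congr_ae (Eventually.of_forall fun ξ => ?_)
    simp only
    rw [amplitude_apply, hP, hχ, hM, smul_smul, smul_smul]
    congr 1
    rw [sub_eq_add_neg, mul_add, Complex.exp_add, Complex.exp_add, mul_neg]
    ring
  · intro ξ hξ
    rw [hφ ξ hξ, Complex.ofReal_zero, mul_zero, zero_mul]
    exact zero_smul ℂ (qt ξ (y : UnitAddCircle))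

/-- The Bloch-transform definition of the low-frequency operator as an oscillatory kernel. -/
lemma IsCriticalBranch.lowFreqOp_eq (hK : 1 ≤ K) (hf : ContDiff ℝ K f)
    (hu : IsPeriodicProfile c f u) (hb : IsCriticalBranch c f u δ mu q qt) (hdδ : d < δ)
    (hdπ : d < Real.pi)
    (hproj : ∀ ξ ∈ Icc (-d) d, eigenprojection (linBloch c f u ξ) (mu ξ) =
      (rowCLM n (qt ξ)).smulRight (toL2per (q ξ)))
    {M χ : C(Icc (-d) d, ℂ)} (hM : ∀ ξ : Icc (-d) d, M ξ = mu ξ)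
    (hχ : ∀ ξ : Icc (-d) d, χ ξ = 1 / (2 * Real.pi) * (φ ξ : ℂ))
    {P : C(UnitAddCircle, C(Icc (-d) d, Cn n →L[ℂ] ℂ))}
    (hP : ∀ (x : UnitAddCircle) (ξ : Icc (-d) d), P x ξ = qt ξ x)
    {R : C(UnitAddCircle, C(Icc (-d) d, Cn n))}
    (hR : ∀ (x : UnitAddCircle) (ξ : Icc (-d) d), R x ξ = q ξ x)
    (hφ : ∀ ξ ∉ Icc (-d) d, φ ξ = 0) {t : ℝ} (ht : 0 ≤ t) (g : 𝓢(ℝ, Cn n)) (x : ℝ) :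
    lowFreqOp c f u mu φ t g x = ∫ ξ : Icc (-d) d,
      (phase M x t ξ * ∫ y : ℝ, amplitude χ (fun y : ℝ => P y) y ξ (g y)) •
        R (x : UnitAddCircle) ξ ∂bandMeasure d := by
  rw [lowFreqOp, intervalIntegral_eq_integral_bandMeasure hdπ, ← integral_smul]
  · refine integral_congr_ae (Eventually.of_forall fun ξ => ?_)
    have hξ : (ξ : ℝ) ∈ Ioo (-δ) δ := ⟨by linarith [ξ.2.1], by linarith [ξ.2.2]⟩
    have h1 : ∫ y : ℝ, amplitude χ (fun y : ℝ => P y) y ξ (g y) =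
        χ ξ * ∫ y : ℝ, Complex.exp (-(Complex.I * (ξ : ℝ) * y)) * qt ξ y (g y) := by
      rw [← integral_const_mul]
      refine integral_congr_ae (Eventually.of_forall fun y => ?_)
      simp only
      rw [amplitude_apply, hP, smul_apply, smul_eq_mul, mul_assoc]
    simp only
    rw [hb.contRep_eigenprojection_expSemigroup hK hf hu hξ (hproj ξ ξ.2) ht,
      rowCLM_blochTransform, h1, hR, hχ, phase_apply, hM, smul_smul, smul_smul]
    congr 1
    rw [Complex.exp_add]
    ring
  · intro ξ hξ
    rw [hφ ξ hξ, Complex.ofReal_zero, mul_zero, zero_smul]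

/-- Differentiability at zero frequency, together with `mu 0 = 0`; these first-order bounds are the
source of the extra decay. -/
lemma IsCriticalBranch.exists_norm_sub_le (hb : IsCriticalBranch c f u δ mu q qt) :
    ∃ C : ℝ, ∀ᶠ ξ in 𝓝 (0 : ℝ), ‖q ξ - q 0‖ ≤ C * |ξ| ∧ ‖mu ξ‖ ≤ C * |ξ| := by
  have h0 : (0 : ℝ) ∈ Ioo (-δ) δ := ⟨neg_neg_of_pos hb.pos, hb.pos⟩
  obtain ⟨C₁, h₁⟩ := (hb.analytic_q 0 h0).differentiableAt.isBigO_sub.bound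
  obtain ⟨C₂, h₂⟩ := (hb.analytic_mu 0 h0).differentiableAt.isBigO_sub.bound
  refine ⟨max C₁ C₂, ?_⟩
  filter_upwards [h₁, h₂] with ξ h₁ h₂
  rw [sub_zero, Real.norm_eq_abs] at h₁ h₂
  rw [hb.mu_zero, sub_zero] at h₂
  exact ⟨h₁.trans (by gcongr; exact le_max_left _ _), h₂.trans (by gcongr; exact le_max_right _ _)⟩

/-- The statement about a critical branch, on a band `[-d, d]` where the branch is controlled. -/
theorem IsCriticalBranch.lowFreq_decomposition (hK : 1 ≤ K) (hf : ContDiff ℝ K f)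
    (hu : IsPeriodicProfile c f u) (hb : IsCriticalBranch c f u δ mu q qt) (hd0 : 0 ≤ d)
    (hdδ : d < δ) (hdπ : d < Real.pi)
    (hproj : ∀ ξ ∈ Icc (-d) d, eigenprojection (linBloch c f u ξ) (mu ξ) =
      (rowCLM n (qt ξ)).smulRight (toL2per (q ξ)))
    {C₀ : ℝ} (hq : ∀ ξ ∈ Icc (-d) d, ‖q ξ - q 0‖ ≤ C₀ * |ξ|)
    (hmu : ∀ ξ ∈ Icc (-d) d, ‖mu ξ‖ ≤ C₀ * |ξ|) {θ : ℝ} (hθ : 0 < θ)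
    (hre : ∀ ξ ∈ Icc (-d) d, (mu ξ).re ≤ -θ * ξ ^ 2)
    (hφc : Continuous φ) (hφ : ∀ ξ ∉ Icc (-d) d, φ ξ = 0) :
    (∃ G Gt : ℝ → ℝ → ℝ → (Cn n →L[ℂ] Cn n),
      IsLowFreqGreenKernel c f u mu φ G ∧
      (∀ x t y : ℝ, 0 < t → G x t y =
        (eTilde mu φ qt x t y).smulRight (toCn (deriv u x)) + Gt x t y) ∧
      ∃ C : ℝ, ∀ (p : ℝ≥0∞) (t : ℝ), 2 ≤ p → 0 < t →
        ⨆ y : ℝ, eLpNorm (fun x => Gt x t y) p volume ≤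
          ENNReal.ofReal
            (C * (1 + t) ^ (-(1 / 2 : ℝ) * (1 - (p⁻¹).toReal) - 1 / 2))) ∧
    (∀ k : ℕ, ContDiff ℝ (K + 1 : ℕ) (fun z : ℝ × ℝ × ℝ =>
      iteratedDeriv k (fun t => eTilde mu φ qt z.1 t z.2.2) z.2.1)) ∧
    ∀ j k r : ℕ, j + r ≤ K + 1 →
      ∃ C : ℝ, ∀ (p : ℝ≥0∞) (t : ℝ), 2 ≤ p → 0 < t →
        ⨆ y : ℝ, eLpNorm (fun x => mixedDeriv j k r (eTilde mu φ qt) x t y) p volume ≤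
          ENNReal.ofReal
            (C * (1 + t) ^
              (-(1 / 2 : ℝ) * (1 - (p⁻¹).toReal) - ((j : ℝ) + k) / 2)) := by
  have hmem : ∀ ξ : Icc (-d) d, (ξ : ℝ) ∈ Ioo (-δ) δ := fun ξ =>
    ⟨by linarith [ξ.2.1], by linarith [ξ.2.2]⟩
  have hmuc : Continuous fun ξ : Icc (-d) d => mu ξ :=
    hb.analytic_mu.continuousOn.comp_continuous continuous_subtype_val hmem
  have hqc : Continuous fun ξ : Icc (-d) d => q ξ :=
    hb.analytic_q.continuousOn.comp_continuous continuous_subtype_val hmem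
  obtain ⟨P, hP, hPc⟩ := hb.exists_regular_left hK hf hu hdδ
  let M : C(Icc (-d) d, ℂ) := ⟨fun ξ => mu ξ, hmuc⟩
  let χ : C(Icc (-d) d, ℂ) := ⟨fun ξ => 1 / (2 * Real.pi) * (φ ξ : ℂ), by fun_prop⟩
  let qI : C(Icc (-d) d, C(UnitAddCircle, Cn n)) := ⟨fun ξ => q ξ, hqc⟩
  let R : C(UnitAddCircle, C(Icc (-d) d, Cn n)) :=
    ContinuousMap.curry ⟨fun z : UnitAddCircle × Icc (-d) d => qI z.2 z.1, by fun_prop⟩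
  -- The difference `q(x,ξ) - q(x,0) = O(ξ)`, amplitude of the faster-decaying part of the kernel.
  let Rt : C(UnitAddCircle, C(Icc (-d) d, Cn n)) :=
    R - ⟨fun x => constMapCLM (Icc (-d) d) (q 0 x), by fun_prop⟩
  have hM : ∀ ξ : Icc (-d) d, M ξ = mu ξ := fun ξ => rfl
  have hχ : ∀ ξ : Icc (-d) d, χ ξ = 1 / (2 * Real.pi) * (φ ξ : ℂ) := fun ξ => rfl
  have hR : ∀ (x : UnitAddCircle) (ξ : Icc (-d) d), R x ξ = q ξ x := fun x ξ => rfl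
  have hRtb : ∀ x ξ, ‖Rt x ξ‖ ≤ C₀ * |(ξ : ℝ)| := fun x ξ =>
    ((q ξ - q 0).norm_coe_le_norm x).trans (hq ξ ξ.2)
  have hPp : Function.Periodic (fun y : ℝ => P y) 1 := fun y => by
    simp only [AddCircle.coe_add_period]
  let w := amplitude χ (fun y : ℝ => P y)
  have hwc : ContDiff ℝ (K + 1 : ℕ) w := contDiff_amplitude χ hPc
  have hwb : ∀ r : ℕ, r ≤ K + 1 → ∃ B, ∀ y, ‖iteratedDeriv r w y‖ ≤ B := fun r hr =>
    exists_norm_iteratedDeriv_amplitude_le χ hPp (hPc.of_le (by exact_mod_cast hr))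
  obtain ⟨B, hB⟩ := hwb 0 (Nat.zero_le _)
  simp only [iteratedDeriv_zero] at hB
  have hMre : ∀ ξ, (M ξ).re ≤ -θ * (ξ : ℝ) ^ 2 := fun ξ => hre ξ ξ.2
  have hMl : ∀ ξ, ‖M ξ‖ ≤ C₀ * |(ξ : ℝ)| := fun ξ => hmu ξ ξ.2
  have he : eTilde mu φ qt = fun x t y => oscIntegral M x t (w y) := by
    funext x t y
    exact eTilde_eq_oscIntegral hM hχ hP hφ x t y
  let b := ContinuousLinearMap.smulRightL ℂ (Cn n) (Cn n)
  refine ⟨⟨fun x t y => oscIntegral M x t (pointwiseBilin (Icc (-d) d) b (w y) (R x)),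
    fun x t y => oscIntegral M x t (pointwiseBilin (Icc (-d) d) b (w y) (Rt x)),
    fun t ht => ⟨continuous_bilin_oscIntegral b M t hwc.continuous R, fun g x => ?_⟩,
    fun x t y _ => ?_, ?_⟩, ?_, ?_⟩
  · obtain ⟨h1, h2⟩ := integral_smulRight_oscIntegral M x t hwc.continuous hB (R x)
      g.continuous g.integrable
    refine ⟨h1, ?_⟩
    rw [h2]
    exact hb.lowFreqOp_eq hK hf hu hdδ hdπ hproj hM hχ hP hR hφ ht.le g x
  · simp only
    rw [he, ← hb.q_zero]
    exact oscIntegral_bilin_eq_add (F₁ := Cn n →L[ℂ] ℂ) (F₃ := Cn n →L[ℂ] Cn n) b M x t (w y) (R x)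
      (q 0 x)
  · obtain ⟨C, hC⟩ := exists_eLpNorm_bilin_oscIntegral_le b hd0 hdπ hθ hMre hB hRtb
    exact ⟨C, fun p t hp ht => iSup_le (hC p t hp ht)⟩
  · intro k
    rw [he]
    exact contDiff_iteratedDeriv_oscIntegral M hwc k
  · intro j k r hjr
    have hr : r ≤ K + 1 := by omega
    obtain ⟨B', hB'⟩ := hwb r hr
    obtain ⟨C, hC⟩ := exists_eLpNorm_mixedDeriv_oscIntegral_le hd0 hdπ hθ hMre hMl
      (hwc.of_le (by exact_mod_cast hr)) hB' j k
    rw [he]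
    exact ⟨C, fun p t hp ht => iSup_le (hC p t hp ht)⟩

end LowFrequency

end

end BlochRD

theorem proposition3p2 (n K : ℕ) (hK : 2 ≤ K) (c : ℝ)
    (f : EuclideanSpace ℝ (Fin n) → EuclideanSpace ℝ (Fin n)) (hf : ContDiff ℝ K f)
    (u : ℝ → EuclideanSpace ℝ (Fin n)) (hu : BlochRD.IsPeriodicProfile c f u)
    (hD1 : BlochRD.CondD1 c f u) (hD2 : BlochRD.CondD2 c f u) :
    (∃ (δ : ℝ) (mu : ℝ → ℂ) (q : ℝ → C(UnitAddCircle, BlochRD.Cn n))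
      (qt : ℝ → C(UnitAddCircle, BlochRD.Cn n →L[ℂ] ℂ)),
      BlochRD.IsCriticalBranch c f u δ mu q qt) ∧
    ∀ (δ : ℝ) (mu : ℝ → ℂ) (q : ℝ → C(UnitAddCircle, BlochRD.Cn n))
      (qt : ℝ → C(UnitAddCircle, BlochRD.Cn n →L[ℂ] ℂ)),
      BlochRD.IsCriticalBranch c f u δ mu q qt →
      ∃ ε₀ : ℝ, 0 < ε₀ ∧ 2 * ε₀ < δ ∧ ∀ ε : ℝ, 0 < ε → ε ≤ ε₀ →
        ∀ φ : ℝ → ℝ, BlochRD.IsCutoff ε φ →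
        (∃ G Gt : ℝ → ℝ → ℝ → (BlochRD.Cn n →L[ℂ] BlochRD.Cn n),
          BlochRD.IsLowFreqGreenKernel c f u mu φ G ∧
          (∀ x t y : ℝ, 0 < t → G x t y =
            (BlochRD.eTilde mu φ qt x t y).smulRight (BlochRD.toCn (deriv u x)) + Gt x t y) ∧
          ∃ C : ℝ, ∀ (p : ℝ≥0∞) (t : ℝ), 2 ≤ p → 0 < t →
            ⨆ y : ℝ, eLpNorm (fun x => Gt x t y) p volume ≤
              ENNReal.ofReal
                (C * (1 + t) ^ (-(1 / 2 : ℝ) * (1 - (p⁻¹).toReal) - 1 / 2))) ∧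
        (∀ k : ℕ, ContDiff ℝ (K + 1 : ℕ) (fun z : ℝ × ℝ × ℝ =>
          iteratedDeriv k (fun t => BlochRD.eTilde mu φ qt z.1 t z.2.2) z.2.1)) ∧
        ∀ j k r : ℕ, j + r ≤ K + 1 →
          ∃ C : ℝ, ∀ (p : ℝ≥0∞) (t : ℝ), 2 ≤ p → 0 < t →
            ⨆ y : ℝ, eLpNorm (fun x =>
              BlochRD.mixedDeriv j k r (BlochRD.eTilde mu φ qt) x t y) p volume ≤
              ENNReal.ofReal
                (C * (1 + t) ^
                  (-(1 / 2 : ℝ) * (1 - (p⁻¹).toReal) - ((j : ℝ) + k) / 2)) := by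
  refine ⟨BlochRD.exists_isCriticalBranch (by omega) hf hu hD1, fun δ mu q qt hb => ?_⟩
  obtain ⟨θ, hθ, hspec⟩ := hD2
  obtain ⟨C₀, hC₀⟩ := hb.exists_norm_sub_le
  obtain ⟨ρ, hρ, hball⟩ := Metric.eventually_nhds_iff.1
    ((hb.eventually_eigenprojection (by omega) hf hu hD1).and hC₀)
  -- The band must lie inside the domain of the branch, inside `(-π, π)` for Parseval and the
  -- spectral bound, and where the projection formula and first-order bounds hold.
  obtain ⟨d, hd0, hd⟩ : ∃ d : ℝ, 0 < d ∧ d < min δ (min Real.pi ρ) :=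
    exists_between (lt_min hb.pos (lt_min Real.pi_pos hρ))
  have hdδ : d < δ := hd.trans_le (min_le_left _ _)
  have hdπ : d < Real.pi := hd.trans_le ((min_le_right _ _).trans (min_le_left _ _))
  have hdρ : d < ρ := hd.trans_le ((min_le_right _ _).trans (min_le_right _ _))
  have hnear : ∀ ξ ∈ Icc (-d) d, dist ξ 0 < ρ := fun ξ hξ => by
    rw [dist_zero_right, Real.norm_eq_abs]
    exact (abs_le.2 hξ).trans_lt hdρ
  -- With `ε ≤ d/2` the cut-off vanishes off `[-d, d]`.
  refine ⟨d / 2, by linarith, by linarith, fun ε _ hε φ hφ => ?_⟩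
  refine hb.lowFreq_decomposition (d := d) (by omega) hf hu hd0.le hdδ hdπ
    (fun ξ hξ => (hball (hnear ξ hξ)).1) (fun ξ hξ => (hball (hnear ξ hξ)).2.1)
    (fun ξ hξ => (hball (hnear ξ hξ)).2.2) hθ
    (fun ξ hξ => hb.re_mu_le ⟨by linarith [hξ.1], by linarith [hξ.2]⟩
      ⟨by linarith [hξ.1], by linarith [hξ.2]⟩ hspec)
    hφ.smooth.continuous fun ξ hξ => hφ.zero ξ ?_
  by_contra h
  exact hξ (abs_le.1 (by linarith))
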